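/- **Setting.** $\log$ is the binary logarithm (with $\log 0:=0$) and $\log^*$ the iterated binary logarithm. A *run-length ACFG* $\mathcal G=(\Sigma,\mathcal V,\mathcal D,S)$ consists of a finite set $\mathcal V$ of positive integers (variables), a start symbol $S\in\mathcal V$, and for every $e\in\mathcal V$ exactly one assignment in $\mathcal D$, of the form $e\to a\in\Sigma$, or $e\to e_\ell e_r$, or $e\to\hat e^{\,d}$ with $d\ge 1$, where variables on the right-hand side belong to $\mathcal V$ and are smaller than $e$; different variables have different right-hand sides, and every variable other than $S$ occurs in the right-hand side of the assignment of some larger variable. $\mathrm{val}(e)\in\Sigma^+$ is the string derived by $e$. $\mathrm{Sig}(x)$ is the variable whose assignment has the right-hand side $x$ (if any); for blocks of three or four variables $\mathrm{Sig}(x_1\cdots x_m)=\mathrm{Sig}(\mathrm{Sig}(x_1\cdots x_{m-1})\,x_m)$, and blocks of any other length than 2, 3, 4 have no signature. $\mathrm{Sig}^+$ applies $\mathrm{Sig}$ entry by entry. A sequence $p[1..n]$ is *$W$-colored* if its entries lie in $\{0,\dots,W\}$ and adjacent entries differ. Put $\Delta_L=\log^*W+6$, $\Delta_R=4$. A *locally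 consistent parsing function* for $W$ is a function $f:[-1..W]^{\log^*W+11}\to\{0,1\}$ such that for every $W$-colored $p$ the bits $d[i]=f(p[i-\Delta_L],\dots,p[i+\Delta_R])$ (entries outside $p$ read as $-1$) satisfy $d[1]=1$; $d[i]+d[i+1]\le1$ for $1\le i<n$; and $d[i]+d[i+1]+d[i+2]+d[i+3]\ge1$ for $1\le i<n-3$. $\mathrm{Eblock}(p)$ cuts $p$ in front of every position $i$ with $d[i]=1$, and $\mathrm{Epow}(s)$ groups the maximal runs of $s$ as powers $a^r$, $r\ge1$. $\mathcal G$ is the *signature encoding* of $T$ (with respect to $f$) if in $\mathrm{Shrink}_0=\mathrm{Sig}^+(T)$, $\mathrm{Pow}_t=\mathrm{Sig}^+(\mathrm{Epow}(\mathrm{Shrink}_t))$, $\mathrm{Shrink}_{t+1}=\mathrm{Sig}^+(\mathrm{Eblock}(\mathrm{Pow}_t))$ everything is defined up to the least $h$ with $|\mathrm{Pow}_h|=1$, and $\mathrm{Pow}_h=S$. The *DAG* of $\mathcal G$ is stored in the (read-only) input memory of a unit-cost word RAM: the node of $e$ is a record at an arbitrary address (different for different variables) that holds the kind of the assignment of $e$,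 pointers to the nodes of its children (and the exponent $d$, for a run), and $|\mathrm{val}(e)|$. Apart from this the RAM has registers and a read/write working memory with arbitrary initial content; its unit-cost instructions are constants, moves, $+,-,\times$, integer division, indirect reads and writes, and (conditional) jumps. For strings $s_1,s_2$, $\mathsf{LCE}(s_1,s_2,i,j)$ is the length of the longest common prefix of $s_1[i..|s_1|]$ and $s_2[j..|s_2|]$; $s^R$ is the reversal of $s$. **Statement.** There are two fixed RAM programs, one for forward and one for backward queries, and a constant $k$ such that for every $K$ there is a constant $C$ with the following property. Let $M\ge1$, let $T$ be a string with $|T|\le M$ over any alphabet, and let $\mathcal G=(\Sigma,\mathcal V,\mathcal D,S)$ be the signature encoding of $T$ with respect to any locally consistent parsing function for some $W\le KM$, where all signatures $e\in\mathcal V$ are at most $W$. Let the word size be at least $\lfloor\log M\rfloor+k$ bits, and let the DAG of $\mathcal G$ be stored as above. Given (the nodes of) any signatures $e_1,e_2\in\mathcal V$, with $s_1=\mathrm{val}(e_1)$, $s_2=\mathrm{val}(e_2)$, and any integers $1\le i\le|s_1|$, $1\le j\le|s_2|$, the first program outputs $\mathsf{LCE}(s_1,s_2,i,j)$ and the second one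 outputs $\mathsf{LCE}(s_1^R,s_2^R,i,j)$, each within $$C\,\bigl(\log|s_1|+\log|s_2|+\log\ell\,\log^*M+1\bigr)$$ steps, where $\ell$ is the answer to the respective query. (This holds even with all logarithms in the bound rounded down.) -/

import Mathlib

/-! ### Strings -/

/-- The length of the longest common prefix of two strings. -/
def lcp {α : Type*} [DecidableEq α] : List α → List α → ℕ
  | a :: u, b :: v => if a = b then lcp u v + 1 else 0
  | _, _ => 0

/-- `LCE (s₁, s₂, i, j)`: the longest common prefix length of `s₁[i..]` and `s₂[j..]`
(positions are counted from `1`). -/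
def LCE {α : Type*} [DecidableEq α] (s₁ s₂ : List α) (i j : ℕ) : ℕ :=
  lcp (s₁.drop (i - 1)) (s₂.drop (j - 1))

/-- The iterated binary logarithm: the least `k` such that the `k`-fold iterated `log₂` of `n` is at
most `1`.  For integers, rounding up in each round does not change this number. -/
def logStar (n : ℕ) : ℕ :=
  if h : n ≤ 1 then 0 else logStar (Nat.clog 2 n) + 1
termination_by n
decreasing_by
  obtain ⟨m, rfl⟩ : ∃ m, n = m + 1 := ⟨n - 1, by omega⟩
  have h2 : m < 2 ^ m := Nat.lt_two_pow_self
  have : Nat.clog 2 (m + 1) ≤ m := Nat.clog_le_of_le_pow (by omega)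
  omega

/-! ### Locally consistent parsing -/

/-- The number of symbols of left context, `Δ_L = log* W + 6`. -/
def deltaL (W : ℕ) : ℕ := logStar W + 6

/-- Functions on windows of `Δ_L + 1 + Δ_R = log* W + 11` symbols (where `Δ_R = 4`), the symbol `-1`
standing for a position outside the sequence. -/
abbrev WindowFun (W : ℕ) : Type := (Fin (logStar W + 11) → ℤ) → Bool

/-- The sequence `p` (indexed from `0`) padded with `-1` on both sides. -/
def padded (p : List ℕ) (j : ℤ) : ℤ :=
  if 0 ≤ j ∧ j < p.length then ((p.getD j.toNat 0 : ℕ) : ℤ) else -1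

/-- The bit `d[i] = f (p[i - Δ_L], …, p[i + Δ_R])`, positions counted from `0`. -/
def parseBit {W : ℕ} (f : WindowFun W) (p : List ℕ) (i : ℕ) : Bool :=
  f fun k => padded p ((i : ℤ) + (k : ℤ) - (deltaL W : ℤ))

/-- `p` is a `W`-colored sequence: entries in `0..W`, adjacent entries different. -/
def IsColored (W : ℕ) (p : List ℕ) : Prop :=
  (∀ x ∈ p, x ≤ W) ∧ p.IsChain (· ≠ ·)

/-- `f` is a locally consistent parsing function for `W`-colored sequences.  With positions counted
from `1` the clauses read: `d[1] = 1`; `d[i] + d[i+1] ≤ 1` for `1 ≤ i < n`;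
`d[i] + d[i+1] + d[i+2] + d[i+3] ≥ 1` for `1 ≤ i < n - 3`. -/
structure IsLocallyConsistent {W : ℕ} (f : WindowFun W) : Prop where
  first : ∀ p, IsColored W p → p ≠ [] → parseBit f p 0 = true
  sparse : ∀ p, IsColored W p → ∀ i, i + 1 < p.length →
    ¬ (parseBit f p i = true ∧ parseBit f p (i + 1) = true)
  dense : ∀ p, IsColored W p → ∀ i, i + 4 < p.length →
    parseBit f p i = true ∨ parseBit f p (i + 1) = true ∨
      parseBit f p (i + 2) = true ∨ parseBit f p (i + 3) = true

/-- `Eblock`: cut `p` in front of every position whose bit is `1`. -/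
def eblock {W : ℕ} (f : WindowFun W) (p : List ℕ) : List (List ℕ) :=
  (p.zipIdx.splitBy fun _ y => !parseBit f p y.2).map fun q => q.map Prod.fst

/-- `Epow`: the maximal runs `a ^ r` of `s`, as pairs `(a, r)`. -/
def epow (s : List ℕ) : List (ℕ × ℕ) :=
  (s.splitBy fun x y => x == y).map fun q => (q.headD 0, q.length)

/-! ### Run-length admissible context free grammars -/

/-- Right-hand sides of assignments: a character, `e_l e_r`, or `e ^ d`. -/
inductive Rhs (α : Type*) where
  | char (a : α) : Rhs α
  | pair (l r : ℕ) : Rhs α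
  | run (e d : ℕ) : Rhs α

/-- The variables occurring in a right-hand side. -/
def Rhs.varsOf {α : Type*} : Rhs α → Set ℕ
  | .char _ => ∅
  | .pair l r => {l, r}
  | .run e _ => {e}

/-- Run-length ACFGs over the alphabet `α`.  The assignments are `e → rhs e` for `e ∈ vars`; the
value of `rhs` off `vars` plays no role.  Runs `e ^ 1` are admitted: they occur in signature
encodings. -/
structure RunLengthACFG (α : Type*) where
  vars : Finset ℕ
  rhs : ℕ → Rhs α
  start : ℕ
  start_mem : start ∈ vars
  pos : ∀ e ∈ vars, 0 < e
  rhs_mem : ∀ e ∈ vars, ∀ x ∈ (rhs e).varsOf, x ∈ vars ∧ x < e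
  run_pos : ∀ e ∈ vars, ∀ x d, rhs e = .run x d → 1 ≤ d
  /-- Every variable but the start symbol is used. -/
  used : ∀ e ∈ vars, e ≠ start → ∃ e' ∈ vars, e < e' ∧ e ∈ (rhs e').varsOf
  /-- `Sig` is a function: no right-hand side is assigned to two variables. -/
  rhs_injOn : Set.InjOn rhs vars

namespace RunLengthACFG

variable {α : Type*} (G : RunLengthACFG α)

/-- The string derived by a variable (the `else` branches are never taken on `G.vars`). -/
def val (e : ℕ) : List α :=
  match G.rhs e with
  | .char a => [a]
  | .pair l r => if _h : l < e ∧ r < e then val l ++ val r else []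
  | .run x d => if _h : x < e then (List.replicate d (val x)).flatten else []
termination_by e
decreasing_by
  · exact _h.1
  · exact _h.2
  · exact _h

/-- `Sig(x) = e` for `x` a right-hand side. -/
def IsSig (x : Rhs α) (e : ℕ) : Prop := e ∈ G.vars ∧ G.rhs e = x

/-- `Sig(q) = e` for a block `q` of two to four variables; `Sig` is applied from left to right, and
it is undefined on blocks of any other length. -/
def IsSigBlock : List ℕ → ℕ → Prop
  | [a, b], e => G.IsSig (.pair a b) e
  | [a, b, c], e => ∃ x, G.IsSig (.pair a b) x ∧ G.IsSig (.pair x c) e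
  | [a, b, c, d], e =>
      ∃ x y, G.IsSig (.pair a b) x ∧ G.IsSig (.pair x c) y ∧ G.IsSig (.pair y d) e
  | _, _ => False

/-- `G` is the signature encoding of `T` for the parsing function `f`: all of
`Shrink₀ = Sig⁺(T)`, `Pow_t = Sig⁺(Epow(Shrink_t))`, `Shrink_{t+1} = Sig⁺(Eblock(Pow_t))` are defined
up to the first `h` with `|Pow_h| = 1`, and `Pow_h` is the start symbol.  (`Forall₂` states
that `Sig⁺` applied to the first sequence is the second one.) -/
def IsSignatureEncoding {W : ℕ} (f : WindowFun W) (T : List α) : Prop :=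
  ∃ (h : ℕ) (shrink pow : ℕ → List ℕ),
    List.Forall₂ (fun a e => G.IsSig (.char a) e) T (shrink 0) ∧
    (∀ t ≤ h, List.Forall₂ (fun q e => G.IsSig (.run q.1 q.2) e) (epow (shrink t)) (pow t)) ∧
    (∀ t < h, List.Forall₂ G.IsSigBlock (eblock f (pow t)) (shrink (t + 1))) ∧
    (∀ t < h, (pow t).length ≠ 1) ∧
    pow h = [G.start]

end RunLengthACFG

/-! ### The unit-cost word RAM -/

/-- Instructions; all arguments are register numbers, except the constant `k` and the jump
targets `l`. -/
inductive Instr where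
  | const (r k : ℕ)
  | move (r s : ℕ)
  | add (r s t : ℕ)
  | sub (r s t : ℕ)
  | mul (r s t : ℕ)
  | div (r s t : ℕ)
  /-- `r := input[s]` -/
  | read (r s : ℕ)
  /-- `r := work[s]` -/
  | load (r s : ℕ)
  /-- `work[r] := s` -/
  | store (r s : ℕ)
  | jump (l : ℕ)
  /-- jump to `l` if `s = t` -/
  | jeq (s t l : ℕ)
  /-- jump to `l` if `s < t` -/
  | jlt (s t l : ℕ)

/-- A program is a finite list of instructions; it does not depend on the input or on the word
size. -/
abbrev Program : Type := List Instr

/-- The configurations of the RAM with words of `b` bits. -/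
structure Config (b : ℕ) where
  pc : ℕ
  reg : ℕ → BitVec b
  work : BitVec b → BitVec b

namespace Config

variable {b : ℕ}

/-- Write a register and go to the next instruction. -/
def setReg (c : Config b) (r : ℕ) (x : BitVec b) : Config b :=
  { c with pc := c.pc + 1, reg := Function.update c.reg r x }

/-- Execute one instruction; `input` is the read-only memory. -/
def exec (input : BitVec b → BitVec b) (c : Config b) : Instr → Config b
  | .const r k => c.setReg r (BitVec.ofNat b k)
  | .move r s => c.setReg r (c.reg s)
  | .add r s t => c.setReg r (c.reg s + c.reg t)
  | .sub r s t => c.setReg r (c.reg s - c.reg t)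
  | .mul r s t => c.setReg r (c.reg s * c.reg t)
  | .div r s t => c.setReg r (BitVec.udiv (c.reg s) (c.reg t))
  | .read r s => c.setReg r (input (c.reg s))
  | .load r s => c.setReg r (c.work (c.reg s))
  | .store r s =>
      { c with pc := c.pc + 1, work := Function.update c.work (c.reg r) (c.reg s) }
  | .jump l => { c with pc := l }
  | .jeq s t l => { c with pc := if c.reg s = c.reg t then l else c.pc + 1 }
  | .jlt s t l => { c with pc := if (c.reg s).toNat < (c.reg t).toNat then l else c.pc + 1 }

/-- One step of unit cost; the machine has halted when the program counter has left the program. -/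
def step (P : Program) (input : BitVec b → BitVec b) (c : Config b) : Config b :=
  match P[c.pc]? with
  | some ins => c.exec input ins
  | none => c

end Config

/-- Started in `c`, the program `P` halts after at most `n` steps with the number `v` in
register `0`. -/
def ComputesWithin {b : ℕ} (P : Program) (input : BitVec b → BitVec b) (c : Config b)
    (v n : ℕ) : Prop :=
  ∃ t ≤ n, P[((Config.step P input)^[t] c).pc]? = none ∧
    (((Config.step P input)^[t] c).reg 0).toNat = v

/-- `input` holds the DAG of `G`, the node of the variable `e` being stored from address `addr e`
on: the kind of its assignment (`0`, `1`, `2`), two fields for the assignment (pointers to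
both children, or a pointer to the only child and the exponent), and `|val(e)|`.  Nothing is said about
any other cell of the memory. -/
structure HoldsDAG {α : Type*} (G : RunLengthACFG α) {b : ℕ} (input : BitVec b → BitVec b)
    (addr : ℕ → BitVec b) : Prop where
  addr_injOn : Set.InjOn addr G.vars
  char_node : ∀ e ∈ G.vars, ∀ a, G.rhs e = .char a → input (addr e) = BitVec.ofNat b 0
  pair_node : ∀ e ∈ G.vars, ∀ l r, G.rhs e = .pair l r →
    input (addr e) = BitVec.ofNat b 1 ∧
    input (addr e + BitVec.ofNat b 1) = addr l ∧ input (addr e + BitVec.ofNat b 2) = addr r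
  run_node : ∀ e ∈ G.vars, ∀ x d, G.rhs e = .run x d →
    input (addr e) = BitVec.ofNat b 2 ∧
    input (addr e + BitVec.ofNat b 1) = addr x ∧
    (input (addr e + BitVec.ofNat b 2)).toNat = d
  length_field : ∀ e ∈ G.vars, (input (addr e + BitVec.ofNat b 3)).toNat = (G.val e).length

/-- The start of a query: the nodes of `e₁`, `e₂` and the positions `i`, `j` are in registers
`0`, …, `3`.  Other registers and the working memory have any content (for example what an earlier
query has left there). -/
structure IsQuery {b : ℕ} (addr : ℕ → BitVec b) (e₁ e₂ i j : ℕ) (c : Config b) : Prop where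
  pc : c.pc = 0
  node₁ : c.reg 0 = addr e₁
  node₂ : c.reg 1 = addr e₂
  pos₁ : (c.reg 2).toNat = i
  pos₂ : (c.reg 3).toNat = j

/-! The proof has two halves which meet in the notion of a certificate (`Cert`).

A refinement of a sequence of variables replaces some of them by their right-hand sides; expanding a
pair costs one, expanding a run is free. A certificate of cost `n` consists of refinements of the
two sides, expanding at most `n` pairs in total, in which the same sequence `c` of variables stands
after the skipped characters; `c` derives the answer, and what follows it starts with different
characters or is empty on one side.

Algorithm. For each string the program keeps a stack of powers of variables deriving the unread
rest. Equal tops are matched with the smaller exponent at once; of two different tops the one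
deriving the longer string is replaced by its children; a run becomes a single entry; a variable
into which a skip reaches is expanded. This is never wasteful: a certificate cannot keep a variable
in which the starting position lies strictly inside (`Cert.expand_skip`), nor the longer one of two
different tops, unless the answer has been found (`Cert.mismatch`), and equal prefixes can be
cancelled (`Cert.match_prefix`). So every expanded pair lowers the cost of the remaining
certificate, and a potential argument (`progress`, `halts_of_invariant`) bounds the time by a
multiple of the cost of any certificate plus one (`lceProgram_correct`). The certificate itself is
never computed.

Cheap certificates. Fix occurrences of the common substring in `T` and climb through the levels
`Shrink_t`, `Pow_t`. Because the parsing is local, all occurrences share a core of equal variables,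
which loses only `Δ_L + O(1)` variables at its ends when blocks are formed and one run at either end
when runs are formed. What is lost is frozen and has to be covered by variables outside the core.
Blocks have at least two entries, so grouping halves the number of covering variables, which
therefore remains `O(log* W)`. A core too short to survive is frozen as a whole. These steps are
`IsLevels.state_block` and `IsLevels.state_run`. A level costs three pairs per covering variable;
once the variables are longer than the window, two of them cover it, so only `log ℓ` levels cost
`O(log* W)` and the others `O(1)` (`levelCost`). A variable that is no character derives at most
four consecutive variables of some `Pow_t` with `2 ^ t` at most its length
(`IsLevels.exists_pow_segment`), so the climb stops at the logarithm of its length. If the two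
variables live on different levels, the window is frozen on the lower one and carried to the higher
one (`IsLevels.covered_levels`). This gives `IsLevels.exists_isPart`, and `exists_cert` adds the
descent to the first character after the match.

Backward queries run the same program with the two child pointers exchanged, which amounts to the
grammar `mirror`; certificates are reversed along with it. Finally `log* W ≤ log* M + O(1)` because
`W ≤ K * M` (`certTime_le`). -/

namespace RunLengthACFG

variable {α : Type*} (G : RunLengthACFG α)

/-! ### Derived strings and their lengths. -/

theorem val_char {e : ℕ} {a : α} (h : G.rhs e = .char a) : G.val e = [a] := by
  rw [val]
  split <;> simp_all

theorem val_pair {e l r : ℕ} (he : e ∈ G.vars) (h : G.rhs e = .pair l r) :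
    G.val e = G.val l ++ G.val r := by
  have h1 := G.rhs_mem e he l (by simp [h, Rhs.varsOf])
  have h2 := G.rhs_mem e he r (by simp [h, Rhs.varsOf])
  rw [val]
  split
  · simp_all
  · rename_i l' r' h'
    rw [h] at h'
    cases h'
    simp [h1.2, h2.2]
  · simp_all

theorem val_run {e x d : ℕ} (he : e ∈ G.vars) (h : G.rhs e = .run x d) :
    G.val e = (List.replicate d (G.val x)).flatten := by
  have h1 := G.rhs_mem e he x (by simp [h, Rhs.varsOf])
  rw [val]
  split
  · simp_all
  · simp_all
  · rename_i l' r' h'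
    rw [h] at h'
    cases h'
    simp [h1.2]

theorem pair_left_mem {e l r : ℕ} (he : e ∈ G.vars) (h : G.rhs e = .pair l r) : l ∈ G.vars :=
  (G.rhs_mem e he l (by simp [h, Rhs.varsOf])).1

theorem pair_right_mem {e l r : ℕ} (he : e ∈ G.vars) (h : G.rhs e = .pair l r) : r ∈ G.vars :=
  (G.rhs_mem e he r (by simp [h, Rhs.varsOf])).1

theorem run_mem {e x d : ℕ} (he : e ∈ G.vars) (h : G.rhs e = .run x d) : x ∈ G.vars :=
  (G.rhs_mem e he x (by simp [h, Rhs.varsOf])).1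

theorem val_ne_nil {e : ℕ} (he : e ∈ G.vars) : G.val e ≠ [] := by
  induction e using Nat.strong_induction_on with
  | _ e ih =>
    rcases h : G.rhs e with a | ⟨l, r⟩ | ⟨x, d⟩
    · simp [G.val_char h]
    · have h1 := G.rhs_mem e he l (by simp [h, Rhs.varsOf])
      simp [G.val_pair he h, ih l h1.2 h1.1]
    · have h1 := G.rhs_mem e he x (by simp [h, Rhs.varsOf])
      have hd := G.run_pos e he x d h
      rw [G.val_run he h]
      intro h0
      exact ih x h1.2 h1.1 (List.flatten_eq_nil_iff.1 h0 _ (by simp; omega))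

/-- The string derived by a sequence of variables. -/
def word (u : List ℕ) : List α := u.flatMap G.val

/-- The length of the string derived by a sequence of variables. -/
def wt (u : List ℕ) : ℕ := (G.word u).length

@[simp] theorem word_nil : G.word [] = [] := rfl
@[simp] theorem word_cons (x : ℕ) (u : List ℕ) : G.word (x :: u) = G.val x ++ G.word u := rfl
@[simp] theorem word_append (u v : List ℕ) : G.word (u ++ v) = G.word u ++ G.word v := by
  simp [word]

theorem word_replicate (d x : ℕ) :
    G.word (List.replicate d x) = (List.replicate d (G.val x)).flatten := by
  simp [word, List.flatMap]

@[simp] theorem wt_nil : G.wt [] = 0 := rfl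
@[simp] theorem wt_cons (x : ℕ) (u : List ℕ) :
    G.wt (x :: u) = (G.val x).length + G.wt u := by simp [wt]
@[simp] theorem wt_append (u v : List ℕ) : G.wt (u ++ v) = G.wt u + G.wt v := by simp [wt]
@[simp] theorem wt_replicate (d x : ℕ) :
    G.wt (List.replicate d x) = d * (G.val x).length := by
  simp [wt, word_replicate]

theorem length_val_pos {x : ℕ} (h : x ∈ G.vars) : 0 < (G.val x).length :=
  List.length_pos_iff.2 (G.val_ne_nil h)

theorem length_le_wt {u : List ℕ} (h : ∀ x ∈ u, x ∈ G.vars) : u.length ≤ G.wt u := by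
  induction u with
  | nil => simp
  | cons x u ih =>
    have := G.length_val_pos (h x (by simp))
    have := ih fun y hy => h y (by simp [hy])
    simp; omega

theorem eq_nil_of_wt {u : List ℕ} (h : ∀ x ∈ u, x ∈ G.vars) (h0 : G.wt u = 0) : u = [] := by
  have := G.length_le_wt h
  exact List.length_eq_zero_iff.1 (by omega)

/-! ### Refinements of sequences of variables. -/

/-- `x` is not assigned a run. -/
def NotRun (x : ℕ) : Prop := ∀ y d, G.rhs x ≠ .run y d

/-- `F` refines to `u` by expanding `n` pairs (and any number of runs). -/
inductive Refines : ℕ → List ℕ → List ℕ → Prop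
  | nil : Refines 0 [] []
  | keep {n x F u} (hx : x ∈ G.vars) (h : Refines n F u) : Refines n (x :: F) (x :: u)
  | pair {n x l r F u} (hx : x ∈ G.vars) (hr : G.rhs x = .pair l r)
      (h : Refines n (l :: r :: F) u) : Refines (n + 1) (x :: F) u
  | run {n x y d F u} (hx : x ∈ G.vars) (hr : G.rhs x = .run y d)
      (h : Refines n (List.replicate d y ++ F) u) : Refines n (x :: F) u

variable {G}

namespace Refines

theorem mem_right {n : ℕ} {F u : List ℕ} (h : G.Refines n F u) : ∀ x ∈ u, x ∈ G.vars := by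
  induction h with
  | nil => simp
  | keep hx _ ih => simpa [hx] using ih
  | pair _ _ _ ih => exact ih
  | run _ _ _ ih => exact ih

theorem mem_left {n : ℕ} {F u : List ℕ} (h : G.Refines n F u) : ∀ x ∈ F, x ∈ G.vars := by
  induction h with
  | nil => simp
  | keep hx _ ih => simpa [hx] using ih
  | pair hx _ _ ih =>
    intro y hy
    rcases List.mem_cons.1 hy with rfl | hy
    · exact hx
    · exact ih y (by simp [hy])
  | run hx _ _ ih =>
    intro y hy
    rcases List.mem_cons.1 hy with rfl | hy
    · exact hx
    · exact ih y (by simp [hy])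

theorem word_eq {n : ℕ} {F u : List ℕ} (h : G.Refines n F u) : G.word F = G.word u := by
  induction h with
  | nil => rfl
  | keep hx _ ih => simp [ih]
  | pair hx hr _ ih => rw [← ih]; simp [G.val_pair hx hr]
  | run hx hr _ ih => rw [← ih]; simp [G.val_run hx hr, word_replicate]

theorem wt_eq {n : ℕ} {F u : List ℕ} (h : G.Refines n F u) : G.wt F = G.wt u := by
  rw [wt, wt, h.word_eq]

theorem length_le {n : ℕ} {F u : List ℕ} (h : G.Refines n F u) : F.length ≤ u.length := by
  induction h with
  | nil => simp
  | keep hx _ ih => simpa using ih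
  | pair hx hr _ ih => simp at ih ⊢; omega
  | run hx hr _ ih =>
    have := G.run_pos _ hx _ _ hr
    simp at ih ⊢; omega

theorem refl {F : List ℕ} (h : ∀ x ∈ F, x ∈ G.vars) : G.Refines 0 F F := by
  induction F with
  | nil => exact .nil
  | cons x F ih => exact .keep (h x (by simp)) (ih fun y hy => h y (by simp [hy]))

theorem append {n m : ℕ} {F F' u u' : List ℕ} (h : G.Refines n F u) (h' : G.Refines m F' u') :
    G.Refines (n + m) (F ++ F') (u ++ u') := by
  induction h with
  | nil => simpa using h'
  | keep hx _ ih => exact .keep hx ih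
  | pair hx hr _ ih => rw [Nat.add_right_comm]; exact .pair hx hr (by simpa using ih)
  | run hx hr _ ih => exact .run hx hr (by simpa using ih)

/-- Expansion does not depend on the context, so both the refinement and its cost split along a
concatenation. -/
theorem split {n : ℕ} {F F' u : List ℕ} (h : G.Refines n (F ++ F') u) :
    ∃ n₁ n₂ u₁ u₂, n₁ + n₂ = n ∧ u = u₁ ++ u₂ ∧ G.Refines n₁ F u₁ ∧ G.Refines n₂ F' u₂ := by
  generalize hE : F ++ F' = E at h
  induction h generalizing F with
  | nil =>
    obtain ⟨rfl, rfl⟩ := List.append_eq_nil_iff.1 hE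
    exact ⟨0, 0, [], [], rfl, rfl, .nil, .nil⟩
  | @keep n x E u hx h ih =>
    cases F with
    | nil => exact ⟨0, n, [], x :: u, by simp, by simp, .nil, by simp at hE; subst hE; exact h.keep hx⟩
    | cons y F =>
      simp only [List.cons_append, List.cons.injEq] at hE
      obtain ⟨rfl, hE⟩ := hE
      obtain ⟨n₁, n₂, u₁, u₂, h1, h2, h3, h4⟩ := ih hE
      exact ⟨n₁, n₂, y :: u₁, u₂, h1, by simp [h2], h3.keep hx, h4⟩
  | @pair n x l r E u hx hr h ih =>
    cases F with
    | nil => exact ⟨0, n + 1, [], u, by simp, by simp, .nil, by simp at hE; subst hE; exact h.pair hx hr⟩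
    | cons y F =>
      simp only [List.cons_append, List.cons.injEq] at hE
      obtain ⟨rfl, hE⟩ := hE
      obtain ⟨n₁, n₂, u₁, u₂, h1, h2, h3, h4⟩ := ih (F := l :: r :: F) (by simp [hE])
      exact ⟨n₁ + 1, n₂, u₁, u₂, by omega, h2, h3.pair hx hr, h4⟩
  | @run n x y d E u hx hr h ih =>
    cases F with
    | nil => exact ⟨0, n, [], u, by simp, by simp, .nil, by simp at hE; subst hE; exact h.run hx hr⟩
    | cons z F =>
      simp only [List.cons_append, List.cons.injEq] at hE
      obtain ⟨rfl, hE⟩ := hE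
      obtain ⟨n₁, n₂, u₁, u₂, h1, h2, h3, h4⟩ := ih (F := List.replicate d y ++ F) (by simp [hE])
      exact ⟨n₁, n₂, u₁, u₂, by omega, h2, h3.run hx hr, h4⟩

theorem trans {n m : ℕ} {F u v : List ℕ} (h : G.Refines n F u) (h' : G.Refines m u v) :
    G.Refines (n + m) F v := by
  induction h generalizing v m with
  | nil => simpa using h'
  | @keep n x F u hx h ih =>
    obtain ⟨n₁, n₂, u₁, u₂, rfl, rfl, h3, h4⟩ := split (F := [x]) (F' := u) h'
    have := h3.append (ih h4)
    rwa [Nat.add_left_comm] at this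
  | pair hx hr _ ih => rw [Nat.add_right_comm]; exact .pair hx hr (ih h')
  | run hx hr _ ih => exact .run hx hr (ih h')

theorem single_pair {x l r : ℕ} (hx : x ∈ G.vars) (hr : G.rhs x = .pair l r) :
    G.Refines 1 [x] [l, r] :=
  .pair hx hr (refl (by simp [G.pair_left_mem hx hr, G.pair_right_mem hx hr]))

theorem single_run {x y d : ℕ} (hx : x ∈ G.vars) (hr : G.rhs x = .run y d) :
    G.Refines 0 [x] (List.replicate d y) :=
  .run hx hr (by
    rw [List.append_nil]
    refine refl fun z hz => ?_
    rw [List.eq_of_mem_replicate hz]; exact G.run_mem hx hr)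

/-- A run at the head cannot survive in a sequence without runs; it has to be expanded at some time,
and this may as well be done first. -/
theorem cons_run {n x y d : ℕ} {F u : List ℕ} (h : G.Refines n (x :: F) u)
    (hr : G.rhs x = .run y d) (hu : ∀ z ∈ u, G.NotRun z) :
    G.Refines n (List.replicate d y ++ F) u := by
  cases h with
  | keep hx h => exact absurd hr (hu x (by simp) y d)
  | pair hx hr' h => simp [hr] at hr'
  | run hx hr' h => rw [hr] at hr'; cases hr'; exact h

/-- A variable that is no run is kept or expanded as a pair. -/
theorem cons_cases {n x : ℕ} {F u : List ℕ} (h : G.Refines n (x :: F) u) (hx : G.NotRun x) :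
    (∃ u', u = x :: u' ∧ G.Refines n F u') ∨
      ∃ l r m, n = m + 1 ∧ G.rhs x = .pair l r ∧ G.Refines m (l :: r :: F) u := by
  cases h with
  | keep _ h => exact .inl ⟨_, rfl, h⟩
  | pair _ hr h => exact .inr ⟨_, _, _, rfl, hr, h⟩
  | run _ hr h => exact absurd hr (hx _ _)

end Refines

variable (G)

/-! ### Mirror images -/

end RunLengthACFG

/-- Exchange the two variables of a pair. -/
def Rhs.swap {α : Type*} : Rhs α → Rhs α
  | .char a => .char a
  | .pair l r => .pair r l
  | .run e d => .run e d

@[simp] theorem Rhs.varsOf_swap {α : Type*} (x : Rhs α) : x.swap.varsOf = x.varsOf := by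
  cases x <;> simp [Rhs.swap, Rhs.varsOf, Set.pair_comm]

theorem Rhs.swap_swap {α : Type*} (x : Rhs α) : x.swap.swap = x := by
  cases x <;> rfl

namespace RunLengthACFG

variable {α : Type*} (G : RunLengthACFG α)

/-- The grammar in which every variable derives the reversed string. -/
def mirror : RunLengthACFG α where
  vars := G.vars
  rhs e := (G.rhs e).swap
  start := G.start
  start_mem := G.start_mem
  pos := G.pos
  rhs_mem e he x hx := G.rhs_mem e he x (by simpa using hx)
  run_pos e he x d h := G.run_pos e he x d (by rw [← (G.rhs e).swap_swap, h]; rfl)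
  used e he hs := by simpa using G.used e he hs
  rhs_injOn e he e' he' h := G.rhs_injOn he he' (by
    have := congrArg Rhs.swap h
    simpa only [Rhs.swap_swap] using this)

@[simp] theorem mirror_vars : G.mirror.vars = G.vars := rfl

theorem mirror_mirror : G.mirror.mirror = G := by
  cases G; simp [mirror, Rhs.swap_swap]

theorem mirror_rhs (e : ℕ) : G.mirror.rhs e = (G.rhs e).swap := rfl

theorem rhs_of_mirror {e : ℕ} {x : Rhs α} (h : G.mirror.rhs e = x) : G.rhs e = x.swap := by
  rw [← h, mirror_rhs, Rhs.swap_swap]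

theorem mirror_val {e : ℕ} (he : e ∈ G.vars) : G.mirror.val e = (G.val e).reverse := by
  induction e using Nat.strong_induction_on with
  | _ e ih =>
    rcases h : G.rhs e with a | ⟨l, r⟩ | ⟨x, d⟩
    · rw [G.val_char h, G.mirror.val_char (by rw [mirror_rhs, h]; rfl)]; rfl
    · have h1 := G.rhs_mem e he l (by simp [h, Rhs.varsOf])
      have h2 := G.rhs_mem e he r (by simp [h, Rhs.varsOf])
      rw [G.val_pair he h, G.mirror.val_pair he (by rw [mirror_rhs, h]; rfl), ih l h1.2 h1.1,
        ih r h2.2 h2.1, List.reverse_append]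
    · have h1 := G.rhs_mem e he x (by simp [h, Rhs.varsOf])
      rw [G.val_run he h, G.mirror.val_run he (by rw [mirror_rhs, h]; rfl), ih x h1.2 h1.1]
      simp [List.reverse_flatten]

theorem mirror_length_val {e : ℕ} (he : e ∈ G.vars) :
    (G.mirror.val e).length = (G.val e).length := by simp [G.mirror_val he]

theorem mirror_word {u : List ℕ} (hu : ∀ x ∈ u, x ∈ G.vars) :
    G.mirror.word u.reverse = (G.word u).reverse := by
  induction u with
  | nil => rfl
  | cons x u ih =>
    simp [ih fun y hy => hu y (by simp [hy]), G.mirror_val (hu x (by simp))]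

theorem mirror_wt {u : List ℕ} (hu : ∀ x ∈ u, x ∈ G.vars) :
    G.mirror.wt u.reverse = G.wt u := by
  simp [wt, G.mirror_word hu]

theorem mirror_notRun {x : ℕ} : G.mirror.NotRun x ↔ G.NotRun x := by
  unfold NotRun
  simp only [mirror_rhs]
  rcases G.rhs x with a | ⟨l, r⟩ | ⟨y, d⟩ <;> simp [Rhs.swap]

variable {G}

/-- Reversal moves the expansion of the head to the end of the sequence, where the constructors do
not apply. It is therefore carried out separately, by `append`, and composed with the induction
hypothesis by `trans`. -/
theorem Refines.mirror {n : ℕ} {F u : List ℕ} (h : G.Refines n F u) :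
    G.mirror.Refines n F.reverse u.reverse := by
  induction h with
  | nil => exact .nil
  | keep hx h ih => simpa using ih.append (.refl (F := [_]) (by simpa using hx))
  | @pair n x l r F u hx hr h ih =>
    have h1 : G.mirror.Refines 1 _ _ := .single_pair hx (by rw [mirror_rhs, hr]; rfl)
    have h2 : G.mirror.Refines 0 F.reverse F.reverse :=
      .refl fun x hx => h.mem_left x (by simp at hx; simp [hx])
    have h3 := (h2.append h1).trans (v := u.reverse) (m := n) (by simpa using ih)
    simpa [Nat.add_comm] using h3
  | @run n x y d F u hx hr h ih =>
    have h1 : G.mirror.Refines 0 _ _ := .single_run hx (by rw [mirror_rhs, hr]; rfl)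
    have h2 : G.mirror.Refines 0 F.reverse F.reverse :=
      .refl fun x hx => h.mem_left x (by simp at hx; simp [hx])
    have h3 := (h2.append h1).trans (v := u.reverse) (m := n) (by simpa using ih)
    simpa using h3

end RunLengthACFG

/-! ### Certificates for the length of a common prefix. -/

namespace RunLengthACFG

variable {α : Type*} {G : RunLengthACFG α}

theorem length_val_pair {x l r : ℕ} (hx : x ∈ G.vars) (hr : G.rhs x = .pair l r) :
    2 ≤ (G.val x).length := by
  have h1 := G.length_val_pos (G.pair_left_mem hx hr)
  have h2 := G.length_val_pos (G.pair_right_mem hx hr)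
  rw [G.val_pair hx hr, List.length_append]; omega

/-- If the prefix `p` derives no more than `w` does, then it is a prefix of `w`. -/
theorem prefix_of_wt_le {w v p q : List ℕ} (h : w ++ v = p ++ q) (hp : ∀ x ∈ p, x ∈ G.vars)
    (hle : G.wt p ≤ G.wt w) : ∃ w', w = p ++ w' ∧ q = w' ++ v := by
  rcases List.append_eq_append_iff.1 h with ⟨r, h1, h2⟩ | ⟨r, h1, h2⟩
  · have : r = [] := G.eq_nil_of_wt (fun x hx => hp x (by simp [h1, hx])) (by
      rw [h1, wt_append] at hle; omega)
    subst this
    exact ⟨[], by simpa using h1.symm, by simpa using h2.symm⟩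
  · exact ⟨r, h1, h2⟩

variable (G) in
/-- Some refinement of `F`, which expands `n` pairs, reads `w ++ c ++ z` where `w` derives a string
of length `k` and `z` is empty or starts with a variable deriving one character. -/
def HalfCert (n k : ℕ) (F c z : List ℕ) : Prop :=
  ∃ w, G.Refines n F (w ++ (c ++ z)) ∧ G.wt w = k ∧ (∀ x ∈ w ++ (c ++ z), G.NotRun x) ∧
    ∀ x z', z = x :: z' → (G.val x).length = 1

namespace HalfCert

variable {n k : ℕ} {F F' c z : List ℕ} {x l r : ℕ}

theorem nil (h : G.HalfCert n k [] c z) : c = [] := by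
  obtain ⟨w, h, -⟩ := h
  generalize hu : w ++ (c ++ z) = u at h
  cases h
  simp at hu
  exact hu.2.1

theorem run {y d : ℕ} (h : G.HalfCert n k (x :: F) c z) (hr : G.rhs x = .run y d) :
    G.HalfCert n k (List.replicate d y ++ F) c z := by
  obtain ⟨w, h, h2, h3, h4⟩ := h
  exact ⟨w, h.cons_run hr h3, h2, h3, h4⟩

/-- The refinement of `F` derives at most `k` characters, hence is a prefix of `w`; it can be cut
off together with its cost. -/
theorem drop (h : G.HalfCert n k (F ++ F') c z) (hk : G.wt F ≤ k) :
    ∃ m ≤ n, G.HalfCert m (k - G.wt F) F' c z := by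
  obtain ⟨w, h, h2, h3, h4⟩ := h
  obtain ⟨n₁, n₂, u₁, u₂, rfl, hu, h5, h6⟩ := h.split
  obtain ⟨w', rfl, rfl⟩ := prefix_of_wt_le hu h5.mem_right (by rw [← h5.wt_eq]; omega)
  have := h5.wt_eq
  refine ⟨n₂, by omega, w', h6, by rw [wt_append] at h2; omega, fun x hx => h3 x ?_, h4⟩
  rw [List.append_assoc]
  exact List.mem_append_right _ hx

/-- If `x` were kept, it would be the first entry of `w`, which is not empty as `0 < k`; but then
`w` derives more than `k` characters. -/
theorem expand_skip (h : G.HalfCert n k (x :: F) c z) (hx : G.NotRun x) (hk : 0 < k)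
    (hk' : k < (G.val x).length) :
    ∃ l r m, n = m + 1 ∧ G.rhs x = .pair l r ∧ G.HalfCert m k (l :: r :: F) c z := by
  obtain ⟨w, h, h2, h3, h4⟩ := h
  rcases h.cons_cases hx with ⟨u', hu, -⟩ | ⟨l, r, m, h5, h6, h7⟩
  · cases w with
    | nil => simp at h2; omega
    | cons y w =>
      simp only [List.cons_append, List.cons.injEq] at hu
      rw [wt_cons, hu.1] at h2
      omega
  · exact ⟨l, r, m, h5, h6, w, h7, h2, h3, h4⟩

/-- The head of the refined sequence derives at most as much as the head of `F` does. -/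
theorem head_le {y : ℕ} {u : List ℕ} (h : G.Refines n (x :: F) (y :: u)) :
    (G.val y).length ≤ (G.val x).length := by
  obtain ⟨n₁, n₂, u₁, u₂, rfl, hu, h5, h6⟩ := Refines.split (F := [x]) (F' := F) h
  cases u₁ with
  | nil => have := h5.length_le; simp at this
  | cons z u₁ =>
    simp only [List.cons_append, List.cons.injEq] at hu
    have := h5.wt_eq
    simp at this
    rw [hu.1]; omega

/-- An expanded `x` would leave at the head at most its left child, which is strictly shorter than
`x`. -/
theorem eq_head {y : ℕ} {u : List ℕ} (h : G.Refines n (x :: F) (y :: u)) (hx : G.NotRun x)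
    (hle : (G.val x).length ≤ (G.val y).length) : x = y := by
  have hxm := h.mem_left x (by simp)
  rcases h.cons_cases hx with ⟨u', hu, -⟩ | ⟨l, r, m, h5, h6, h7⟩
  · simp at hu; exact hu.1.symm
  · have h1 := head_le h7
    rw [G.val_pair hxm h6, List.length_append] at hle
    have := G.length_val_pos (G.pair_right_mem hxm h6)
    omega

end HalfCert

variable (G) in
/-- A certificate that `F₁` without its first `k₁` characters and `F₂` without its first `k₂`
characters agree on `r` characters exactly: they have refinements, which expand at most `n` pairs
in total, sharing a sequence which derives a string of length `r`. -/
def Cert (n k₁ : ℕ) (F₁ : List ℕ) (k₂ : ℕ) (F₂ : List ℕ) (r : ℕ) : Prop :=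
  ∃ n₁ n₂ c z₁ z₂, n₁ + n₂ ≤ n ∧ G.HalfCert n₁ k₁ F₁ c z₁ ∧ G.HalfCert n₂ k₂ F₂ c z₂ ∧
    G.wt c = r ∧ ∀ a s t, G.word z₁ = a :: s → G.word z₂ = a :: t → False

namespace Cert

variable {n k₁ k₂ r : ℕ} {F F₁ F₂ : List ℕ} {x y : ℕ}

theorem symm (h : G.Cert n k₁ F₁ k₂ F₂ r) : G.Cert n k₂ F₂ k₁ F₁ r := by
  obtain ⟨n₁, n₂, c, z₁, z₂, h1, h2, h3, h4, h5⟩ := h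
  exact ⟨n₂, n₁, c, z₂, z₁, by omega, h3, h2, h4, fun a s t hs ht => h5 a t s ht hs⟩

theorem nil_left (h : G.Cert n k₁ [] k₂ F₂ r) : r = 0 := by
  obtain ⟨n₁, n₂, c, z₁, z₂, h1, h2, h3, h4, h5⟩ := h
  rw [← h4, h2.nil]; rfl

theorem run {y d : ℕ} (h : G.Cert n k₁ (x :: F₁) k₂ F₂ r) (hr : G.rhs x = .run y d) :
    G.Cert n k₁ (List.replicate d y ++ F₁) k₂ F₂ r := by
  obtain ⟨n₁, n₂, c, z₁, z₂, h1, h2, h3, h4, h5⟩ := h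
  exact ⟨n₁, n₂, c, z₁, z₂, h1, h2.run hr, h3, h4, h5⟩

theorem drop (h : G.Cert n k₁ (F ++ F₁) k₂ F₂ r) (hk : G.wt F ≤ k₁) :
    G.Cert n (k₁ - G.wt F) F₁ k₂ F₂ r := by
  obtain ⟨n₁, n₂, c, z₁, z₂, h1, h2, h3, h4, h5⟩ := h
  obtain ⟨m, hm, h2⟩ := h2.drop hk
  exact ⟨m, n₂, c, z₁, z₂, by omega, h2, h3, h4, h5⟩

theorem expand_skip (h : G.Cert n k₁ (x :: F₁) k₂ F₂ r) (hx : G.NotRun x) (hk : 0 < k₁)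
    (hk' : k₁ < (G.val x).length) :
    ∃ l r' m, n = m + 1 ∧ G.rhs x = .pair l r' ∧ G.Cert m k₁ (l :: r' :: F₁) k₂ F₂ r := by
  obtain ⟨n₁, n₂, c, z₁, z₂, h1, h2, h3, h4, h5⟩ := h
  obtain ⟨l, r', m, rfl, hr, h2⟩ := h2.expand_skip hx hk hk'
  exact ⟨l, r', n - 1, by omega, hr, m, n₂, c, z₁, z₂, by omega, h2, h3, h4, h5⟩

/-- This justifies the greedy choice. Suppose that the certificate keeps the longer variable `x`. If
`x` begins the common sequence, it also heads the refinement of the other side, and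
`HalfCert.eq_head` gives `y = x`. If the common sequence is empty, `x` begins `z₁`, so it derives
one character and nothing is left to match. In all other cases the certificate pays for expanding
`x`, just as the algorithm does. -/
theorem mismatch (h : G.Cert n 0 (x :: F₁) 0 (y :: F₂) r) (hx : G.NotRun x) (hy : G.NotRun y)
    (hxy : x ≠ y) (hle : (G.val y).length ≤ (G.val x).length) :
    ((G.val x).length = 1 ∧ r = 0) ∨ ∃ l r' m, n = m + 1 ∧ G.rhs x = .pair l r' ∧
      G.Cert m 0 (l :: r' :: F₁) 0 (y :: F₂) r := by
  obtain ⟨n₁, n₂, c, z₁, z₂, h1, ⟨w₁, h2, hw₁, h2n, h2z⟩, ⟨w₂, h3, hw₂, h3n, h3z⟩, h4, h5⟩ := h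
  have hw₁' := G.eq_nil_of_wt (fun x hx => h2.mem_right x (by simp [hx])) hw₁
  have hw₂' := G.eq_nil_of_wt (fun x hx => h3.mem_right x (by simp [hx])) hw₂
  subst hw₁' hw₂'
  rw [List.nil_append] at h2 h3
  rcases h2.cons_cases hx with ⟨u', hu, -⟩ | ⟨l, r', m, h6, h7, h8⟩
  · cases c with
    | nil => exact .inl ⟨h2z _ _ hu, h4.symm⟩
    | cons x' c =>
      simp only [List.cons_append, List.cons.injEq] at hu
      obtain ⟨rfl, -⟩ := hu
      exact absurd (HalfCert.eq_head h3 hy hle).symm hxy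
  · exact .inr ⟨l, r', n - 1, by omega, h7, m, n₂, c, z₁, z₂, by omega, ⟨[], h8, rfl, h2n, h2z⟩,
      ⟨[], h3, rfl, h3n, h3z⟩, h4, h5⟩

/-- The two refinements may expand `F` differently, but both results derive the same string. Either
this string ends within the common sequence, whose prefix then fixes both results, or the two
remainders begin alike. -/
theorem match_prefix (h : G.Cert n 0 (F ++ F₁) 0 (F ++ F₂) r) :
    G.wt F ≤ r ∧ G.Cert n 0 F₁ 0 F₂ (r - G.wt F) := by
  obtain ⟨n₁, n₂, c, z₁, z₂, h1, ⟨w₁, h2, hw₁, h2n, h2z⟩, ⟨w₂, h3, hw₂, h3n, h3z⟩, h4, h5⟩ := h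
  have hw₁' := G.eq_nil_of_wt (fun x hx => h2.mem_right x (by simp [hx])) hw₁
  have hw₂' := G.eq_nil_of_wt (fun x hx => h3.mem_right x (by simp [hx])) hw₂
  subst hw₁' hw₂'
  rw [List.nil_append] at h2 h3
  obtain ⟨a₁, b₁, p₁, q₁, rfl, hu₁, hp₁, hq₁⟩ := h2.split
  obtain ⟨a₂, b₂, p₂, q₂, rfl, hu₂, hp₂, hq₂⟩ := h3.split
  have hp : G.word p₁ = G.word p₂ := by rw [← hp₁.word_eq, hp₂.word_eq]
  have hpw : G.wt p₁ = G.wt p₂ := by rw [wt, hp]; rfl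
  by_cases hle : G.wt p₁ ≤ G.wt c
  · obtain ⟨c₁, rfl, rfl⟩ := prefix_of_wt_le hu₁ hp₁.mem_right hle
    obtain ⟨c₂, hc, rfl⟩ := prefix_of_wt_le hu₂ hp₂.mem_right (hpw ▸ hle)
    -- Both `p₁` and `p₂` are prefixes of `c` deriving strings of equal length, so their difference
    -- `c₃` is empty and they coincide.
    obtain ⟨c₃, hc₃, hc'⟩ := prefix_of_wt_le hc hp₂.mem_right hpw.ge
    have : c₃ = [] := by
      refine G.eq_nil_of_wt (fun x hx => hp₁.mem_right x (by simp [hc₃, hx])) ?_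
      rw [hc₃, wt_append] at hpw
      omega
    subst this
    simp only [List.append_nil, List.nil_append] at hc₃ hc'
    subst hc₃ hc'
    have := hp₁.wt_eq
    rw [wt_append] at h4
    refine ⟨by omega, b₁, b₂, c₂, z₁, z₂, by omega, ⟨[], hq₁, rfl, fun x hx => h2n x ?_, h2z⟩,
      ⟨[], hq₂, rfl, fun x hx => h3n x ?_, h3z⟩, by omega, h5⟩
    · simp at hx ⊢; tauto
    · simp at hx ⊢; tauto
  -- The common sequence ends inside the string derived by `F`; then `z₁` and `z₂` both start with
  -- the rest of that string, against the last clause of `Cert`.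
  · exfalso
    obtain ⟨r₁, rfl, hr₁⟩ := prefix_of_wt_le hu₁.symm
      (fun x hx => h2.mem_right x (by simp [hx])) (by omega)
    obtain ⟨r₂, rfl, hr₂⟩ := prefix_of_wt_le hu₂.symm
      (fun x hx => h2.mem_right x (by simp [hx])) (by omega)
    have hr : G.word r₁ = G.word r₂ := by simpa using hp
    cases hw : G.word r₁ with
    | nil => simp [wt, hw] at hle
    | cons a s =>
      exact h5 a _ _ (by rw [hr₁, word_append, hw]; rfl) (by rw [hr₂, word_append, ← hr, hw]; rfl)

end Cert

end RunLengthACFG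

/-! ### The query program. -/

/-- The query program.  In a record of the kind `1`, the variable read first is at offset `o₁` and
the other one at offset `o₂`.

Registers: `4`, `5`, `6` hold the stack pointer, the bottom of the stack and the number of
characters to skip for the first string, `7`, `8`, `9` the same for the second one; `10` counts the
characters matched so far, and `11`, …, `15` hold the constants `1`, `2`, `3`, `4`, `0`.  An entry of
a stack is a node followed by the number of its copies; entries of both stacks alternate in the
working memory. -/
def lceProgram (o₁ o₂ : ℕ) : Program := [
  .const 11 1, .const 12 2, .const 13 3, .const 14 4, .const 15 0, .const 5 0, .const 8 2,
  .store 5 0, .add 4 5 11, .store 4 11, .add 4 5 14,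
  .store 8 1, .add 7 8 11, .store 7 11, .add 7 8 14,
  .sub 6 2 11, .sub 9 3 11, .const 10 0,
  -- 18: the main loop
  .jeq 4 5 106, .jeq 7 8 106,
  .sub 28 4 14, .load 20 28, .add 29 28 11, .load 21 29, .read 22 20,
  .jeq 22 12 58, .jlt 15 6 65,
  .sub 30 7 14, .load 23 30, .read 25 23,
  .jeq 25 12 79, .jlt 15 9 79,
  .add 26 20 13, .read 26 26, .add 27 23 13, .read 27 27,
  .jlt 26 27 79, .jeq 20 23 89, .jeq 22 15 106,
  -- 39: expand the top of the first stack
  .jeq 21 11 43, .sub 21 21 11, .store 29 21, .add 28 28 14,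
  .const 16 o₂, .add 16 20 16, .read 16 16, .store 28 16, .add 29 28 11, .store 29 11,
  .add 28 28 14,
  .const 16 o₁, .add 16 20 16, .read 16 16, .store 28 16, .add 29 28 11, .store 29 11,
  .add 4 28 14, .jump 18,
  -- 58: replace a run
  .add 16 20 11, .read 16 16, .store 28 16, .add 16 20 12, .read 16 16, .store 29 16, .jump 18,
  -- 65: skip characters
  .add 26 20 13, .read 26 26, .mul 27 26 21, .jlt 6 27 72, .sub 6 6 27, .move 4 28, .jump 18,
  .div 27 6 26, .sub 21 21 27, .mul 27 27 26, .sub 6 6 27, .store 29 21, .jlt 15 6 39, .jump 18,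
  -- 79: exchange the roles of the strings
  .move 16 4, .move 4 7, .move 7 16, .move 16 5, .move 5 8, .move 8 16, .move 16 6, .move 6 9,
  .move 9 16, .jump 18,
  -- 89: match the tops of the stacks
  .add 31 30 11, .load 24 31, .jlt 21 24 100,
  .mul 27 24 26, .add 10 10 27, .move 7 30, .sub 21 21 24, .store 29 21, .jlt 15 21 18,
  .move 4 28, .jump 18,
  .mul 27 21 26, .add 10 10 27, .sub 24 24 21, .store 31 24, .move 4 28, .jump 18,
  -- 106: the answer
  .move 0 10]

/-! ### Rules for the execution of single instructions. -/

/-- Within `N` steps, `P` leads from `c` to a configuration satisfying `Q`. -/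
def Leads {b : ℕ} (P : Program) (input : BitVec b → BitVec b) (N : ℕ) (c : Config b)
    (Q : Config b → Prop) : Prop :=
  ∃ t ≤ N, Q ((Config.step P input)^[t] c)

namespace Leads

variable {b : ℕ} {P : Program} {input : BitVec b → BitVec b} {N pc r s t l k : ℕ}
  {R : ℕ → BitVec b} {m : BitVec b → BitVec b} {Q : Config b → Prop} {v a : BitVec b}

theorem done {c : Config b} (h : Q c) : Leads P input N c Q := ⟨0, Nat.zero_le _, h⟩

theorem mono {N' : ℕ} {Q' : Config b → Prop} {c : Config b} (h : Leads P input N c Q)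
    (hN : N ≤ N') (hQ : ∀ c, Q c → Q' c) : Leads P input N' c Q' := by
  obtain ⟨t, ht, h⟩ := h
  exact ⟨t, by omega, hQ _ h⟩

theorem trans {N' : ℕ} {Q' : Config b → Prop} {c : Config b} (h : Leads P input N c Q)
    (h' : ∀ c, Q c → Leads P input N' c Q') : Leads P input (N + N') c Q' := by
  obtain ⟨t, ht, h⟩ := h
  obtain ⟨t', ht', h'⟩ := h' _ h
  exact ⟨t' + t, by omega, by rwa [Function.iterate_add_apply]⟩

theorem of_step {c c' : Config b} (h : Config.step P input c = c')
    (h' : Leads P input N c' Q) : Leads P input (N + 1) c Q := by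
  obtain ⟨t, ht, h'⟩ := h'
  exact ⟨t + 1, by omega, by rwa [Function.iterate_succ_apply, h]⟩

theorem of_exec {ins : Instr} {c c' : Config b} (h : P[c.pc]? = some ins)
    (hc : c.exec input ins = c') (h' : Leads P input N c' Q) : Leads P input (N + 1) c Q :=
  of_step (by rw [Config.step, h]; exact hc) h'

theorem const (h : P[pc]? = some (.const r k))
    (h' : Leads P input N ⟨pc + 1, Function.update R r (BitVec.ofNat b k), m⟩ Q) :
    Leads P input (N + 1) ⟨pc, R, m⟩ Q :=
  of_exec h rfl h'

/-- Here and in the following rules the computed value is a parameter `v`, so that each use can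
supply it in a normal form such as `BitVec.ofNat b _` instead of accumulating the history of the
registers. -/
theorem move (h : P[pc]? = some (.move r s)) (hv : R s = v)
    (h' : Leads P input N ⟨pc + 1, Function.update R r v, m⟩ Q) :
    Leads P input (N + 1) ⟨pc, R, m⟩ Q :=
  of_exec h (by rw [← hv]; rfl) h'

theorem add (h : P[pc]? = some (.add r s t)) (hv : R s + R t = v)
    (h' : Leads P input N ⟨pc + 1, Function.update R r v, m⟩ Q) :
    Leads P input (N + 1) ⟨pc, R, m⟩ Q :=
  of_exec h (by rw [← hv]; rfl) h'

theorem sub (h : P[pc]? = some (.sub r s t)) (hv : R s - R t = v)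
    (h' : Leads P input N ⟨pc + 1, Function.update R r v, m⟩ Q) :
    Leads P input (N + 1) ⟨pc, R, m⟩ Q :=
  of_exec h (by rw [← hv]; rfl) h'

theorem mul (h : P[pc]? = some (.mul r s t)) (hv : R s * R t = v)
    (h' : Leads P input N ⟨pc + 1, Function.update R r v, m⟩ Q) :
    Leads P input (N + 1) ⟨pc, R, m⟩ Q :=
  of_exec h (by rw [← hv]; rfl) h'

theorem div (h : P[pc]? = some (.div r s t)) (hv : BitVec.udiv (R s) (R t) = v)
    (h' : Leads P input N ⟨pc + 1, Function.update R r v, m⟩ Q) :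
    Leads P input (N + 1) ⟨pc, R, m⟩ Q :=
  of_exec h (by rw [← hv]; rfl) h'

theorem read (h : P[pc]? = some (.read r s)) (hv : input (R s) = v)
    (h' : Leads P input N ⟨pc + 1, Function.update R r v, m⟩ Q) :
    Leads P input (N + 1) ⟨pc, R, m⟩ Q :=
  of_exec h (by rw [← hv]; rfl) h'

theorem load (h : P[pc]? = some (.load r s)) (hv : m (R s) = v)
    (h' : Leads P input N ⟨pc + 1, Function.update R r v, m⟩ Q) :
    Leads P input (N + 1) ⟨pc, R, m⟩ Q :=
  of_exec h (by rw [← hv]; rfl) h'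

theorem store (h : P[pc]? = some (.store r s)) (ha : R r = a) (hv : R s = v)
    (h' : Leads P input N ⟨pc + 1, R, Function.update m a v⟩ Q) :
    Leads P input (N + 1) ⟨pc, R, m⟩ Q :=
  of_exec h (by rw [← hv, ← ha]; rfl) h'

theorem jump (h : P[pc]? = some (.jump l)) (h' : Leads P input N ⟨l, R, m⟩ Q) :
    Leads P input (N + 1) ⟨pc, R, m⟩ Q :=
  of_exec h rfl h'

theorem jeq_pos (h : P[pc]? = some (.jeq s t l)) (hv : R s = R t)
    (h' : Leads P input N ⟨l, R, m⟩ Q) : Leads P input (N + 1) ⟨pc, R, m⟩ Q :=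
  of_exec h (by simp [Config.exec, hv]) h'

theorem jeq_neg (h : P[pc]? = some (.jeq s t l)) (hv : R s ≠ R t)
    (h' : Leads P input N ⟨pc + 1, R, m⟩ Q) : Leads P input (N + 1) ⟨pc, R, m⟩ Q :=
  of_exec h (by simp [Config.exec, hv]) h'

theorem jlt_pos (h : P[pc]? = some (.jlt s t l)) (hv : (R s).toNat < (R t).toNat)
    (h' : Leads P input N ⟨l, R, m⟩ Q) : Leads P input (N + 1) ⟨pc, R, m⟩ Q :=
  of_exec h (by simp only [Config.exec, hv, if_true]) h'

theorem jlt_neg (h : P[pc]? = some (.jlt s t l)) (hv : (R t).toNat ≤ (R s).toNat)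
    (h' : Leads P input N ⟨pc + 1, R, m⟩ Q) : Leads P input (N + 1) ⟨pc, R, m⟩ Q :=
  of_exec h (by simp only [Config.exec, Nat.not_lt.2 hv, if_false]) h'

end Leads

/-! ### Numbers in words -/

theorem BitVec.ofNat_sub_ofNat_of_le' {b x y : ℕ} (h : y ≤ x) :
    BitVec.ofNat b x - BitVec.ofNat b y = BitVec.ofNat b (x - y) := by
  obtain ⟨z, rfl⟩ := Nat.exists_eq_add_of_le h
  rw [BitVec.ofNat_add, Nat.add_sub_cancel_left]; ring

theorem BitVec.toNat_ofNat_of_lt' {b x : ℕ} (h : x < 2 ^ b) : (BitVec.ofNat b x).toNat = x := by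
  rw [BitVec.toNat_ofNat, Nat.mod_eq_of_lt h]

theorem BitVec.ofNat_inj_of_lt {b x y : ℕ} (hx : x < 2 ^ b) (hy : y < 2 ^ b) :
    BitVec.ofNat b x = BitVec.ofNat b y ↔ x = y :=
  ⟨fun h => by rw [← BitVec.toNat_ofNat_of_lt' hx, h, BitVec.toNat_ofNat_of_lt' hy],
    fun h => by rw [h]⟩

theorem BitVec.udiv_ofNat_of_lt {b x y : ℕ} (hx : x < 2 ^ b) (hy : y < 2 ^ b) :
    BitVec.udiv (BitVec.ofNat b x) (BitVec.ofNat b y) = BitVec.ofNat b (x / y) := by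
  apply BitVec.eq_of_toNat_eq
  have := Nat.div_le_self x y
  rw [BitVec.toNat_ofNat_of_lt' (by omega)]
  change (BitVec.ofNat b x / BitVec.ofNat b y).toNat = _
  rw [BitVec.toNat_udiv, BitVec.toNat_ofNat_of_lt' hx, BitVec.toNat_ofNat_of_lt' hy]

/-! ### The representation of the state of the algorithm -/

/-- The working memory `m` holds the stack `S` (the head is on top) from the address `base` on. -/
def StackAt {b : ℕ} (addr : ℕ → BitVec b) (m : BitVec b → BitVec b) (base : ℕ) :
    List (ℕ × ℕ) → Prop
  | [] => True
  | p :: S => m (BitVec.ofNat b (base + 4 * S.length)) = addr p.1 ∧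
      m (BitVec.ofNat b (base + 4 * S.length + 1)) = BitVec.ofNat b p.2 ∧ StackAt addr m base S

/-- The highest cell of the stack has the address `base + 4 * S.length - 3`; the bound on the size
keeps it below `2 ^ b`, so that different numbers are different addresses. -/
theorem StackAt.update {b : ℕ} {addr : ℕ → BitVec b} {m : BitVec b → BitVec b} {base a : ℕ}
    {v : BitVec b} {S : List (ℕ × ℕ)} (h : StackAt addr m base S) (ha : a < 2 ^ b)
    (hS : base + 4 * S.length ≤ 2 ^ b + 2)
    (hne : ∀ k < S.length, a ≠ base + 4 * k ∧ a ≠ base + 4 * k + 1) :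
    StackAt addr (Function.update m (BitVec.ofNat b a) v) base S := by
  induction S with
  | nil => trivial
  | cons p S ih =>
    obtain ⟨h1, h2, h3⟩ := h
    simp only [List.length_cons] at hS hne
    have h4 := hne S.length (by omega)
    refine ⟨?_, ?_, ih h3 (by omega) fun k hk => hne k (by omega)⟩
    · rw [Function.update_of_ne, h1]
      rw [ne_eq, BitVec.ofNat_inj_of_lt (by omega) ha]; exact h4.1.symm
    · rw [Function.update_of_ne, h2]
      rw [ne_eq, BitVec.ofNat_inj_of_lt (by omega) ha]; exact h4.2.symm

/-- The registers and the working memory represent a state of the algorithm: for each string the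
bottom of the stack, the number of characters to skip and the stack, and the number of characters
matched. -/
structure StateRep {b : ℕ} (addr : ℕ → BitVec b) (R : ℕ → BitVec b) (m : BitVec b → BitVec b)
    (p₁ k₁ : ℕ) (S₁ : List (ℕ × ℕ)) (p₂ k₂ : ℕ) (S₂ : List (ℕ × ℕ)) (acc : ℕ) : Prop where
  r4 : R 4 = BitVec.ofNat b (p₁ + 4 * S₁.length)
  r5 : R 5 = BitVec.ofNat b p₁
  r6 : R 6 = BitVec.ofNat b k₁
  r7 : R 7 = BitVec.ofNat b (p₂ + 4 * S₂.length)
  r8 : R 8 = BitVec.ofNat b p₂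
  r9 : R 9 = BitVec.ofNat b k₂
  r10 : R 10 = BitVec.ofNat b acc
  r11 : R 11 = BitVec.ofNat b 1
  r12 : R 12 = BitVec.ofNat b 2
  r13 : R 13 = BitVec.ofNat b 3
  r14 : R 14 = BitVec.ofNat b 4
  r15 : R 15 = BitVec.ofNat b 0
  stack₁ : StackAt addr m p₁ S₁
  stack₂ : StackAt addr m p₂ S₂
  base : p₁ = 0 ∧ p₂ = 2 ∨ p₁ = 2 ∧ p₂ = 0
  size₁ : 4 * S₁.length + 8 ≤ 2 ^ b
  size₂ : 4 * S₂.length + 8 ≤ 2 ^ b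
  skip₁ : k₁ < 2 ^ b
  skip₂ : k₂ < 2 ^ b

namespace StateRep

variable {b : ℕ} {addr : ℕ → BitVec b} {R R' : ℕ → BitVec b} {m : BitVec b → BitVec b}
    {p₁ k₁ : ℕ} {S₁ : List (ℕ × ℕ)} {p₂ k₂ : ℕ} {S₂ : List (ℕ × ℕ)} {acc : ℕ}
    {input : BitVec b → BitVec b} {o₁ o₂ x y d e : ℕ}

/-- The configuration is at the head of the main loop, in the given state. -/
def AtLoop (addr : ℕ → BitVec b) (p₁ k₁ : ℕ) (S₁ : List (ℕ × ℕ)) (p₂ k₂ : ℕ)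
    (S₂ : List (ℕ × ℕ)) (acc : ℕ) (c : Config b) : Prop :=
  c.pc = 18 ∧ StateRep addr c.reg c.work p₁ k₁ S₁ p₂ k₂ S₂ acc

/-- The program has stopped with the given answer. -/
def Halted (o₁ o₂ acc : ℕ) (c : Config b) : Prop :=
  (lceProgram o₁ o₂)[c.pc]? = none ∧ c.reg 0 = BitVec.ofNat b acc

theorem halt (h : StateRep addr R m p₁ k₁ S₁ p₂ k₂ S₂ acc) :
    Leads (lceProgram o₁ o₂) input 1 ⟨106, R, m⟩ (Halted o₁ o₂ acc) :=
  .move rfl h.r10 (.done ⟨rfl, by simp⟩)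

theorem halt_nil_left (h : StateRep addr R m p₁ k₁ [] p₂ k₂ S₂ acc) :
    Leads (lceProgram o₁ o₂) input 2 ⟨18, R, m⟩ (Halted o₁ o₂ acc) :=
  .jeq_pos rfl (by simp [h.r4, h.r5]) h.halt

theorem sp_ne_left {p : ℕ × ℕ} (h : StateRep addr R m p₁ k₁ (p :: S₁) p₂ k₂ S₂ acc) : R 4 ≠ R 5 := by
  have := h.base
  have := h.size₁
  simp only [List.length_cons] at this
  rw [h.r4, h.r5, ne_eq, List.length_cons, BitVec.ofNat_inj_of_lt (by omega) (by omega)]; omega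

theorem sp_ne_right {p : ℕ × ℕ} (h : StateRep addr R m p₁ k₁ S₁ p₂ k₂ (p :: S₂) acc) : R 7 ≠ R 8 := by
  have := h.base
  have := h.size₂
  simp only [List.length_cons] at this
  rw [h.r7, h.r8, ne_eq, List.length_cons, BitVec.ofNat_inj_of_lt (by omega) (by omega)]; omega

theorem halt_nil_right {p : ℕ × ℕ} (h : StateRep addr R m p₁ k₁ (p :: S₁) p₂ k₂ [] acc) :
    Leads (lceProgram o₁ o₂) input 3 ⟨18, R, m⟩ (Halted o₁ o₂ acc) :=
  .jeq_neg rfl h.sp_ne_left (.jeq_pos rfl (by simp [h.r7, h.r8]) h.halt)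

/-- Only auxiliary registers differ. -/
theorem congr (h : StateRep addr R m p₁ k₁ S₁ p₂ k₂ S₂ acc) (hR : ∀ r, 4 ≤ r → r < 16 → R' r = R r) :
    StateRep addr R' m p₁ k₁ S₁ p₂ k₂ S₂ acc := by
  constructor <;> first | (rw [hR _ (by omega) (by omega)]) | skip
  exacts [h.r4, h.r5, h.r6, h.r7, h.r8, h.r9, h.r10, h.r11, h.r12, h.r13, h.r14, h.r15, h.stack₁,
    h.stack₂, h.base, h.size₁, h.size₂, h.skip₁, h.skip₂]

/-- The registers `20`, `21`, `28`, `29` describe the top of the first stack. -/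
structure Top (addr : ℕ → BitVec b) (R : ℕ → BitVec b) (p₁ : ℕ) (x d : ℕ) (S₁ : List (ℕ × ℕ)) :
    Prop where
  r20 : R 20 = addr x
  r21 : R 21 = BitVec.ofNat b d
  r28 : R 28 = BitVec.ofNat b (p₁ + 4 * S₁.length)
  r29 : R 29 = BitVec.ofNat b (p₁ + 4 * S₁.length + 1)

/-- The rest of the computation is a hypothesis about an arbitrary register file `R'`: of the
auxiliary registers only the contents listed there are remembered. -/
theorem fetch (h : StateRep addr R m p₁ k₁ ((x, d) :: S₁) p₂ k₂ ((y, e) :: S₂) acc)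
    {N : ℕ} {Q : Config b → Prop}
    (hQ : ∀ R' : ℕ → BitVec b, StateRep addr R' m p₁ k₁ ((x, d) :: S₁) p₂ k₂ ((y, e) :: S₂) acc →
      Top addr R' p₁ x d S₁ → R' 22 = input (addr x) →
      Leads (lceProgram o₁ o₂) input N ⟨25, R', m⟩ Q) :
    Leads (lceProgram o₁ o₂) input (N + 7) ⟨18, R, m⟩ Q := by
  have h28 : R 4 - R 14 = BitVec.ofNat b (p₁ + 4 * S₁.length) := by
    rw [h.r4, h.r14, BitVec.ofNat_sub_ofNat_of_le' (by simp; omega)]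
    simp [Nat.mul_add, ← Nat.add_assoc]
  have h11 := h.r11
  obtain ⟨hs1, hs2, hs3⟩ := h.stack₁
  refine .jeq_neg rfl h.sp_ne_left <| .jeq_neg rfl h.sp_ne_right <| .sub rfl h28 <|
    .load rfl (v := addr x) (by simpa using hs1) <|
    .add rfl (v := BitVec.ofNat b (p₁ + 4 * S₁.length + 1))
      (by simp [h11, BitVec.ofNat_add]) <|
    .load rfl (v := BitVec.ofNat b d) (by simpa [Function.update_apply] using hs2) <|
    .read rfl (v := input (addr x)) (by simp) <|
    hQ _ (h.congr ?_) ⟨?_, ?_, ?_, ?_⟩ ?_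
  · intro r h1 h2
    interval_cases r <;> rfl
  all_goals simp

end StateRep

theorem StackAt.push {b : ℕ} {addr : ℕ → BitVec b} {m : BitVec b → BitVec b} {base x d : ℕ}
    {S : List (ℕ × ℕ)} (h : StackAt addr m base S) (hb : base ≤ 2)
    (hS : 4 * S.length + 4 ≤ 2 ^ b) :
    StackAt addr (Function.update (Function.update m (BitVec.ofNat b (base + 4 * S.length))
      (addr x)) (BitVec.ofNat b (base + 4 * S.length + 1)) (BitVec.ofNat b d)) base
      ((x, d) :: S) := by
  refine ⟨?_, by simp, ?_⟩
  · rw [Function.update_of_ne, Function.update_self]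
    rw [ne_eq, BitVec.ofNat_inj_of_lt (by omega) (by omega)]; omega
  · exact (h.update (by omega) (by omega) fun k hk => by omega).update (by omega) (by omega)
      fun k hk => by omega

theorem StackAt.set_count {b : ℕ} {addr : ℕ → BitVec b} {m : BitVec b → BitVec b} {base x d d' : ℕ}
    {S : List (ℕ × ℕ)} (h : StackAt addr m base ((x, d) :: S)) (hb : base ≤ 2)
    (hS : 4 * S.length + 4 ≤ 2 ^ b) :
    StackAt addr (Function.update m (BitVec.ofNat b (base + 4 * S.length + 1)) (BitVec.ofNat b d'))
      base ((x, d') :: S) := by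
  obtain ⟨h1, h2, h3⟩ := h
  refine ⟨?_, by simp, ?_⟩
  · rw [Function.update_of_ne, h1]
    rw [ne_eq, BitVec.ofNat_inj_of_lt (by omega) (by omega)]; omega
  · exact h3.update (by omega) (by omega) fun k hk => by omega

/-! ### The effect of the sections of the program on the state. -/

namespace StateRep

variable {b : ℕ} {addr : ℕ → BitVec b} {R R' : ℕ → BitVec b} {m m' : BitVec b → BitVec b}
    {p₁ k₁ k₁' : ℕ} {S₁ S₁' : List (ℕ × ℕ)} {p₂ k₂ k₂' : ℕ} {S₂ S₂' : List (ℕ × ℕ)} {acc acc' : ℕ}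
    {input : BitVec b → BitVec b} {o₁ o₂ x y d e l r L : ℕ}

/-- Only the indicated parts of the state differ. -/
theorem modify (h : StateRep addr R m p₁ k₁ S₁ p₂ k₂ S₂ acc)
    (hR : ∀ r, r = 5 ∨ r = 8 ∨ r = 9 ∨ 11 ≤ r ∧ r < 16 → R' r = R r)
    (h4 : R' 4 = BitVec.ofNat b (p₁ + 4 * S₁'.length)) (h6 : R' 6 = BitVec.ofNat b k₁')
    (h7 : R' 7 = BitVec.ofNat b (p₂ + 4 * S₂'.length)) (h10 : R' 10 = BitVec.ofNat b acc')
    (hs₁ : StackAt addr m' p₁ S₁') (hs₂ : StackAt addr m' p₂ S₂')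
    (h₁ : 4 * S₁'.length + 8 ≤ 2 ^ b) (h₂ : S₂'.length ≤ S₂.length) (hk : k₁' ≤ k₁) :
    StateRep addr R' m' p₁ k₁' S₁' p₂ k₂ S₂' acc' where
  r4 := h4
  r5 := by rw [hR _ (by omega), h.r5]
  r6 := h6
  r7 := h7
  r8 := by rw [hR _ (by omega), h.r8]
  r9 := by rw [hR _ (by omega), h.r9]
  r10 := h10
  r11 := by rw [hR _ (by omega), h.r11]
  r12 := by rw [hR _ (by omega), h.r12]
  r13 := by rw [hR _ (by omega), h.r13]
  r14 := by rw [hR _ (by omega), h.r14]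
  r15 := by rw [hR _ (by omega), h.r15]
  stack₁ := hs₁
  stack₂ := hs₂
  base := h.base
  size₁ := h₁
  size₂ := by have := h.size₂; omega
  skip₁ := by have := h.skip₁; omega
  skip₂ := h.skip₂

theorem base₁_le (h : StateRep addr R m p₁ k₁ S₁ p₂ k₂ S₂ acc) : p₁ ≤ 2 := by
  have := h.base; omega

theorem base₂_le (h : StateRep addr R m p₁ k₁ S₁ p₂ k₂ S₂ acc) : p₂ ≤ 2 := by
  have := h.base; omega

/-- Writing into the cells of the first stack does not change the second one. -/
theorem stack₂_update (h : StateRep addr R m p₁ k₁ S₁ p₂ k₂ S₂ acc) {m : BitVec b → BitVec b}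
    (hm : StackAt addr m p₂ S₂) {k a : ℕ} (ha : a = p₁ + 4 * k ∨ a = p₁ + 4 * k + 1)
    (hk : 4 * k + 4 ≤ 2 ^ b) (v : BitVec b) :
    StackAt addr (Function.update m (BitVec.ofNat b a) v) p₂ S₂ := by
  -- The bases are `0` and `2`, entries have two cells and the stride is `4`, so the cells of the
  -- two stacks differ modulo `4`.
  have := h.base
  have := h.size₂
  exact hm.update (by omega) (by omega) fun k hk => by omega

theorem stack₁_update (h : StateRep addr R m p₁ k₁ S₁ p₂ k₂ S₂ acc) {m : BitVec b → BitVec b}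
    (hm : StackAt addr m p₁ S₁) {k a : ℕ} (ha : a = p₂ + 4 * k ∨ a = p₂ + 4 * k + 1)
    (hk : 4 * k + 4 ≤ 2 ^ b) (v : BitVec b) :
    StackAt addr (Function.update m (BitVec.ofNat b a) v) p₁ S₁ := by
  have := h.base
  have := h.size₁
  exact hm.update (by omega) (by omega) fun k hk => by omega

/-- The top entry is overwritten in place and its count `d` is lost. This is harmless, since
`GoodStack` admits runs with multiplicity one only. -/
theorem expandRun (h : StateRep addr R m p₁ k₁ ((x, d) :: S₁) p₂ k₂ S₂ acc)
    (ht : Top addr R p₁ x d S₁) (h22 : R 22 = BitVec.ofNat b 2)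
    (hy : input (addr x + BitVec.ofNat b 1) = addr y)
    (he : input (addr x + BitVec.ofNat b 2) = BitVec.ofNat b e) :
    Leads (lceProgram o₁ o₂) input 8 ⟨25, R, m⟩ (AtLoop addr p₁ k₁ ((y, e) :: S₁) p₂ k₂ S₂ acc) := by
  have hs := h.size₁
  have h20 := ht.r20
  have h11 := h.r11
  have h12 := h.r12
  simp only [List.length_cons] at hs
  refine .jeq_pos rfl (by rw [h22, h.r12]) <| .add rfl (by rw [ht.r20, h.r11]) <|
    .read rfl (v := addr y) (by simpa using hy) <|
    .store rfl (a := BitVec.ofNat b (p₁ + 4 * S₁.length)) (v := addr y)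
      (by simpa [Function.update_apply] using ht.r28) (by simp) <|
    .add rfl (v := addr x + BitVec.ofNat b 2) (by simp [h20, h12]) <|
    .read rfl (v := BitVec.ofNat b e) (by simpa using he) <|
    .store rfl (a := BitVec.ofNat b (p₁ + 4 * S₁.length + 1)) (v := BitVec.ofNat b e)
      (by simpa [Function.update_apply] using ht.r29) (by simp) <| .jump rfl <|
    .done ⟨rfl, h.modify ?_ ?_ ?_ ?_ ?_ ?_ ?_ ?_ ?_ ?_⟩
  · rintro r (rfl | rfl | rfl | ⟨h1, h2⟩)
    iterate 3 rfl
    interval_cases r <;> rfl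
  · exact h.r4
  · exact h.r6
  · exact h.r7
  · exact h.r10
  · exact h.stack₁.2.2.push h.base₁_le (by omega)
  · exact h.stack₂_update (h.stack₂_update h.stack₂ (.inl rfl) (by omega) _) (.inr rfl) (by omega) _
  all_goals simp
  omega

theorem expandPair (h : StateRep addr R m p₁ k₁ ((x, d) :: S₁) p₂ k₂ S₂ acc)
    (ht : Top addr R p₁ x d S₁) (hd : 1 ≤ d) (hdb : d < 2 ^ b)
    (hl : input (addr x + BitVec.ofNat b o₁) = addr l)
    (hr : input (addr x + BitVec.ofNat b o₂) = addr r)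
    (hS : S₁' = if d = 1 then S₁ else (x, d - 1) :: S₁)
    (hsize : 4 * S₁'.length + 16 ≤ 2 ^ b) :
    Leads (lceProgram o₁ o₂) input 19 ⟨39, R, m⟩
      (AtLoop addr p₁ k₁ ((l, 1) :: (r, 1) :: S₁') p₂ k₂ S₂ acc) := by
  -- The cases of one and of several copies join at instruction 43, where the remaining copies of
  -- `x`, if any, are already back in the stack `S₁'`.
  have key : ∀ (R' : ℕ → BitVec b) (m' : BitVec b → BitVec b),
      R' 20 = addr x →
      StackAt addr m' p₁ S₁' → StackAt addr m' p₂ S₂ →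
      R' 28 = BitVec.ofNat b (p₁ + 4 * S₁'.length) →
      (∀ r, 4 ≤ r → r < 16 → R' r = R r) →
      Leads (lceProgram o₁ o₂) input 15 ⟨43, R', m'⟩
        (AtLoop addr p₁ k₁ ((l, 1) :: (r, 1) :: S₁') p₂ k₂ S₂ acc) := by
    intro R' m' h20 hst₁ hst₂ h28 hR
    have h11 : R' 11 = BitVec.ofNat b 1 := by rw [hR _ (by omega) (by omega), h.r11]
    have h14 : R' 14 = BitVec.ofNat b 4 := by rw [hR _ (by omega) (by omega), h.r14]
    refine .const rfl <| .add rfl (v := addr x + BitVec.ofNat b o₂) (by simp [h20]) <|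
      .read rfl (v := addr r) (by simpa using hr) <|
      .store rfl (a := BitVec.ofNat b (p₁ + 4 * S₁'.length)) (v := addr r)
        (by simpa using h28) (by simp) <|
      .add rfl (v := BitVec.ofNat b (p₁ + 4 * S₁'.length + 1))
        (by simp [h28, h11, BitVec.ofNat_add]) <|
      .store rfl (a := BitVec.ofNat b (p₁ + 4 * S₁'.length + 1)) (v := BitVec.ofNat b 1)
        (by simp) (by simp [h11]) <|
      .add rfl (v := BitVec.ofNat b (p₁ + 4 * ((r, 1) :: S₁').length))
        (by simp [h28, h14, BitVec.ofNat_add, Nat.mul_add, ← Nat.add_assoc]) <|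
      .const rfl <| .add rfl (v := addr x + BitVec.ofNat b o₁) (by simp [h20]) <|
      .read rfl (v := addr l) (by simpa using hl) <|
      .store rfl (a := BitVec.ofNat b (p₁ + 4 * ((r, 1) :: S₁').length)) (v := addr l)
        (by simp) (by simp) <|
      .add rfl (v := BitVec.ofNat b (p₁ + 4 * ((r, 1) :: S₁').length + 1))
        (by simp [h11, BitVec.ofNat_add]) <|
      .store rfl (a := BitVec.ofNat b (p₁ + 4 * ((r, 1) :: S₁').length + 1))
        (v := BitVec.ofNat b 1) (by simp) (by simp [h11]) <|
      .add rfl (v := BitVec.ofNat b (p₁ + 4 * ((l, 1) :: (r, 1) :: S₁').length))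
        (by simp [h14, BitVec.ofNat_add, Nat.mul_add, ← Nat.add_assoc]) <|
      .jump rfl <| .done ⟨rfl, h.modify ?_ ?_ ?_ ?_ ?_ ?_ ?_ ?_ ?_ ?_⟩
    · rintro r (rfl | rfl | rfl | ⟨h1, h2⟩)
      iterate 3 exact hR _ (by omega) (by omega)
      interval_cases r <;> exact hR _ (by omega) (by omega)
    · simp
    · simpa using (hR 6 (by omega) (by omega)).trans h.r6
    · simpa using (hR 7 (by omega) (by omega)).trans h.r7
    · simpa using (hR 10 (by omega) (by omega)).trans h.r10
    · exact (hst₁.push h.base₁_le (by omega)).push h.base₁_le (by simp; omega)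
    · refine h.stack₂_update (h.stack₂_update (h.stack₂_update (h.stack₂_update hst₂
        (.inl rfl) ?_ _) (.inr rfl) ?_ _) (.inl rfl) ?_ _) (.inr rfl) ?_ _
      all_goals
        try simp only [List.length_cons]
        omega
    · simp; omega
    · simp
    · simp
  have hs := h.size₁
  have h11 := h.r11
  have h14 := h.r14
  have h21 := ht.r21
  have h28 := ht.r28
  simp only [List.length_cons] at hs
  by_cases hd1 : d = 1
  · rw [if_pos hd1] at hS
    subst hS
    exact (Leads.jeq_pos rfl (by rw [h21, h11, hd1]) <| key R m ht.r20 h.stack₁.2.2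
      h.stack₂ h28 fun _ _ _ => rfl).mono (by omega) fun _ => id
  · rw [if_neg hd1] at hS
    subst hS
    refine .jeq_neg rfl ?_ <| .sub rfl (v := BitVec.ofNat b (d - 1))
      (by rw [h21, h11, BitVec.ofNat_sub_ofNat_of_le' hd]) <|
      .store rfl (a := BitVec.ofNat b (p₁ + 4 * S₁.length + 1)) (v := BitVec.ofNat b (d - 1))
        (by simpa using ht.r29) (by simp) <|
      .add rfl (v := BitVec.ofNat b (p₁ + 4 * ((x, d - 1) :: S₁).length))
        (by simp [h28, h14, BitVec.ofNat_add, Nat.mul_add, ← Nat.add_assoc]) <|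
      key _ _ (by simpa using ht.r20) (h.stack₁.set_count h.base₁_le (by omega))
        (h.stack₂_update h.stack₂ (.inr rfl) (by omega) _) (by simp) fun r h1 h2 => ?_
    · rw [h21, h11, ne_eq, BitVec.ofNat_inj_of_lt hdb (by omega)]; exact hd1
    · interval_cases r <;> rfl

theorem skipAll (h : StateRep addr R m p₁ k₁ ((x, d) :: S₁) p₂ k₂ S₂ acc)
    (ht : Top addr R p₁ x d S₁) (hx : input (addr x) ≠ BitVec.ofNat b 2)
    (h22 : R 22 = input (addr x)) (hk : 0 < k₁)
    (hL : input (addr x + BitVec.ofNat b 3) = BitVec.ofNat b L) (hle : d * L ≤ k₁) :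
    Leads (lceProgram o₁ o₂) input 9 ⟨25, R, m⟩
      (AtLoop addr p₁ (k₁ - d * L) S₁ p₂ k₂ S₂ acc) := by
  have hs := h.size₁
  have hk₁ := h.skip₁
  have h6 := h.r6
  have h20 := ht.r20
  have h21 := ht.r21
  have h13 := h.r13
  simp only [List.length_cons] at hs
  refine .jeq_neg rfl (by rw [h22, h.r12]; exact hx) <|
    .jlt_pos rfl (by rw [h.r15, h.r6, BitVec.toNat_ofNat_of_lt' (by omega),
      BitVec.toNat_ofNat_of_lt' (by omega)]; exact hk) <|
    .add rfl (v := addr x + BitVec.ofNat b 3) (by simp [h20, h13]) <|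
    .read rfl (v := BitVec.ofNat b L) (by simpa using hL) <|
    .mul rfl (v := BitVec.ofNat b (d * L))
      (by simp [h21, BitVec.ofNat_mul, mul_comm]) <|
    .jlt_neg rfl ?_ <|
    .sub rfl (v := BitVec.ofNat b (k₁ - d * L))
      (by simp [h6, BitVec.ofNat_sub_ofNat_of_le' hle]) <|
    .move rfl (v := BitVec.ofNat b (p₁ + 4 * S₁.length)) (by simpa using ht.r28) <|
    .jump rfl <| .done ⟨rfl, h.modify ?_ ?_ ?_ ?_ ?_ ?_ ?_ ?_ ?_ ?_⟩
  · simp only [Function.update_apply]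
    simp only [Nat.reduceEqDiff, if_false, if_true, h6]
    rw [BitVec.toNat_ofNat_of_lt' (by omega), BitVec.toNat_ofNat_of_lt' (by omega)]; exact hle
  · rintro r (rfl | rfl | rfl | ⟨h1, h2⟩)
    iterate 3 rfl
    interval_cases r <;> rfl
  · simp
  · simp
  · exact h.r7
  · exact h.r10
  · exact h.stack₁.2.2
  · exact h.stack₂
  · omega
  · exact le_rfl
  · omega

/-- One division skips all the whole copies of `x`. If a residue remains, it lies strictly inside
the next copy, and the program goes on to expand this copy without returning to the loop; hence the
two continuations `hloop` and `hexp`. -/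
theorem skipPart (h : StateRep addr R m p₁ k₁ ((x, d) :: S₁) p₂ k₂ S₂ acc)
    (ht : Top addr R p₁ x d S₁) (hx : input (addr x) ≠ BitVec.ofNat b 2)
    (h22 : R 22 = input (addr x)) (hk : 0 < k₁)
    (hL : input (addr x + BitVec.ofNat b 3) = BitVec.ofNat b L) (hlt : k₁ < d * L)
    (hdL : d * L < 2 ^ b) {N : ℕ} {Q : Config b → Prop}
    (hloop : k₁ % L = 0 → ∀ c, AtLoop addr p₁ 0 ((x, d - k₁ / L) :: S₁) p₂ k₂ S₂ acc c → Q c)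
    (hexp : 0 < k₁ % L → ∀ R' m', StateRep addr R' m' p₁ (k₁ % L) ((x, d - k₁ / L) :: S₁) p₂ k₂ S₂ acc →
      Top addr R' p₁ x (d - k₁ / L) S₁ → Leads (lceProgram o₁ o₂) input N ⟨39, R', m'⟩ Q) :
    Leads (lceProgram o₁ o₂) input (N + 13) ⟨25, R, m⟩ Q := by
  have hs := h.size₁
  have hk₁ := h.skip₁
  have h6 := h.r6
  have h15 := h.r15
  have h20 := ht.r20
  have h21 := ht.r21
  have h29 := ht.r29
  have h13 := h.r13
  have hL0 : 0 < L := Nat.pos_of_ne_zero fun h => by simp [h] at hlt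
  have hd0 : 0 < d := Nat.pos_of_ne_zero fun h => by simp [h] at hlt
  have hdv := Nat.div_lt_of_lt_mul (by rwa [mul_comm] at hlt)
  have hLb : L < 2 ^ b := lt_of_le_of_lt (Nat.le_mul_of_pos_left L hd0) hdL
  have hdm := Nat.div_add_mod' k₁ L
  simp only [List.length_cons] at hs
  have hrep : ∀ R' : ℕ → BitVec b, (∀ r, 4 ≤ r → r < 16 → r ≠ 6 → R' r = R r) →
      R' 6 = BitVec.ofNat b (k₁ % L) → StateRep addr R' (Function.update m
        (BitVec.ofNat b (p₁ + 4 * S₁.length + 1)) (BitVec.ofNat b (d - k₁ / L)))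
        p₁ (k₁ % L) ((x, d - k₁ / L) :: S₁) p₂ k₂ S₂ acc := by
    intro R' hR' hR6
    refine h.modify ?_ ?_ hR6 ?_ ?_ ?_ ?_ ?_ ?_ ?_
    · intro r h
      exact hR' r (by omega) (by omega) (by omega)
    · rw [hR' 4 (by omega) (by omega) (by omega), h.r4]; rfl
    · rw [hR' 7 (by omega) (by omega) (by omega), h.r7]
    · rw [hR' 10 (by omega) (by omega) (by omega), h.r10]
    · exact h.stack₁.set_count h.base₁_le (by omega)
    · exact h.stack₂_update h.stack₂ (.inr rfl) (by omega) _
    · simp; omega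
    · exact le_rfl
    · omega
  refine .jeq_neg rfl (by rw [h22, h.r12]; exact hx) <|
    .jlt_pos rfl (by rw [h.r15, h.r6, BitVec.toNat_ofNat_of_lt' (by omega),
      BitVec.toNat_ofNat_of_lt' (by omega)]; exact hk) <|
    .add rfl (v := addr x + BitVec.ofNat b 3) (by simp [h20, h13]) <|
    .read rfl (v := BitVec.ofNat b L) (by simpa using hL) <|
    .mul rfl (v := BitVec.ofNat b (d * L))
      (by simp [h21, BitVec.ofNat_mul, mul_comm]) <|
    .jlt_pos rfl ?_ <|
    .div rfl (v := BitVec.ofNat b (k₁ / L))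
      (by simp only [Function.update_apply]; simp only [Nat.reduceEqDiff, if_false, if_true, h6]
          exact BitVec.udiv_ofNat_of_lt hk₁ hLb) <|
    .sub rfl (v := BitVec.ofNat b (d - k₁ / L))
      (by simp [h21, BitVec.ofNat_sub_ofNat_of_le' hdv.le]) <|
    .mul rfl (v := BitVec.ofNat b (k₁ / L * L)) (by simp [BitVec.ofNat_mul]) <|
    .sub rfl (v := BitVec.ofNat b (k₁ % L)) ?_ <|
    .store rfl (a := BitVec.ofNat b (p₁ + 4 * S₁.length + 1)) (v := BitVec.ofNat b (d - k₁ / L))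
      (by simpa [Function.update_apply] using h29) (by simp) ?_
  · simp only [Function.update_apply]
    simp only [Nat.reduceEqDiff, if_false, if_true, h6]
    rw [BitVec.toNat_ofNat_of_lt' (by omega), BitVec.toNat_ofNat_of_lt' (by omega)]; exact hlt
  · simp only [Function.update_apply]
    simp only [Nat.reduceEqDiff, if_false, if_true, h6]
    rw [BitVec.ofNat_sub_ofNat_of_le' (by omega)]
    congr 1; omega
  · have hmod := Nat.mod_lt k₁ hL0
    rcases Nat.eq_zero_or_pos (k₁ % L) with h0 | h0
    · refine .jlt_neg rfl ?_ <| .jump rfl <| .done <| hloop h0 _ ⟨rfl, ?_⟩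
      · simp [h15, h0]
      · have := hrep
        rw [h0] at this
        refine this _ (fun r h1 h2 h3 => ?_) (by simp [h0])
        interval_cases r <;> first | rfl | exact absurd rfl h3
    · refine .jlt_pos rfl ?_ ((hexp h0 _ _ (hrep _ (fun r h1 h2 h3 => ?_) (by simp))
        ⟨?_, ?_, ?_, ?_⟩).mono (by omega) fun _ => id)
      · simp only [Function.update_apply]
        simp only [Nat.reduceEqDiff, if_false, if_true, h15]
        rw [BitVec.toNat_ofNat_of_lt' (by omega), BitVec.toNat_ofNat_of_lt' (by omega)]; exact h0
      · interval_cases r <;> first | rfl | exact absurd rfl h3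
      · exact ht.r20
      · simp
      · exact ht.r28
      · exact ht.r29

/-- The registers `23`, `25`, `30` describe the top of the second stack. -/
theorem fetch₂ (h : StateRep addr R m p₁ 0 ((x, d) :: S₁) p₂ k₂ ((y, e) :: S₂) acc)
    (ht : Top addr R p₁ x d S₁) (hx : input (addr x) ≠ BitVec.ofNat b 2)
    (h22 : R 22 = input (addr x)) {N : ℕ} {Q : Config b → Prop}
    (hQ : ∀ R' : ℕ → BitVec b, StateRep addr R' m p₁ 0 ((x, d) :: S₁) p₂ k₂ ((y, e) :: S₂) acc →
      Top addr R' p₁ x d S₁ → R' 22 = input (addr x) → R' 23 = addr y → R' 25 = input (addr y) →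
      R' 30 = BitVec.ofNat b (p₂ + 4 * S₂.length) →
      Leads (lceProgram o₁ o₂) input N ⟨30, R', m⟩ Q) :
    Leads (lceProgram o₁ o₂) input (N + 5) ⟨25, R, m⟩ Q := by
  have h30 : R 7 - R 14 = BitVec.ofNat b (p₂ + 4 * S₂.length) := by
    rw [h.r7, h.r14, BitVec.ofNat_sub_ofNat_of_le' (by simp; omega)]
    simp [Nat.mul_add, ← Nat.add_assoc]
  obtain ⟨hs1, hs2, hs3⟩ := h.stack₂
  refine .jeq_neg rfl (by rw [h22, h.r12]; exact hx) <|
    .jlt_neg rfl (by rw [h.r15, h.r6]) <| .sub rfl h30 <|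
    .load rfl (v := addr y) (by simpa using hs1) <|
    .read rfl (v := input (addr y)) (by simp) <|
    hQ _ (h.congr ?_) ⟨ht.r20, ht.r21, ht.r28, ht.r29⟩ h22 (by simp) (by simp) (by simp)
  intro r h1 h2
  interval_cases r <;> rfl

theorem swap (h : StateRep addr R m p₁ k₁ S₁ p₂ k₂ S₂ acc) :
    Leads (lceProgram o₁ o₂) input 10 ⟨79, R, m⟩ (AtLoop addr p₂ k₂ S₂ p₁ k₁ S₁ acc) := by
  refine .move rfl h.r4 <| .move rfl (v := R 7) (by simp) <|
    .move rfl (v := BitVec.ofNat b (p₁ + 4 * S₁.length)) (by simp) <|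
    .move rfl (v := R 5) (by simp) <| .move rfl (v := R 8) (by simp) <|
    .move rfl (v := R 5) (by simp) <| .move rfl (v := R 6) (by simp) <|
    .move rfl (v := R 9) (by simp) <| .move rfl (v := R 6) (by simp) <| .jump rfl <|
    .done ⟨rfl, ?_⟩
  exact ⟨h.r7, h.r8, h.r9, rfl, h.r5, h.r6, h.r10, h.r11, h.r12, h.r13, h.r14, h.r15, h.stack₂,
    h.stack₁, h.base.symm.imp And.symm And.symm, h.size₂, h.size₁, h.skip₂, h.skip₁⟩

/-- The lengths of both tops are compared. -/
theorem fetchLengths (h : StateRep addr R m p₁ k₁ ((x, d) :: S₁) p₂ k₂ ((y, e) :: S₂) acc)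
    (ht : Top addr R p₁ x d S₁) (h23 : R 23 = addr y)
    (h30 : R 30 = BitVec.ofNat b (p₂ + 4 * S₂.length)) (h22 : R 22 = input (addr x))
    {L₁ L₂ : ℕ} (hL₁ : input (addr x + BitVec.ofNat b 3) = BitVec.ofNat b L₁)
    (hL₂ : input (addr y + BitVec.ofNat b 3) = BitVec.ofNat b L₂) {N : ℕ} {Q : Config b → Prop}
    (hQ : ∀ R' : ℕ → BitVec b, StateRep addr R' m p₁ k₁ ((x, d) :: S₁) p₂ k₂ ((y, e) :: S₂) acc →
      Top addr R' p₁ x d S₁ → R' 22 = input (addr x) → R' 23 = addr y →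
      R' 30 = BitVec.ofNat b (p₂ + 4 * S₂.length) →
      R' 26 = BitVec.ofNat b L₁ → R' 27 = BitVec.ofNat b L₂ →
      Leads (lceProgram o₁ o₂) input N ⟨36, R', m⟩ Q) :
    Leads (lceProgram o₁ o₂) input (N + 4) ⟨32, R, m⟩ Q := by
  have h20 := ht.r20
  have h13 := h.r13
  refine .add rfl (v := addr x + BitVec.ofNat b 3) (by simp [h20, h13]) <|
    .read rfl (v := BitVec.ofNat b L₁) (by simpa using hL₁) <|
    .add rfl (v := addr y + BitVec.ofNat b 3) (by simp [h23, h13]) <|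
    .read rfl (v := BitVec.ofNat b L₂) (by simpa using hL₂) <|
    hQ _ (h.congr ?_) ⟨ht.r20, ht.r21, ht.r28, ht.r29⟩ h22 h23 h30 (by simp) (by simp)
  intro r h1 h2
  interval_cases r <;> rfl

/-- A power with the smaller of the two multiplicities is matched by a single multiplication, so the
time does not depend on the exponents of runs. -/
theorem matchTops (h : StateRep addr R m p₁ k₁ ((x, d) :: S₁) p₂ k₂ ((y, e) :: S₂) acc)
    (ht : Top addr R p₁ x d S₁) (h30 : R 30 = BitVec.ofNat b (p₂ + 4 * S₂.length))
    (h26 : R 26 = BitVec.ofNat b L) (hd : d < 2 ^ b) (he : e < 2 ^ b) :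
    Leads (lceProgram o₁ o₂) input 11 ⟨89, R, m⟩ fun c =>
      (d < e ∧ AtLoop addr p₁ k₁ S₁ p₂ k₂ ((y, e - d) :: S₂) (acc + d * L) c) ∨
      (e ≤ d ∧ AtLoop addr p₁ k₁ (if d = e then S₁ else (x, d - e) :: S₁) p₂ k₂ S₂
        (acc + e * L) c) := by
  have hs₁ := h.size₁
  have hs₂ := h.size₂
  have h11 := h.r11
  have h10 := h.r10
  have h15 := h.r15
  have h21 := ht.r21
  simp only [List.length_cons] at hs₁ hs₂
  refine .add rfl (v := BitVec.ofNat b (p₂ + 4 * S₂.length + 1))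
      (by simp [h30, h11, BitVec.ofNat_add]) <|
    .load rfl (v := BitVec.ofNat b e) (by simpa using h.stack₂.2.1) ?_
  rcases lt_or_ge d e with hde | hde
  · refine .jlt_pos rfl ?_ <|
      .mul rfl (v := BitVec.ofNat b (d * L)) (by simp [h21, h26, BitVec.ofNat_mul]) <|
      .add rfl (v := BitVec.ofNat b (acc + d * L)) (by simp [h10, BitVec.ofNat_add]) <|
      .sub rfl (v := BitVec.ofNat b (e - d))
        (by simp [h21, BitVec.ofNat_sub_ofNat_of_le' hde.le]) <|
      .store rfl (a := BitVec.ofNat b (p₂ + 4 * S₂.length + 1)) (v := BitVec.ofNat b (e - d))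
        (by simp) (by simp) <|
      .move rfl (v := BitVec.ofNat b (p₁ + 4 * S₁.length)) (by simpa using ht.r28) <| .jump rfl <|
      .done (.inl ⟨hde, rfl, h.modify ?_ ?_ ?_ ?_ ?_ ?_ ?_ ?_ ?_ ?_⟩)
    · simp only [Function.update_apply]
      simp only [Nat.reduceEqDiff, if_false, if_true, h21]
      rw [BitVec.toNat_ofNat_of_lt' (by omega), BitVec.toNat_ofNat_of_lt' (by omega)]; exact hde
    · rintro r (rfl | rfl | rfl | ⟨h1, h2⟩)
      iterate 3 rfl
      interval_cases r <;> rfl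
    · simp
    · exact h.r6
    · exact h.r7
    · simp
    · exact (h.stack₁_update h.stack₁ (k := S₂.length) (.inr rfl) (by omega) _).2.2
    · exact h.stack₂.set_count h.base₂_le (by omega)
    · omega
    · simp
    · simp
  · refine .jlt_neg rfl ?_ <|
      .mul rfl (v := BitVec.ofNat b (e * L)) (by simp [h26, BitVec.ofNat_mul]) <|
      .add rfl (v := BitVec.ofNat b (acc + e * L)) (by simp [h10, BitVec.ofNat_add]) <|
      .move rfl (v := BitVec.ofNat b (p₂ + 4 * S₂.length)) (by simpa using h30) <|
      .sub rfl (v := BitVec.ofNat b (d - e))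
        (by simp [h21, BitVec.ofNat_sub_ofNat_of_le' hde]) <|
      .store rfl (a := BitVec.ofNat b (p₁ + 4 * S₁.length + 1)) (v := BitVec.ofNat b (d - e))
        (by simpa [Function.update_apply] using ht.r29) (by simp) ?_
    · simp only [Function.update_apply]
      simp only [Nat.reduceEqDiff, if_false, if_true, h21]
      rw [BitVec.toNat_ofNat_of_lt' (by omega), BitVec.toNat_ofNat_of_lt' (by omega)]; exact hde
    · by_cases hde' : d = e
      · subst hde'
        rw [if_pos rfl]
        refine .jlt_neg rfl (by simp) <|
          .move rfl (v := BitVec.ofNat b (p₁ + 4 * S₁.length)) (by simpa using ht.r28) <|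
          .jump rfl <| .done (.inr ⟨hde, rfl, h.modify ?_ ?_ ?_ ?_ ?_ ?_ ?_ ?_ ?_ ?_⟩)
        · rintro r (rfl | rfl | rfl | ⟨h1, h2⟩)
          iterate 3 rfl
          interval_cases r <;> rfl
        · simp
        · exact h.r6
        · simp
        · simp
        · exact (h.stack₁.set_count h.base₁_le (by omega)).2.2
        · exact (h.stack₂_update h.stack₂ (k := S₁.length) (.inr rfl) (by omega) _).2.2
        · omega
        · simp
        · simp
      · rw [if_neg hde']
        refine .jlt_pos rfl ?_ <| .done (.inr ⟨hde, rfl, h.modify ?_ ?_ ?_ ?_ ?_ ?_ ?_ ?_ ?_ ?_⟩)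
        · simp only [Function.update_apply]
          simp only [Nat.reduceEqDiff, if_false, if_true, h15]
          rw [BitVec.toNat_ofNat_of_lt' (by omega), BitVec.toNat_ofNat_of_lt' (by omega)]; omega
        · rintro r (rfl | rfl | rfl | ⟨h1, h2⟩)
          iterate 3 rfl
          interval_cases r <;> rfl
        · exact h.r4
        · exact h.r6
        · simp
        · simp
        · exact h.stack₁.set_count h.base₁_le (by omega)
        · exact (h.stack₂_update h.stack₂ (k := S₁.length) (.inr rfl) (by omega) _).2.2
        · simp; omega
        · simp
        · simp

end StateRep

/-! ### The input memory, seen from the left and from the right. -/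

/-- `input` holds the DAG of `G`, where both variables of a pair are stored at the offsets `o₁`,
`o₂`. -/
structure StoredDAG {α : Type*} (G : RunLengthACFG α) {b : ℕ} (input : BitVec b → BitVec b)
    (addr : ℕ → BitVec b) (o₁ o₂ : ℕ) : Prop where
  addr_injOn : Set.InjOn addr G.vars
  char_node : ∀ e ∈ G.vars, ∀ a, G.rhs e = .char a → input (addr e) = BitVec.ofNat b 0
  pair_node : ∀ e ∈ G.vars, ∀ l r, G.rhs e = .pair l r →
    input (addr e) = BitVec.ofNat b 1 ∧
    input (addr e + BitVec.ofNat b o₁) = addr l ∧ input (addr e + BitVec.ofNat b o₂) = addr r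
  run_node : ∀ e ∈ G.vars, ∀ x d, G.rhs e = .run x d →
    input (addr e) = BitVec.ofNat b 2 ∧
    input (addr e + BitVec.ofNat b 1) = addr x ∧
    input (addr e + BitVec.ofNat b 2) = BitVec.ofNat b d
  length_field : ∀ e ∈ G.vars,
    input (addr e + BitVec.ofNat b 3) = BitVec.ofNat b (G.val e).length

theorem BitVec.eq_ofNat_of_toNat {b n : ℕ} {x : BitVec b} (h : x.toNat = n) :
    x = BitVec.ofNat b n := by
  rw [← h, BitVec.ofNat_toNat, BitVec.setWidth_eq]

theorem HoldsDAG.stored {α : Type*} {G : RunLengthACFG α} {b : ℕ} {input : BitVec b → BitVec b}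
    {addr : ℕ → BitVec b} (h : HoldsDAG G input addr) : StoredDAG G input addr 1 2 where
  addr_injOn := h.addr_injOn
  char_node := h.char_node
  pair_node := h.pair_node
  run_node e he x d hr := by
    obtain ⟨h1, h2, h3⟩ := h.run_node e he x d hr
    exact ⟨h1, h2, BitVec.eq_ofNat_of_toNat h3⟩
  length_field e he := BitVec.eq_ofNat_of_toNat (h.length_field e he)

/-- Exchanging the offsets of the two children turns the same memory into the DAG of the mirror
grammar, so backward queries need no data of their own. -/
theorem HoldsDAG.stored_mirror {α : Type*} {G : RunLengthACFG α} {b : ℕ}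
    {input : BitVec b → BitVec b} {addr : ℕ → BitVec b} (h : HoldsDAG G input addr) :
    StoredDAG G.mirror input addr 2 1 where
  addr_injOn := h.addr_injOn
  char_node e he a hr := h.char_node e he a (G.rhs_of_mirror hr)
  pair_node e he l r hr := by
    obtain ⟨h1, h2, h3⟩ := h.pair_node e he r l (G.rhs_of_mirror hr)
    exact ⟨h1, h3, h2⟩
  run_node e he x d hr := h.stored.run_node e he x d (G.rhs_of_mirror hr)
  length_field e he := by rw [G.mirror_length_val he]; exact h.stored.length_field e he

/-! ### The invariant of the main loop and its potential. -/

/-- The sequence of variables represented by a stack. -/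
def flat (S : List (ℕ × ℕ)) : List ℕ := S.flatMap fun p => List.replicate p.2 p.1

@[simp] theorem flat_nil : flat [] = [] := rfl
@[simp] theorem flat_cons (x d : ℕ) (S : List (ℕ × ℕ)) :
    flat ((x, d) :: S) = List.replicate d x ++ flat S := rfl

namespace RunLengthACFG

variable {α : Type*} (G : RunLengthACFG α)

/-- The potential of a stack: entries count twice if they are runs. -/
def potential (S : List (ℕ × ℕ)) : ℕ :=
  (S.map fun p => match G.rhs p.1 with
    | .run _ _ => 2
    | _ => 1).sum

theorem potential_cons_of_notRun {x d : ℕ} {S : List (ℕ × ℕ)} (h : G.NotRun x) :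
    G.potential ((x, d) :: S) = 1 + G.potential S := by
  rcases hr : G.rhs x with a | ⟨l, r⟩ | ⟨y, e⟩
  · simp [potential, hr]
  · simp [potential, hr]
  · exact absurd hr (h y e)

theorem potential_cons_le {x d : ℕ} {S : List (ℕ × ℕ)} :
    G.potential ((x, d) :: S) ≤ 2 + G.potential S := by
  rcases hr : G.rhs x with a | ⟨l, r⟩ | ⟨y, e⟩ <;> simp [potential, hr]

theorem potential_cons_of_run {x d y e : ℕ} {S : List (ℕ × ℕ)} (h : G.rhs x = .run y e) :
    G.potential ((x, d) :: S) = 2 + G.potential S := by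
  simp [potential, h]

/-- The entries of a stack are variables with positive multiplicities, and runs occur only once. -/
def GoodStack (M : ℕ) (S : List (ℕ × ℕ)) : Prop :=
  (∀ p ∈ S, p.1 ∈ G.vars ∧ 1 ≤ p.2 ∧ (¬ G.NotRun p.1 → p.2 = 1)) ∧ G.wt (flat S) ≤ M

variable {G}

namespace GoodStack

variable {M x d : ℕ} {S : List (ℕ × ℕ)}

theorem tail {p : ℕ × ℕ} (h : G.GoodStack M (p :: S)) : G.GoodStack M S := by
  refine ⟨fun q hq => h.1 q (by simp [hq]), ?_⟩
  have := h.2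
  rw [flat_cons, wt_append] at this
  omega

theorem mem (h : G.GoodStack M ((x, d) :: S)) : x ∈ G.vars := (h.1 (x, d) (by simp)).1

theorem pos (h : G.GoodStack M ((x, d) :: S)) : 1 ≤ d := (h.1 (x, d) (by simp)).2.1

theorem mul_le (h : G.GoodStack M ((x, d) :: S)) : d * (G.val x).length ≤ M := by
  have := h.2
  rw [flat_cons, wt_append, wt_replicate] at this
  omega

theorem count_le (h : G.GoodStack M ((x, d) :: S)) : d ≤ M :=
  (Nat.le_mul_of_pos_right d (G.length_val_pos h.mem)).trans h.mul_le

/-- Every entry derives at least one character. In this way the heights of the stacks, and with them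
all addresses used, stay within a word. -/
theorem length_le (h : G.GoodStack M S) : S.length ≤ M := by
  refine le_trans ?_ h.2
  obtain ⟨h, -⟩ := h
  induction S with
  | nil => simp
  | cons p S ih =>
    obtain ⟨h1, h2, -⟩ := h p (by simp)
    have := ih fun q hq => h q (by simp [hq])
    rw [flat_cons, wt_append, wt_replicate, List.length_cons]
    have := Nat.mul_le_mul h2 (G.length_val_pos h1)
    omega

theorem set_count {d' : ℕ} (h : G.GoodStack M ((x, d) :: S)) (hx : G.NotRun x) (h1 : 1 ≤ d')
    (h2 : d' ≤ d) : G.GoodStack M ((x, d') :: S) := by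
  refine ⟨?_, ?_⟩
  · intro p hp
    rcases List.mem_cons.1 hp with rfl | hp
    · exact ⟨h.mem, h1, fun h => absurd hx h⟩
    · exact h.tail.1 p hp
  · have := h.2
    rw [flat_cons, wt_append, wt_replicate] at this ⊢
    have := Nat.mul_le_mul_right (G.val x).length h2
    omega

theorem sub_count {d' : ℕ} (h : G.GoodStack M ((x, d) :: S)) (hx : G.NotRun x) (hd : d' ≤ d) :
    G.GoodStack M (if d = d' then S else (x, d - d') :: S) := by
  split_ifs
  · exact h.tail
  · exact h.set_count hx (by omega) (by omega)

theorem run {y e : ℕ} (h : G.GoodStack M ((x, d) :: S)) (hr : G.rhs x = .run y e)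
    (hy : G.NotRun y) : G.GoodStack M ((y, e) :: S) ∧ d = 1 := by
  have hd := (h.1 (x, d) (by simp)).2.2 (fun h => h y e hr)
  simp only at hd
  subst hd
  refine ⟨⟨?_, ?_⟩, rfl⟩
  · intro p hp
    rcases List.mem_cons.1 hp with rfl | hp
    · exact ⟨G.run_mem h.mem hr, G.run_pos x h.mem y e hr, fun h => absurd hy h⟩
    · exact h.tail.1 p hp
  · have := h.2
    rw [flat_cons, wt_append, wt_replicate, G.val_run h.mem hr] at this
    rw [flat_cons, wt_append, wt_replicate]
    simpa using this

theorem pair {l r : ℕ} (h : G.GoodStack M ((x, d) :: S)) (hr : G.rhs x = .pair l r) :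
    G.GoodStack M ((l, 1) :: (r, 1) :: (if d = 1 then S else (x, d - 1) :: S)) := by
  have hx : G.NotRun x := fun y e h => by simp [hr] at h
  have hd := h.pos
  refine ⟨?_, ?_⟩
  · intro p hp
    rcases List.mem_cons.1 hp with rfl | hp
    · exact ⟨G.pair_left_mem h.mem hr, le_rfl, fun _ => rfl⟩
    rcases List.mem_cons.1 hp with rfl | hp
    · exact ⟨G.pair_right_mem h.mem hr, le_rfl, fun _ => rfl⟩
    · exact (h.sub_count hx hd).1 p hp
  · have := h.2
    have hw : (G.val x).length = (G.val l).length + (G.val r).length := by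
      simp [G.val_pair h.mem hr]
    split_ifs with h1
    · subst h1
      simp at this ⊢
      omega
    · obtain ⟨d, rfl⟩ := Nat.exists_eq_add_of_le' hd
      simp [Nat.add_mul] at this ⊢
      omega

end GoodStack

theorem flat_ite {x d d' : ℕ} {S : List (ℕ × ℕ)} :
    flat (if d = d' then S else (x, d - d') :: S) = List.replicate (d - d') x ++ flat S := by
  split_ifs with h
  · simp [h]
  · rfl

theorem potential_ite {x d d' : ℕ} {S : List (ℕ × ℕ)} (hx : G.NotRun x) :
    G.potential (if d = d' then S else (x, d - d') :: S) ≤ 1 + G.potential S := by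
  split_ifs with h
  · omega
  · rw [G.potential_cons_of_notRun hx]

variable (G) in
/-- The invariant of the algorithm: the answer is `ans`, and at most `φ` rounds follow. -/
structure Invariant (M φ ans k₁ : ℕ) (S₁ : List (ℕ × ℕ)) (k₂ : ℕ) (S₂ : List (ℕ × ℕ))
    (acc : ℕ) : Prop where
  good₁ : G.GoodStack M S₁
  good₂ : G.GoodStack M S₂
  cert : ∃ n r, G.Cert n k₁ (flat S₁) k₂ (flat S₂) r ∧ acc + r = ans ∧
    5 * n + G.potential S₁ + G.potential S₂ + min k₁ 1 + min k₂ 1 ≤ φ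

namespace Invariant

variable {M φ ans k₁ k₂ acc x d y e l r : ℕ} {S₁ S₂ : List (ℕ × ℕ)}

theorem symm (h : G.Invariant M φ ans k₁ S₁ k₂ S₂ acc) :
    G.Invariant M φ ans k₂ S₂ k₁ S₁ acc := by
  obtain ⟨n, r, h1, h2, h3⟩ := h.cert
  exact ⟨h.good₂, h.good₁, n, r, h1.symm, h2, by omega⟩

theorem nil_left (h : G.Invariant M φ ans k₁ [] k₂ S₂ acc) : acc = ans := by
  obtain ⟨n, r, h1, h2, h3⟩ := h.cert
  rw [← h2, h1.nil_left]; rfl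

theorem run (h : G.Invariant M φ ans k₁ ((x, d) :: S₁) k₂ S₂ acc) (hr : G.rhs x = .run y e)
    (hy : G.NotRun y) : ∃ φ' < φ, G.Invariant M φ' ans k₁ ((y, e) :: S₁) k₂ S₂ acc := by
  obtain ⟨n, r, h1, h2, h3⟩ := h.cert
  obtain ⟨h4, rfl⟩ := h.good₁.run hr hy
  rw [G.potential_cons_of_run hr] at h3
  refine ⟨φ - 1, by omega, h4, h.good₂, n, r, h1.run hr, h2, ?_⟩
  rw [G.potential_cons_of_notRun hy]
  omega

theorem skip_all (h : G.Invariant M φ ans k₁ ((x, d) :: S₁) k₂ S₂ acc) (hx : G.NotRun x)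
    (hle : d * (G.val x).length ≤ k₁) :
    ∃ φ' < φ, G.Invariant M φ' ans (k₁ - d * (G.val x).length) S₁ k₂ S₂ acc := by
  obtain ⟨n, r, h1, h2, h3⟩ := h.cert
  rw [G.potential_cons_of_notRun hx] at h3
  have := h1.drop (by simpa using hle)
  rw [wt_replicate] at this
  exact ⟨φ - 1, by omega, h.good₁.tail, h.good₂, n, r, this, h2, by omega⟩

theorem cert_skip {n : ℕ} (h : G.Cert n k₁ (flat ((x, d) :: S₁)) k₂ (flat S₂) r)
    (hlt : k₁ < d * (G.val x).length) : G.Cert n (k₁ % (G.val x).length)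
      (flat ((x, d - k₁ / (G.val x).length) :: S₁)) k₂ (flat S₂) r := by
  have hdv := Nat.div_lt_of_lt_mul (by rwa [mul_comm] at hlt)
  obtain ⟨q, hq⟩ := Nat.exists_eq_add_of_lt hdv
  have h1 : List.replicate d x = List.replicate (k₁ / (G.val x).length) x ++
      List.replicate (d - k₁ / (G.val x).length) x := by
    rw [List.replicate_append_replicate]; congr 1; omega
  rw [flat_cons, h1, List.append_assoc] at h
  have := Nat.div_add_mod' k₁ (G.val x).length
  have h2 := h.drop (by rw [wt_replicate]; omega)
  rw [wt_replicate, show k₁ - k₁ / (G.val x).length * (G.val x).length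
    = k₁ % (G.val x).length by omega] at h2
  exact h2

theorem skip_part (h : G.Invariant M φ ans k₁ ((x, d) :: S₁) k₂ S₂ acc) (hx : G.NotRun x)
    (hlt : k₁ < d * (G.val x).length) (hk : 0 < k₁) (h0 : k₁ % (G.val x).length = 0) :
    ∃ φ' < φ, G.Invariant M φ' ans 0 ((x, d - k₁ / (G.val x).length) :: S₁) k₂ S₂ acc := by
  obtain ⟨n, r, h1, h2, h3⟩ := h.cert
  have hdv := Nat.div_lt_of_lt_mul (by rwa [mul_comm] at hlt)
  have h4 := cert_skip h1 hlt
  rw [h0] at h4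
  rw [G.potential_cons_of_notRun hx] at h3
  refine ⟨φ - 1, by omega, h.good₁.set_count hx (by omega) (Nat.sub_le _ _), h.good₂, n, r, h4, h2, ?_⟩
  rw [G.potential_cons_of_notRun hx]
  omega

theorem pair_of_cert (h₁ : G.GoodStack M ((x, d) :: S₁)) (h₂ : G.GoodStack M S₂)
    (hr : G.rhs x = .pair l r) {n s : ℕ}
    (hc : G.Cert n k₁ (l :: r :: (List.replicate (d - 1) x ++ flat S₁)) k₂ (flat S₂) s)
    (hs : acc + s = ans)
    (hφ : 5 * n + 5 + G.potential ((x, d) :: S₁) + G.potential S₂ + min k₁ 1 + min k₂ 1 ≤ φ) :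
    ∃ φ' < φ, G.Invariant M φ' ans k₁
      ((l, 1) :: (r, 1) :: (if d = 1 then S₁ else (x, d - 1) :: S₁)) k₂ S₂ acc := by
  have hx : G.NotRun x := fun y e h => by simp [hr] at h
  refine ⟨φ - 1, by omega, h₁.pair hr, h₂, n, s, ?_, hs, ?_⟩
  · rw [flat_cons, flat_cons, flat_ite]
    exact hc
  · have h1 := G.potential_cons_le (x := l) (d := 1)
      (S := (r, 1) :: (if d = 1 then S₁ else (x, d - 1) :: S₁))
    have h2 := G.potential_cons_le (x := r) (d := 1)
      (S := if d = 1 then S₁ else (x, d - 1) :: S₁)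
    have h3 := potential_ite (d := d) (d' := 1) (S := S₁) hx
    rw [G.potential_cons_of_notRun hx] at hφ
    omega

theorem skip_expand (h : G.Invariant M φ ans k₁ ((x, d) :: S₁) k₂ S₂ acc) (hx : G.NotRun x)
    (hlt : k₁ < d * (G.val x).length) (h0 : 0 < k₁ % (G.val x).length) :
    ∃ l r, G.rhs x = .pair l r ∧ ∃ φ' < φ, G.Invariant M φ' ans (k₁ % (G.val x).length)
      ((l, 1) :: (r, 1) :: (if d - k₁ / (G.val x).length = 1 then S₁
        else (x, d - k₁ / (G.val x).length - 1) :: S₁)) k₂ S₂ acc := by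
  obtain ⟨n, s, h1, h2, h3⟩ := h.cert
  have hdv := Nat.div_lt_of_lt_mul (by rwa [mul_comm] at hlt)
  have hk : 0 < k₁ := Nat.pos_of_ne_zero fun h => by simp [h] at h0
  have h4 := cert_skip h1 hlt
  have hd₁ : 1 ≤ d - k₁ / (G.val x).length := by omega
  have h5 := h.good₁.set_count hx hd₁ (Nat.sub_le _ _)
  generalize d - k₁ / (G.val x).length = d' at *
  have : List.replicate d' x = x :: List.replicate (d' - 1) x := by
    rw [← List.replicate_succ]; congr 1; omega
  rw [flat_cons, this, List.cons_append] at h4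
  obtain ⟨l, r, m, rfl, hr, h6⟩ := h4.expand_skip hx h0
    (Nat.mod_lt _ (G.length_val_pos h.good₁.mem))
  refine ⟨l, r, hr, pair_of_cert h5 h.good₂ hr h6 h2 ?_⟩
  rw [G.potential_cons_of_notRun hx] at h3 ⊢
  omega

theorem mismatch (h : G.Invariant M φ ans 0 ((x, d) :: S₁) 0 ((y, e) :: S₂) acc)
    (hx : G.NotRun x) (hy : G.NotRun y) (hxy : x ≠ y)
    (hle : (G.val y).length ≤ (G.val x).length) :
    ((∃ a, G.rhs x = .char a) ∧ acc = ans) ∨ ∃ l r, G.rhs x = .pair l r ∧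
      ∃ φ' < φ, G.Invariant M φ' ans 0
        ((l, 1) :: (r, 1) :: (if d = 1 then S₁ else (x, d - 1) :: S₁)) 0 ((y, e) :: S₂) acc := by
  obtain ⟨n, s, h1, h2, h3⟩ := h.cert
  have hd := h.good₁.pos
  have he := h.good₂.pos
  have hd' : flat ((x, d) :: S₁) = x :: (List.replicate (d - 1) x ++ flat S₁) := by
    rw [flat_cons, ← List.cons_append, ← List.replicate_succ]; congr 2; omega
  have he' : flat ((y, e) :: S₂) = y :: (List.replicate (e - 1) y ++ flat S₂) := by
    rw [flat_cons, ← List.cons_append, ← List.replicate_succ]; congr 2; omega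
  rw [hd', he'] at h1
  rcases h1.mismatch hx hy hxy hle with ⟨h4, h5⟩ | ⟨l, r, m, rfl, hr, h4⟩
  · refine .inl ⟨?_, by omega⟩
    rcases hr : G.rhs x with a | ⟨l, r⟩ | ⟨z, f⟩
    · exact ⟨a, rfl⟩
    · have := length_val_pair h.good₁.mem hr; omega
    · exact absurd hr (hx _ _)
  · rw [← he'] at h4
    exact .inr ⟨l, r, hr, pair_of_cert h.good₁ h.good₂ hr h4 h2 (by omega)⟩

theorem match_lt (h : G.Invariant M φ ans 0 ((x, d) :: S₁) 0 ((x, e) :: S₂) acc)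
    (hx : G.NotRun x) (hde : d < e) : ∃ φ' < φ,
      G.Invariant M φ' ans 0 S₁ 0 ((x, e - d) :: S₂) (acc + d * (G.val x).length) := by
  obtain ⟨n, s, h1, h2, h3⟩ := h.cert
  have he : List.replicate e x = List.replicate d x ++ List.replicate (e - d) x := by
    rw [List.replicate_append_replicate]; congr 1; omega
  rw [flat_cons, flat_cons, he, List.append_assoc] at h1
  obtain ⟨h4, h5⟩ := h1.match_prefix
  rw [wt_replicate] at h4 h5
  rw [G.potential_cons_of_notRun hx, G.potential_cons_of_notRun hx] at h3
  refine ⟨φ - 1, by omega, h.good₁.tail, h.good₂.set_count hx (by omega) (by omega), n, _, h5,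
    by omega, ?_⟩
  rw [G.potential_cons_of_notRun hx]
  omega

theorem match_ge (h : G.Invariant M φ ans 0 ((x, d) :: S₁) 0 ((x, e) :: S₂) acc)
    (hx : G.NotRun x) (hde : e ≤ d) : ∃ φ' < φ,
      G.Invariant M φ' ans 0 (if d = e then S₁ else (x, d - e) :: S₁) 0 S₂
        (acc + e * (G.val x).length) := by
  obtain ⟨n, s, h1, h2, h3⟩ := h.cert
  have he : List.replicate d x = List.replicate e x ++ List.replicate (d - e) x := by
    rw [List.replicate_append_replicate]; congr 1; omega
  rw [flat_cons, flat_cons, he, List.append_assoc] at h1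
  obtain ⟨h4, h5⟩ := h1.match_prefix
  rw [wt_replicate] at h4 h5
  rw [G.potential_cons_of_notRun hx, G.potential_cons_of_notRun hx] at h3
  have := potential_ite (d := d) (d' := e) (S := S₁) hx
  exact ⟨φ - 1, by omega, h.good₁.sub_count hx hde, h.good₂.tail, n, _, by rwa [flat_ite],
    by omega, by omega⟩

end Invariant

end RunLengthACFG

/-! ### Correctness and running time of the program. -/

section Correctness

variable {α : Type*} {G : RunLengthACFG α} {b : ℕ} {input : BitVec b → BitVec b}
  {addr : ℕ → BitVec b} {o₁ o₂ M φ ans k₁ k₂ acc x d y e p₁ p₂ : ℕ} {S₁ S₂ : List (ℕ × ℕ)}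
  {R : ℕ → BitVec b} {m : BitVec b → BitVec b}

variable (G) (addr o₁ o₂ M ans) in
/-- The program has stopped with the answer, or it is at the head of the main loop and the invariant
holds with a number less than `φ`. -/
def Progress (φ : ℕ) (c : Config b) : Prop :=
  StateRep.Halted o₁ o₂ ans c ∨ ∃ φ' < φ, ∃ p₁ k₁ S₁ p₂ k₂ S₂ acc,
    StateRep.AtLoop addr p₁ k₁ S₁ p₂ k₂ S₂ acc c ∧ G.Invariant M φ' ans k₁ S₁ k₂ S₂ acc

/-- A round of the main loop which does not exchange the strings. -/
theorem progress_of_no_swap (hst : StoredDAG G input addr o₁ o₂)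
    (hM : 4 * M + 32 ≤ 2 ^ b) (hrun : ∀ e ∈ G.vars, ∀ y d, G.rhs e = .run y d → G.NotRun y)
    (hrep : StateRep addr R m p₁ k₁ ((x, d) :: S₁) p₂ k₂ ((y, e) :: S₂) acc)
    (hinv : G.Invariant M φ ans k₁ ((x, d) :: S₁) k₂ ((y, e) :: S₂) acc)
    (hns : ¬ G.NotRun x ∨ 0 < k₁ ∨
      (G.NotRun y ∧ k₂ = 0 ∧ (G.val y).length ≤ (G.val x).length)) :
    Leads (lceProgram o₁ o₂) input 50 ⟨18, R, m⟩ (Progress G addr o₁ o₂ M ans φ) := by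
  refine (hrep.fetch (N := 43) fun R hrep ht h22 => ?_).mono (by omega) fun _ => id
  have hxm := hinv.good₁.mem
  have hym := hinv.good₂.mem
  by_cases hx : G.NotRun x
  swap
  · obtain ⟨z, f, hr⟩ : ∃ z f, G.rhs x = .run z f := by simpa [RunLengthACFG.NotRun] using hx
    obtain ⟨h1, h2, h3⟩ := hst.run_node x hxm z f hr
    obtain ⟨φ', hφ', hinv'⟩ := hinv.run hr (hrun x hxm z f hr)
    exact (hrep.expandRun ht (h22.trans h1) h2 h3).mono (by omega) fun c hc =>
      .inr ⟨φ', hφ', _, _, _, _, _, _, _, hc, hinv'⟩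
  have kind : ∀ z ∈ G.vars, G.NotRun z → input (addr z) ≠ BitVec.ofNat b 2 := by
    intro z hzm hz
    rcases hr : G.rhs z with a | ⟨l, r⟩ | ⟨w, f⟩
    · rw [hst.char_node z hzm a hr, ne_eq, BitVec.ofNat_inj_of_lt (by omega) (by omega)]; omega
    · rw [(hst.pair_node z hzm l r hr).1, ne_eq, BitVec.ofNat_inj_of_lt (by omega) (by omega)]
      omega
    · exact absurd hr (hz _ _)
  have hxk := kind x hxm hx
  have hLx := hst.length_field x hxm
  have hLy := hst.length_field y hym
  have hmul := hinv.good₁.mul_le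
  have hdM := hinv.good₁.count_le
  have heM := hinv.good₂.count_le
  have lenM : ∀ {z f S}, G.GoodStack M ((z, f) :: S) → (G.val z).length ≤ M := fun h =>
    (Nat.le_mul_of_pos_left _ h.pos).trans h.mul_le
  have hLxM := lenM hinv.good₁
  have hLyM := lenM hinv.good₂
  rcases Nat.eq_zero_or_pos k₁ with rfl | hk
  swap
  · rcases le_or_gt (d * (G.val x).length) k₁ with hle | hlt
    · obtain ⟨φ', hφ', hinv'⟩ := hinv.skip_all hx hle
      exact (hrep.skipAll ht hxk h22 hk hLx hle).mono (by omega) fun c hc =>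
        .inr ⟨φ', hφ', _, _, _, _, _, _, _, hc, hinv'⟩
    · refine (hrep.skipPart ht hxk h22 hk hLx hlt (by omega) (N := 19) (fun h0 c hc => ?_)
        fun h0 R' m' hrep' ht' => ?_).mono (by omega) fun _ => id
      · obtain ⟨φ', hφ', hinv'⟩ := hinv.skip_part hx hlt hk h0
        exact .inr ⟨φ', hφ', _, _, _, _, _, _, _, hc, hinv'⟩
      · obtain ⟨l, r, hr, φ', hφ', hinv'⟩ := hinv.skip_expand hx hlt h0
        obtain ⟨-, h1, h2⟩ := hst.pair_node x hxm l r hr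
        have hdv := Nat.div_lt_of_lt_mul (by rwa [mul_comm] at hlt)
        -- The stack after the expansion satisfies the invariant again; this bounds its height
        -- before the cells are written.
        have hlen := hinv'.good₁.length_le
        have := Nat.sub_le d (k₁ / (G.val x).length)
        simp only [List.length_cons] at hlen
        exact (hrep'.expandPair ht' (by omega) (by omega) h1 h2 rfl (by omega)).mono le_rfl
          fun c hc => .inr ⟨φ', hφ', _, _, _, _, _, _, _, hc, hinv'⟩
  obtain ⟨hy, rfl, hle⟩ : G.NotRun y ∧ k₂ = 0 ∧ (G.val y).length ≤ (G.val x).length := by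
    rcases hns with h | h | h
    · exact absurd hx h
    · omega
    · exact h
  refine (hrep.fetch₂ ht hxk h22 (N := 30) fun R hrep ht h22 h23 h25 h30 => ?_).mono (by omega)
    fun _ => id
  refine .jeq_neg rfl (by rw [h25, hrep.r12]; exact kind y hym hy) <|
    .jlt_neg rfl (by rw [hrep.r15, hrep.r9]) <|
    (hrep.fetchLengths ht h23 h30 h22 hLx hLy (N := 23)
      fun R hrep ht h22 h23 h30 h26 h27 => ?_).mono (by omega) fun _ => id
  refine .jlt_neg rfl (by rw [h26, h27, BitVec.toNat_ofNat_of_lt' (by omega),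
    BitVec.toNat_ofNat_of_lt' (by omega)]; exact hle) ?_
  by_cases hxy : x = y
  · subst hxy
    refine .jeq_pos rfl (by rw [h23, ht.r20]) <|
      (hrep.matchTops ht h30 h26 (by omega) (by omega)).mono (by omega) ?_
    rintro c (⟨hde, hc⟩ | ⟨hde, hc⟩)
    · obtain ⟨φ', hφ', hinv'⟩ := hinv.match_lt hx hde
      exact .inr ⟨φ', hφ', _, _, _, _, _, _, _, hc, hinv'⟩
    · obtain ⟨φ', hφ', hinv'⟩ := hinv.match_ge hx hde
      exact .inr ⟨φ', hφ', _, _, _, _, _, _, _, hc, hinv'⟩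
  · refine .jeq_neg rfl (by
      rw [h23, ht.r20]; exact fun h => hxy (hst.addr_injOn hxm hym h)) ?_
    rcases hinv.mismatch hx hy hxy hle with ⟨⟨a, hr⟩, rfl⟩ | ⟨l, r, hr, φ', hφ', hinv'⟩
    · exact .jeq_pos rfl (by rw [h22, hrep.r15]; exact hst.char_node x hxm a hr) <|
        hrep.halt.mono (by omega) fun c hc => .inl hc
    · obtain ⟨h0, h1, h2⟩ := hst.pair_node x hxm l r hr
      have hlen := hinv'.good₁.length_le
      simp only [List.length_cons] at hlen
      refine .jeq_neg rfl ?_ <|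
        (hrep.expandPair ht hinv.good₁.pos (by omega) h1 h2 rfl (by omega)).mono (by omega)
          fun c hc => .inr ⟨φ', hφ', _, _, _, _, _, _, _, hc, hinv'⟩
      rw [h22, hrep.r15, h0, ne_eq, BitVec.ofNat_inj_of_lt (by omega) (by omega)]; omega

/-- If the strings have to be exchanged, the state after the exchange meets the condition of
`progress_of_no_swap`. So two exchanges never follow each other, and one or two passes of the loop
always lower the bound. -/
theorem progress (hst : StoredDAG G input addr o₁ o₂)
    (hM : 4 * M + 32 ≤ 2 ^ b) (hrun : ∀ e ∈ G.vars, ∀ y d, G.rhs e = .run y d → G.NotRun y)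
    (hrep : StateRep addr R m p₁ k₁ S₁ p₂ k₂ S₂ acc)
    (hinv : G.Invariant M φ ans k₁ S₁ k₂ S₂ acc) :
    Leads (lceProgram o₁ o₂) input 80 ⟨18, R, m⟩ (Progress G addr o₁ o₂ M ans φ) := by
  rcases S₁ with _ | ⟨⟨x, d⟩, S₁⟩
  · rw [← hinv.nil_left]
    exact hrep.halt_nil_left.mono (by omega) fun c hc => .inl hc
  rcases S₂ with _ | ⟨⟨y, e⟩, S₂⟩
  · rw [← hinv.symm.nil_left]
    exact hrep.halt_nil_right.mono (by omega) fun c hc => .inl hc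
  by_cases hns : ¬ G.NotRun x ∨ 0 < k₁ ∨
      (G.NotRun y ∧ k₂ = 0 ∧ (G.val y).length ≤ (G.val x).length)
  · exact (progress_of_no_swap hst hM hrun hrep hinv hns).mono (by omega) fun _ => id
  push Not at hns
  obtain ⟨hx, hk, hns⟩ := hns
  obtain rfl : k₁ = 0 := by omega
  have hxm := hinv.good₁.mem
  have hym := hinv.good₂.mem
  have hxk : input (addr x) ≠ BitVec.ofNat b 2 := by
    rcases hr : G.rhs x with a | ⟨l, r⟩ | ⟨w, f⟩
    · rw [hst.char_node x hxm a hr, ne_eq, BitVec.ofNat_inj_of_lt (by omega) (by omega)]; omega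
    · rw [(hst.pair_node x hxm l r hr).1, ne_eq, BitVec.ofNat_inj_of_lt (by omega) (by omega)]
      omega
    · exact absurd hr (hx _ _)
  have hyk : ¬ G.NotRun y → input (addr y) = BitVec.ofNat b 2 := by
    intro hy
    obtain ⟨z, f, hr⟩ : ∃ z f, G.rhs y = .run z f := by simpa [RunLengthACFG.NotRun] using hy
    exact (hst.run_node y hym z f hr).1
  have hLx := hst.length_field x hxm
  have hLy := hst.length_field y hym
  have lenM : ∀ {z f S}, G.GoodStack M ((z, f) :: S) → (G.val z).length ≤ M := fun h =>
    (Nat.le_mul_of_pos_left _ h.pos).trans h.mul_le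
  have hLxM := lenM hinv.good₁
  have hLyM := lenM hinv.good₂
  have hswap : ∀ R, StateRep addr R m p₁ 0 ((x, d) :: S₁) p₂ k₂ ((y, e) :: S₂) acc →
      Leads (lceProgram o₁ o₂) input 60 ⟨79, R, m⟩ (Progress G addr o₁ o₂ M ans φ) := by
    intro R hrep
    refine (hrep.swap.trans (N' := 50) ?_)
    rintro ⟨pc, R', m'⟩ ⟨rfl : pc = 18, hrep'⟩
    refine progress_of_no_swap hst hM hrun hrep' hinv.symm ?_
    by_cases hy : G.NotRun y
    · rcases Nat.eq_zero_or_pos k₂ with rfl | hk₂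
      · exact .inr (.inr ⟨hx, rfl, (hns hy rfl).le⟩)
      · exact .inr (.inl hk₂)
    · exact .inl hy
  refine (hrep.fetch (N := 73) fun R hrep ht h22 => ?_)
  refine (hrep.fetch₂ ht hxk h22 (N := 68) fun R hrep ht h22 h23 h25 h30 => ?_)
  by_cases hy : G.NotRun y
  · by_cases hkk : input (addr y) = BitVec.ofNat b 2
    · exact .jeq_pos rfl (by rw [h25, hrep.r12]; exact hkk) <|
        (hswap R hrep).mono (by omega) fun _ => id
    refine .jeq_neg rfl (by rw [h25, hrep.r12]; exact hkk) ?_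
    rcases Nat.eq_zero_or_pos k₂ with rfl | hk₂
    · refine .jlt_neg rfl (by rw [hrep.r15, hrep.r9]) <|
        (hrep.fetchLengths ht h23 h30 h22 hLx hLy (N := 61)
          fun R hrep ht h22 h23 h30 h26 h27 => ?_).mono (by omega) fun _ => id
      refine .jlt_pos rfl ?_ (hswap R hrep)
      rw [h26, h27, BitVec.toNat_ofNat_of_lt' (by omega), BitVec.toNat_ofNat_of_lt' (by omega)]
      exact hns hy rfl
    · refine .jlt_pos rfl ?_ <| (hswap R hrep).mono (by omega) fun _ => id
      have := hrep.skip₂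
      rw [hrep.r15, hrep.r9, BitVec.toNat_ofNat_of_lt' (by omega),
        BitVec.toNat_ofNat_of_lt' (by omega)]
      exact hk₂
  · exact .jeq_pos rfl (by rw [h25, hrep.r12]; exact hyk hy) <|
      (hswap R hrep).mono (by omega) fun _ => id

theorem halts_of_invariant (hst : StoredDAG G input addr o₁ o₂)
    (hM : 4 * M + 32 ≤ 2 ^ b) (hrun : ∀ e ∈ G.vars, ∀ y d, G.rhs e = .run y d → G.NotRun y)
    (hrep : StateRep addr R m p₁ k₁ S₁ p₂ k₂ S₂ acc)
    (hinv : G.Invariant M φ ans k₁ S₁ k₂ S₂ acc) :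
    Leads (lceProgram o₁ o₂) input (80 * (φ + 1)) ⟨18, R, m⟩ (StateRep.Halted o₁ o₂ ans) := by
  induction φ using Nat.strong_induction_on generalizing R m p₁ k₁ S₁ p₂ k₂ S₂ acc with
  | _ φ ih =>
    refine ((progress hst hM hrun hrep hinv).trans (N' := 80 * φ) ?_).mono (by omega)
      fun _ => id
    rintro c (hc | ⟨φ', hφ', p₁, k₁, S₁, p₂, k₂, S₂, acc, ⟨hpc, hrep⟩, hinv⟩)
    · exact .done hc
    · obtain ⟨pc, R, m⟩ := c
      obtain rfl : pc = 18 := hpc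
      exact (ih φ' hφ' hrep hinv).mono (by omega) fun _ => id

/-- The program answers a query correctly, in time proportional to the size of any certificate. -/
theorem lceProgram_correct (hst : StoredDAG G input addr o₁ o₂)
    (hM : 4 * M + 32 ≤ 2 ^ b) (hrun : ∀ e ∈ G.vars, ∀ y d, G.rhs e = .run y d → G.NotRun y)
    {e₁ e₂ i j n : ℕ} (he₁ : e₁ ∈ G.vars) (he₂ : e₂ ∈ G.vars) (hM₁ : (G.val e₁).length ≤ M)
    (hM₂ : (G.val e₂).length ≤ M) (hi : 1 ≤ i) (hj : 1 ≤ j)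
    (hcert : G.Cert n (i - 1) [e₁] (j - 1) [e₂] ans)
    (hans : ans < 2 ^ b) {c : Config b} (hc : IsQuery addr e₁ e₂ i j c) :
    ComputesWithin (lceProgram o₁ o₂) input c ans (1000 * (n + 1)) := by
  obtain ⟨pc, R, m⟩ := c
  obtain ⟨hpc, h0, h1, h2, h3⟩ := hc
  simp only at hpc h0 h1 h2 h3
  subst hpc
  have h2' := BitVec.eq_ofNat_of_toNat h2
  have h3' := BitVec.eq_ofNat_of_toNat h3
  -- Initially each stack has a single entry, of potential at most `2`, and each skip counts at most
  -- `1`: hence `5 * n + 6`. The setup takes 18 instructions.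
  have key : Leads (lceProgram o₁ o₂) input (80 * (5 * n + 6 + 1) + 18) ⟨0, R, m⟩
      (StateRep.Halted o₁ o₂ ans) := by
    refine .const rfl <| .const rfl <| .const rfl <| .const rfl <| .const rfl <| .const rfl <|
      .const rfl <|
      .store rfl (a := BitVec.ofNat b 0) (v := addr e₁) (by simp) (by simpa using h0) <|
      .add rfl (v := BitVec.ofNat b 1) (by simp) <|
      .store rfl (a := BitVec.ofNat b 1) (v := BitVec.ofNat b 1) (by simp) (by simp) <|
      .add rfl (v := BitVec.ofNat b 4) (by simp) <|
      .store rfl (a := BitVec.ofNat b 2) (v := addr e₂) (by simp) (by simpa using h1) <|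
      .add rfl (v := BitVec.ofNat b 3) (by simp [← BitVec.ofNat_add]) <|
      .store rfl (a := BitVec.ofNat b 3) (v := BitVec.ofNat b 1) (by simp) (by simp) <|
      .add rfl (v := BitVec.ofNat b 6) (by simp [← BitVec.ofNat_add]) <|
      .sub rfl (v := BitVec.ofNat b (i - 1))
        (by simp [h2', BitVec.ofNat_sub_ofNat_of_le' hi]) <|
      .sub rfl (v := BitVec.ofNat b (j - 1))
        (by simp [h3', BitVec.ofNat_sub_ofNat_of_le' hj]) <| .const rfl <|
      halts_of_invariant (M := M) (φ := 5 * n + 6) (p₁ := 0) (k₁ := i - 1) (S₁ := [(e₁, 1)])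
        (p₂ := 2) (k₂ := j - 1) (S₂ := [(e₂, 1)]) (acc := 0) hst hM hrun ?_ ?_
    · have hs : StackAt addr (Function.update (Function.update m (BitVec.ofNat b 0) (addr e₁))
          (BitVec.ofNat b 1) (BitVec.ofNat b 1)) 0 [(e₁, 1)] :=
        StackAt.push (base := 0) (S := []) trivial (by omega) (by simp; omega)
      refine ⟨rfl, rfl, rfl, rfl, rfl, rfl, rfl, rfl, rfl, rfl, rfl, rfl, ?_, ?_, .inl ⟨rfl, rfl⟩,
        by simp; omega, by simp; omega, by omega, by omega⟩
      · exact (hs.update (by omega) (by simp; omega) (by simp)).update (by omega) (by simp; omega)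
          (by simp)
      · exact StackAt.push (base := 2) (S := []) trivial (by omega) (by simp; omega)
    · have hp : ∀ e, G.potential [(e, 1)] ≤ 2 := fun e =>
        G.potential_cons_le (x := e) (d := 1) (S := [])
      have hg : ∀ e ∈ G.vars, (G.val e).length ≤ M → G.GoodStack M [(e, 1)] := fun e he hM =>
        ⟨by simp [he], by simpa using hM⟩
      refine ⟨hg _ he₁ hM₁, hg _ he₂ hM₂, n, ans, hcert, by omega, ?_⟩
      have := hp e₁
      have := hp e₂
      omega
  obtain ⟨t, ht, hpc, h0⟩ := key
  exact ⟨t, by omega, hpc, by rw [h0, BitVec.toNat_ofNat_of_lt' hans]⟩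

end Correctness

/-! ### Lists -/

/-- The number of adjacent pairs of different entries. -/
def changes : List ℕ → ℕ
  | a :: b :: l => (if a = b then 0 else 1) + changes (b :: l)
  | _ => 0

/-- `1` if the last entry of `l` differs from the first entry of `m`. -/
def changeAt (l m : List ℕ) : ℕ :=
  match l.getLast?, m.head? with
  | some a, some b => if a = b then 0 else 1
  | _, _ => 0

theorem changes_cons (x : ℕ) (l : List ℕ) : changes (x :: l) = changeAt [x] l + changes l := by
  cases l <;> simp [changes, changeAt]

theorem changes_append (l m : List ℕ) :
    changes (l ++ m) = changes l + changeAt l m + changes m := by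
  induction l with
  | nil => simp [changes, changeAt]
  | cons x l ih =>
    rw [List.cons_append, changes_cons, changes_cons, ih]
    cases l with
    | nil => simp [changeAt, changes]
    | cons y l =>
      have h1 : changeAt [x] (y :: l ++ m) = changeAt [x] (y :: l) := rfl
      have h2 : changeAt (x :: y :: l) m = changeAt (y :: l) m := by
        simp [changeAt, List.getLast?_cons_cons]
      omega

theorem changeAt_le (l m : List ℕ) : changeAt l m ≤ 1 := by
  unfold changeAt
  split
  · split_ifs <;> omega
  · omega

theorem changes_le_length (l : List ℕ) : changes l ≤ l.length := by
  induction l with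
  | nil => simp [changes]
  | cons x l ih =>
    have := changeAt_le [x] l
    rw [changes_cons, List.length_cons]; omega

theorem changes_le_of_infix {l m : List ℕ} (h : l <:+: m) : changes l ≤ changes m := by
  obtain ⟨s, t, rfl⟩ := h
  rw [changes_append, changes_append]; omega

theorem changes_eq_zero {l : List ℕ} (h : l.IsChain fun x y => (x == y) = true) :
    changes l = 0 := by
  induction l with
  | nil => rfl
  | cons x l ih =>
    cases l with
    | nil => rfl
    | cons y l =>
      rw [List.isChain_cons_cons] at h
      simp [changes, ih h.2, beq_iff_eq.1 h.1]

theorem List.splitBy_boundary {β : Type*} {r : β → β → Bool} {l : List β} {Q₁ Q₂ : List (List β)}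
    (h : l.splitBy r = Q₁ ++ Q₂) :
    ∀ x ∈ Q₁.flatten.getLast?, ∀ y ∈ Q₂.flatten.head?, r x y = false := by
  have hc := List.isChain_getLast_head_splitBy r l
  have hn := List.nil_notMem_splitBy r l
  rw [h] at hc hn
  have h3 := (List.isChain_append.1 hc).2.2
  rcases List.eq_nil_or_concat Q₁ with rfl | ⟨Q₁, q₁, rfl⟩
  · simp
  rcases Q₂ with _ | ⟨q₂, Q₂⟩
  · simp
  obtain ⟨ha, hb, hr⟩ := h3 q₁ (by simp) q₂ (by simp)
  intro x hx y hy
  obtain ⟨a, q₁', rfl⟩ | h1 := (List.eq_nil_or_concat q₁).symm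
  · obtain ⟨b, q₂', rfl⟩ := List.exists_cons_of_ne_nil hb
    simp at hx hy hr
    subst hx hy
    exact hr
  · exact absurd h1 ha

/-- Consecutive blocks of maximal runs cannot be more numerous than the changes allow. -/
theorem length_le_changes {l : List ℕ} {Q : List (List ℕ)}
    (hQ : Q <:+: l.splitBy fun x y => x == y) : Q.length ≤ changes Q.flatten + 1 := by
  obtain ⟨s, t, hst⟩ := hQ
  have hn := List.nil_notMem_splitBy (fun x y => x == y) l
  induction Q generalizing s with
  | nil => simp
  | cons q Q ih =>
    have h1 := ih (s ++ [q]) (by rw [← hst]; simp)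
    cases Q with
    | nil => simp
    | cons q' Q =>
      have h2 := List.splitBy_boundary (Q₁ := s ++ [q]) (Q₂ := q' :: Q ++ t)
        (r := fun x y => x == y) (l := l) (by rw [← hst]; simp)
      rw [← hst] at hn
      obtain ⟨b, q'', rfl⟩ := List.exists_cons_of_ne_nil (l := q') (by rintro rfl; simp at hn)
      obtain ⟨q₀, a, rfl⟩ := (List.eq_nil_or_concat q).resolve_left (by rintro rfl; simp at hn)
      have h3 := h2 a (by simp) b (by simp)
      rw [List.flatten_cons, changes_append]
      have : changeAt (q₀.concat a) ((b :: q'') :: Q).flatten = 1 := by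
        simp only [beq_eq_false_iff_ne, ne_eq] at h3
        simp [changeAt, h3]
      simp only [List.length_cons] at h1 ⊢
      omega

/-- Blocks inside `z` go to the left, a block straddling the end of `z` goes to the right, and `z'`
is its part inside `z`. The last clause says that this block really reaches beyond `z`, which keeps
covers tight. -/
theorem List.coarsen_left {β : Type*} {Q : List (List β)} {z a : List β}
    (h : Q.flatten = z ++ a) :
    ∃ Q₁ Q₂ z', Q = Q₁ ++ Q₂ ∧ Q₁.flatten ++ z' = z ∧ Q₂.flatten = z' ++ a ∧
      ∀ q Q', Q₂ = q :: Q' → z'.length < q.length := by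
  induction Q generalizing z with
  | nil =>
    simp at h
    exact ⟨[], [], [], by simp [h.1, h.2]⟩
  | cons q Q ih =>
    by_cases hq : q.length ≤ z.length
    · rw [List.flatten_cons] at h
      obtain ⟨z, rfl⟩ : q <+: z := List.prefix_of_prefix_length_le ⟨_, h⟩ ⟨_, rfl⟩ hq
      rw [List.append_assoc, List.append_cancel_left_eq] at h
      obtain ⟨Q₁, Q₂, z', rfl, h2, h3, h4⟩ := ih h
      exact ⟨q :: Q₁, Q₂, z', rfl, by simp [← h2], h3, h4⟩
    · refine ⟨[], q :: Q, z, rfl, rfl, h, ?_⟩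
      rintro q' Q' h'
      simp only [List.cons.injEq] at h'
      rw [← h'.1]; omega

theorem List.flatten_reverse_map_reverse {β : Type*} (Q : List (List β)) :
    (Q.map List.reverse).reverse.flatten = Q.flatten.reverse := by
  rw [List.reverse_flatten]

theorem List.coarsen_right {β : Type*} {Q : List (List β)} {a v : List β}
    (h : Q.flatten = a ++ v) :
    ∃ Q₁ Q₂ v', Q = Q₁ ++ Q₂ ∧ v' ++ Q₂.flatten = v ∧ Q₁.flatten = a ++ v' ∧
      ∀ Q' q, Q₁ = Q' ++ [q] → v'.length < q.length := by
  have h' : (Q.map List.reverse).reverse.flatten = v.reverse ++ a.reverse := by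
    rw [List.flatten_reverse_map_reverse, h, List.reverse_append]
  obtain ⟨Q₁, Q₂, z', h1, h2, h3, h4⟩ := List.coarsen_left h'
  have hQ : Q = (Q₂.map List.reverse).reverse ++ (Q₁.map List.reverse).reverse := by
    have := congrArg (fun L : List (List β) => (L.map List.reverse).reverse) h1
    simpa [Function.comp_def] using this
  refine ⟨_, _, z'.reverse, hQ, ?_, ?_, ?_⟩
  · rw [List.flatten_reverse_map_reverse, ← List.reverse_append, h2, List.reverse_reverse]
  · rw [List.flatten_reverse_map_reverse, h3]; simp
  · intro Q' q hq
    have := congrArg (fun L : List (List β) => (L.map List.reverse).reverse) hq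
    simp at this
    simpa using h4 _ _ this

theorem List.length_flatten_ge {β : Type*} {Q : List (List β)} {μ : ℕ}
    (h : ∀ q ∈ Q, μ ≤ q.length) : μ * Q.length ≤ Q.flatten.length := by
  induction Q with
  | nil => simp
  | cons q Q ih =>
    have h1 := h q (by simp)
    have h2 := ih fun q hq => h q (by simp [hq])
    simp only [List.length_cons, List.flatten_cons, List.length_append, Nat.mul_succ]
    omega

/-! ### Cutting a sequence at given positions -/

/-- Since `splitBy` runs an accumulating loop, naturality is shown for arbitrary accumulators. Only
the second argument of the test is restricted to `l`: the tests in `cuts` look at nothing else. -/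
theorem List.splitBy_loop_map {β γ : Type*} {r : β → β → Bool} {r' : γ → γ → Bool} {g : β → γ}
    {l : List β} {a : β} {u : List β} {U : List (List β)}
    (h : ∀ x, ∀ y ∈ l, r' (g x) (g y) = r x y) :
    List.splitBy.loop r' (l.map g) (g a) (u.map g) (U.map (List.map g)) =
      (List.splitBy.loop r l a u U).map (List.map g) := by
  induction l generalizing a u U with
  | nil => simp [List.splitBy.loop]
  | cons b l ih =>
    have ih' := fun a u U => ih (a := a) (u := u) (U := U) fun x y hy => h x y (by simp [hy])
    rw [List.map_cons, List.splitBy.loop, List.splitBy.loop, h a b (by simp)]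
    cases r a b
    · simp only
      rw [← ih']
      simp
    · simp only
      rw [← ih']
      simp

theorem List.splitBy_map {β γ : Type*} {r : β → β → Bool} {r' : γ → γ → Bool} {g : β → γ}
    {l : List β} (h : ∀ x, ∀ y ∈ l, r' (g x) (g y) = r x y) :
    (l.map g).splitBy r' = (l.splitBy r).map (List.map g) := by
  cases l with
  | nil => rfl
  | cons a l =>
    exact List.splitBy_loop_map (u := []) (U := []) fun x y hy => h x y (by simp [hy])

/-- Cut `l` in front of every position with `bit` set; the first position has the number `off`. -/
def cuts (bit : ℕ → Bool) (off : ℕ) (l : List ℕ) : List (List ℕ) :=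
  ((l.zipIdx off).splitBy fun _ y => !bit y.2).map fun q => q.map Prod.fst

theorem eblock_eq_cuts {W : ℕ} (f : WindowFun W) (p : List ℕ) :
    eblock f p = cuts (parseBit f p) 0 p := rfl

theorem flatten_cuts (bit : ℕ → Bool) (off : ℕ) (l : List ℕ) : (cuts bit off l).flatten = l := by
  rw [cuts, ← List.map_flatten, List.flatten_splitBy, List.zipIdx_map_fst]

theorem cuts_append {bit : ℕ → Bool} {off : ℕ} {l m : List ℕ} (h : bit (off + l.length) = true) :
    cuts bit off (l ++ m) = cuts bit off l ++ cuts bit (off + l.length) m := by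
  rw [cuts, List.zipIdx_append, List.splitBy_append, List.map_append]
  · rfl
  · intro x _ y hy
    cases m with
    | nil => simp at hy
    | cons a m =>
      simp at hy
      subst hy
      simp [h]

/-- The blocks depend only on the bits inside the segment and not on its position, so a segment is
cut alike wherever it occurs with the same bits. -/
theorem cuts_congr {bit bit' : ℕ → Bool} {off off' : ℕ} {l : List ℕ}
    (h : ∀ k < l.length, bit' (off' + k) = bit (off + k)) : cuts bit' off' l = cuts bit off l := by
  have h1 : ∀ o, l.zipIdx o = (l.zipIdx 0).map fun y => (y.1, o + y.2) := by
    intro o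
    rw [List.zipIdx_eq_map_add]
  have h2 : ∀ y ∈ l.zipIdx 0, y.2 < l.length := by
    intro y hy
    obtain ⟨a, k⟩ := y
    have := List.mem_zipIdx hy
    simpa using this.2.1
  unfold cuts
  rw [h1 off', h1 off, List.splitBy_map (r := fun _ y => !bit (off + y.2)),
    List.splitBy_map (r := fun _ y => !bit (off + y.2))]
  · simp
  · intro x y _; rfl
  · intro x y hy
    simp [h _ (h2 y hy)]

/-- This is local consistency: the bit depends on `Δ_L` symbols to the left and four to the right,
all of which lie in `v`, so neither the surroundings nor the padding matter. -/
theorem parseBit_append {W : ℕ} (f : WindowFun W) {u v w : List ℕ} {k : ℕ} (hk : deltaL W ≤ k)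
    (hk' : k + 4 < v.length) : parseBit f (u ++ (v ++ w)) (u.length + k) = parseBit f v k := by
  unfold parseBit
  congr 1
  funext j
  have hj : (j : ℕ) < deltaL W + 5 := by have := j.2; unfold deltaL; omega
  generalize (j : ℕ) = j at hj
  obtain ⟨i, hi⟩ : ∃ i : ℕ, k + j = i + deltaL W := ⟨k + j - deltaL W, by omega⟩
  rw [show (((u.length + k : ℕ) : ℤ) + (j : ℤ) - (deltaL W : ℤ)) = ((u.length + i : ℕ) : ℤ) by
    push_cast; omega, show ((k : ℤ) + (j : ℤ) - (deltaL W : ℤ)) = (i : ℤ) by omega]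
  have hi' : i < v.length := by omega
  unfold padded
  rw [if_pos (by simp; omega), if_pos (by omega)]
  congr 1
  simp only [Int.toNat_natCast]
  rw [List.getD_append_right _ _ _ _ (by omega), Nat.add_sub_cancel_left,
    List.getD_append _ _ _ _ hi']

/-- If two cuts of `v = v₁ ++ v₂ ++ v₃` are decided inside `v`, then all sequences containing `v`
are cut there, and the middle part is always cut in the same way. -/
theorem eblock_append {W : ℕ} (f : WindowFun W) {v v₁ v₂ v₃ : List ℕ} (hv : v = v₁ ++ (v₂ ++ v₃))
    (h₁ : deltaL W ≤ v₁.length) (h₂ : (v₁ ++ v₂).length + 4 < v.length)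
    (hb₁ : parseBit f v v₁.length = true) (hb₂ : parseBit f v (v₁ ++ v₂).length = true)
    (u w : List ℕ) : ∃ Q₁ Q₃, eblock f (u ++ (v ++ w)) =
      Q₁ ++ (cuts (parseBit f v) v₁.length v₂ ++ Q₃) ∧
      Q₁.flatten = u ++ v₁ ∧ Q₃.flatten = v₃ ++ w := by
  rw [List.length_append] at h₂ hb₂
  have hb : ∀ k, deltaL W ≤ k → k + 4 < v.length →
    parseBit f (u ++ (v ++ w)) (u.length + k) = parseBit f v k := fun k => parseBit_append f
  generalize hbit : parseBit f (u ++ (v ++ w)) = bit at hb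
  have h1 : u ++ (v ++ w) = (u ++ v₁) ++ (v₂ ++ (v₃ ++ w)) := by simp [hv]
  refine ⟨cuts bit 0 (u ++ v₁), cuts bit (0 + (u ++ v₁).length + v₂.length) (v₃ ++ w), ?_,
    flatten_cuts _ _ _, flatten_cuts _ _ _⟩
  rw [eblock_eq_cuts, hbit, h1, cuts_append (l := u ++ v₁), cuts_append (l := v₂)]
  · congr 2
    refine cuts_congr fun k hk => ?_
    rw [Nat.zero_add, List.length_append, Nat.add_assoc]
    exact hb _ (by omega) (by omega)
  · rw [Nat.zero_add, List.length_append, Nat.add_assoc, hb _ (by omega) (by omega)]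
    exact hb₂
  · rw [Nat.zero_add, List.length_append, hb _ (by omega) (by omega)]
    exact hb₁

theorem List.Forall₂.append_left {β γ : Type*} {r : β → γ → Prop} {l₁ l₂ : List β} {m : List γ}
    (h : List.Forall₂ r (l₁ ++ l₂) m) :
    ∃ m₁ m₂, m = m₁ ++ m₂ ∧ List.Forall₂ r l₁ m₁ ∧ List.Forall₂ r l₂ m₂ := by
  induction l₁ generalizing m with
  | nil => exact ⟨[], m, rfl, .nil, h⟩
  | cons a l₁ ih =>
    cases h with
    | cons h1 h2 =>
      obtain ⟨m₁, m₂, rfl, h3, h4⟩ := ih h2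
      exact ⟨_ :: m₁, m₂, rfl, .cons h1 h3, h4⟩

theorem List.Forall₂.reverse' {β γ : Type*} {r : β → γ → Prop} {l : List β} {m : List γ}
    (h : List.Forall₂ r l m) : List.Forall₂ r l.reverse m.reverse := by
  induction h with
  | nil => exact .nil
  | cons h1 _ ih => simpa using List.rel_append ih (.cons h1 .nil)

theorem List.exists_overlap_left {β : Type*} {q s z t : List β} (h : q ++ s = z ++ t)
    (hlt : z.length < q.length) : ∃ r, r ≠ [] ∧ q = z ++ r ∧ t = r ++ s := by
  rcases List.append_eq_append_iff.1 h with ⟨r, h1, h2⟩ | ⟨r, h1, h2⟩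
  · simp [h1] at hlt
  · exact ⟨r, by rintro rfl; simp [h1] at hlt, h1, h2⟩

theorem List.exists_overlap_right {β : Type*} {q s z t : List β} (h : s ++ q = t ++ z)
    (hlt : z.length < q.length) : ∃ r, r ≠ [] ∧ q = r ++ z ∧ t = s ++ r := by
  rcases List.append_eq_append_iff.1 h with ⟨r, h1, h2⟩ | ⟨r, h1, h2⟩
  · exact ⟨r, by rintro rfl; simp [h2] at hlt, h2, h1⟩
  · simp [h2] at hlt

/-! ### Covers of a window by variables, and their coarsening. -/

namespace RunLengthACFG

variable {α : Type*} {G : RunLengthACFG α}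

variable (G) in
/-- `F` refines to `u` by expanding at most `n` pairs. -/
def RefinesLE (n : ℕ) (F u : List ℕ) : Prop := ∃ m ≤ n, G.Refines m F u

namespace RefinesLE

variable {n m k : ℕ} {F F' u u' v : List ℕ}

theorem mono (h : G.RefinesLE n F u) (hnm : n ≤ m) : G.RefinesLE m F u := by
  obtain ⟨k, hk, h⟩ := h
  exact ⟨k, by omega, h⟩

theorem append (h : G.RefinesLE n F u) (h' : G.RefinesLE m F' u') :
    G.RefinesLE (n + m) (F ++ F') (u ++ u') := by
  obtain ⟨k, hk, h⟩ := h
  obtain ⟨k', hk', h'⟩ := h'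
  exact ⟨k + k', by omega, h.append h'⟩

theorem trans (h : G.RefinesLE n F u) (h' : G.RefinesLE m u v) : G.RefinesLE (n + m) F v := by
  obtain ⟨k, hk, h⟩ := h
  obtain ⟨k', hk', h'⟩ := h'
  exact ⟨k + k', by omega, h.trans h'⟩

theorem refl (h : ∀ x ∈ F, x ∈ G.vars) : G.RefinesLE 0 F F := ⟨0, le_rfl, .refl h⟩

theorem mem_left (h : G.RefinesLE n F u) : ∀ x ∈ F, x ∈ G.vars := h.choose_spec.2.mem_left
theorem mem_right (h : G.RefinesLE n F u) : ∀ x ∈ u, x ∈ G.vars := h.choose_spec.2.mem_right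
theorem word_eq (h : G.RefinesLE n F u) : G.word F = G.word u := h.choose_spec.2.word_eq
theorem wt_eq (h : G.RefinesLE n F u) : G.wt F = G.wt u := h.choose_spec.2.wt_eq

theorem mirror (h : G.RefinesLE n F u) : G.mirror.RefinesLE n F.reverse u.reverse := by
  obtain ⟨k, hk, h⟩ := h
  exact ⟨k, hk, h.mirror⟩

theorem eq_nil (h : G.RefinesLE n [] u) : u = [] :=
  G.eq_nil_of_wt h.mem_right (by rw [← h.wt_eq]; rfl)

theorem of_forall₂ {Q : List (List ℕ)} {L : List ℕ}
    (h : List.Forall₂ (fun q e => G.RefinesLE k [e] q) Q L) :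
    G.RefinesLE (k * L.length) L Q.flatten := by
  induction h with
  | nil => exact ⟨0, by simp, .nil⟩
  | cons h1 _ ih => exact (h1.append ih).mono (by simp [Nat.mul_succ]; omega)

end RefinesLE

variable (G) in
/-- A variable which becomes a sequence without runs by expanding runs only. -/
def Flattens (x : ℕ) : Prop := ∃ u, G.RefinesLE 0 [x] u ∧ ∀ y ∈ u, G.NotRun y

theorem exists_flatten {L : List ℕ} (h : ∀ x ∈ L, G.Flattens x) :
    ∃ u, G.RefinesLE 0 L u ∧ ∀ y ∈ u, G.NotRun y := by
  induction L with
  | nil => exact ⟨[], ⟨0, le_rfl, .nil⟩, by simp⟩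
  | cons x L ih =>
    obtain ⟨u, h1, h2⟩ := ih fun y hy => h y (by simp [hy])
    obtain ⟨v, h3, h4⟩ := h x (by simp)
    refine ⟨v ++ u, h3.append h1, fun y hy => ?_⟩
    rcases List.mem_append.1 hy with hy | hy
    exacts [h4 y hy, h2 y hy]

theorem Flattens.mirror {x : ℕ} (h : G.Flattens x) : G.mirror.Flattens x := by
  obtain ⟨u, h1, h2⟩ := h
  exact ⟨u.reverse, h1.mirror, fun y hy => G.mirror_notRun.2 (h2 y (by simpa using hy))⟩

variable (G) in
/-- The sequence `X = Z ++ A` covers `lam` on the right: `A` refines to `w ++ lam`, where `lam` starts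
at the position `P`, and the first variable of `A` is not part of `w`. -/
structure IsLeftCover (X : List ℕ) (P : ℕ) (lam : List ℕ) (n : ℕ) (Z A w : List ℕ) : Prop where
  eq : X = Z ++ A
  refines : G.RefinesLE n A (w ++ lam)
  wt_eq : G.wt Z + G.wt w = P
  tight : ∀ x A', A = x :: A' → G.wt w < (G.val x).length
  notRun : ∀ x ∈ w ++ lam, G.NotRun x
  mem : ∀ x ∈ Z, x ∈ G.vars

variable (G) in
/-- The sequence `L = Z ++ R ++ V` covers `cs`: `R` refines to `w ++ cs ++ z`, where `cs` is preceded
by `P` and followed by `E` characters, the first variable of `R` is not part of `w`, and the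
last one is not part of `z`. -/
structure IsCover (L : List ℕ) (P E : ℕ) (cs : List ℕ) (n : ℕ) (Z R V w z : List ℕ) : Prop where
  eq : L = Z ++ (R ++ V)
  refines : G.RefinesLE n R (w ++ (cs ++ z))
  wt_left : G.wt Z + G.wt w = P
  wt_right : G.wt V + G.wt z = E
  tight_left : ∀ x R', R = x :: R' → G.wt w < (G.val x).length
  tight_right : ∀ x R', R = R' ++ [x] → G.wt z < (G.val x).length
  notRun : ∀ x ∈ w ++ (cs ++ z), G.NotRun x
  mem_left : ∀ x ∈ Z, x ∈ G.vars
  mem_right : ∀ x ∈ V, x ∈ G.vars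

/-- The new cover consists of the blocks that reach into `A ++ lp`. All of them but the first lie
inside `A ++ lp`, which gives `N + 1`. Each is opened at the cost `k`, and then the old refinement
applies; the part of the first block to the left of `A` is freed of runs and joins `w`. -/
theorem IsLeftCover.coarsen {X X' : List ℕ} {P n k N : ℕ} {lam lp lp' Z A w : List ℕ}
    {Q : List (List ℕ)} (h : G.IsLeftCover X P lam n Z A w) (hQ : Q.flatten = X ++ lp)
    (hr : List.Forall₂ (fun q e => G.RefinesLE k [e] q) Q X')
    (hN : ∀ Q', Q' <:+: Q → Q'.flatten <:+ A ++ lp → Q'.length ≤ N)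
    (hX : ∀ x ∈ X, G.Flattens x) (hlp : G.RefinesLE 0 lp lp') (hlp' : ∀ x ∈ lp', G.NotRun x) :
    ∃ Z' A' w', A'.length ≤ N + 1 ∧
      G.IsLeftCover X' P (lam ++ lp') (n + k * A'.length) Z' A' w' := by
  rw [h.eq, List.append_assoc] at hQ
  obtain ⟨Q₁, Q₂, za, rfl, h1, h2, h3⟩ := List.coarsen_left hQ
  obtain ⟨Z', A', rfl, hr₁, hr₂⟩ := hr.append_left
  obtain ⟨za', hza, hza'⟩ := exists_flatten (L := za) fun x hx => hX x (by
    rw [h.eq, ← h1]; simp [hx])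
  have hA := RefinesLE.of_forall₂ hr₂
  have hZ := RefinesLE.of_forall₂ hr₁
  have hlen := hr₂.length_eq
  refine ⟨Z', A', za' ++ w, ?_, rfl, ?_, ?_, ?_, ?_, ?_⟩
  · rw [← hlen]
    cases Q₂ with
    | nil => simp
    | cons q Q' =>
      obtain ⟨r, hr0, hr1, hr2⟩ := List.exists_overlap_left (q := q) h2 (h3 q Q' rfl)
      have := hN Q' ⟨Q₁ ++ [q], [], by simp⟩ ⟨r, hr2.symm⟩
      simpa using this
  · rw [h2] at hA
    have := hA.trans (hza.append (h.refines.append hlp))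
    simp only [List.append_assoc] at this ⊢
    exact this.mono (by omega)
  · rw [wt_append, hZ.wt_eq, ← hza.wt_eq, ← h.wt_eq, ← h1, wt_append]; omega
  · rintro x A'' rfl
    cases hr₂ with
    | @cons q _ Q' _ hx hr₂ =>
      obtain ⟨r, hr0, hr1, hr2⟩ := List.exists_overlap_left (q := q) h2 (h3 q Q' rfl)
      have hq := hx.wt_eq
      have hmem := hx.mem_right
      -- If `A` is empty, so is `w`, while `r` is not; otherwise `r` begins with the first variable
      -- of `A`, which is longer than `w` by tightness.
      have hlt : G.wt w < G.wt r := by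
        rcases A with _ | ⟨y, A⟩
        · have := h.refines.eq_nil
          rw [(List.append_eq_nil_iff.1 this).1]
          have := G.length_le_wt (u := r) fun y hy => hmem y (by simp [hr1, hy])
          have := List.length_pos_iff.2 hr0
          rw [wt_nil]
          omega
        · obtain ⟨y', r, rfl⟩ := List.exists_cons_of_ne_nil hr0
          simp only [List.cons_append, List.cons.injEq] at hr2
          have := h.tight y A rfl
          rw [wt_cons, ← hr2.1]
          omega
      rw [wt_cons, wt_nil, hr1, wt_append, hza.wt_eq] at hq
      rw [wt_append]
      omega
  · intro x hx
    simp only [List.mem_append] at hx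
    rcases hx with (hx | hx) | hx | hx
    · exact hza' x hx
    · exact h.notRun x (by simp [hx])
    · exact h.notRun x (by simp [hx])
    · exact hlp' x hx
  · exact hZ.mem_left

/-- By tightness the window begins inside the first variable of `A`; a second variable would derive
a part of what `lam` derives and yet be longer. -/
theorem IsLeftCover.length_le_one {X : List ℕ} {P n : ℕ} {lam Z A w : List ℕ}
    (h : G.IsLeftCover X P lam n Z A w) (hA : ∀ x ∈ A, G.wt lam < (G.val x).length) :
    A.length ≤ 1 := by
  rcases A with _ | ⟨x, _ | ⟨y, A⟩⟩
  · simp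
  · simp
  · exfalso
    have h1 := h.tight x _ rfl
    have h2 := hA y (by simp)
    have h3 := h.refines.wt_eq
    simp only [wt_cons, wt_append] at h3
    omega

/-- As in `IsLeftCover.coarsen`, now with a possibly straddling block at either end: all blocks
between the first and the last one lie inside `R`. That `cs` is not empty guarantees that `R` is
not. -/
theorem IsCover.coarsen {L L' : List ℕ} {P E n k N : ℕ} {cs Z R V w z : List ℕ}
    {Q : List (List ℕ)} (h : G.IsCover L P E cs n Z R V w z) (hcs : cs ≠ []) (hQ : Q.flatten = L)
    (hr : List.Forall₂ (fun q e => G.RefinesLE k [e] q) Q L')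
    (hN : ∀ Q', Q' <:+: Q → Q'.flatten <:+: R → Q'.length ≤ N)
    (hL : ∀ x ∈ L, G.Flattens x) :
    ∃ Z' R' V' w' z', R'.length ≤ N + 2 ∧
      G.IsCover L' P E cs (n + k * R'.length) Z' R' V' w' z' := by
  rw [h.eq] at hQ
  obtain ⟨Q₁, Qb, za, rfl, h1, h2, h3⟩ := List.coarsen_left hQ
  rw [← List.append_assoc] at h2
  obtain ⟨Q₂, Q₃, vd, rfl, h4, h5, h6⟩ := List.coarsen_right h2
  obtain ⟨Z', Rb, rfl, hr₁, hr₂⟩ := hr.append_left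
  obtain ⟨R', V', rfl, hr₂, hr₃⟩ := hr₂.append_left
  obtain ⟨za', hza, hza'⟩ := exists_flatten (L := za) fun x hx => hL x (by
    rw [h.eq, ← h1]; simp [hx])
  obtain ⟨vd', hvd, hvd'⟩ := exists_flatten (L := vd) fun x hx => hL x (by
    rw [h.eq, ← h4]; simp [hx])
  have hZ := RefinesLE.of_forall₂ hr₁
  have hR := RefinesLE.of_forall₂ hr₂
  have hV := RefinesLE.of_forall₂ hr₃
  have hlen := hr₂.length_eq
  have hR0 : R ≠ [] := by
    rintro rfl
    have := h.refines.eq_nil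
    simp [hcs] at this
  have hleft : ∀ q Q', Q₂ = q :: Q' → ∃ r, r ≠ [] ∧ q = za ++ r ∧ R ++ vd = r ++ Q'.flatten := by
    rintro q Q' rfl
    rw [List.append_assoc] at h5
    exact List.exists_overlap_left (q := q) h5 (h3 q _ rfl)
  have hright : ∀ q Q', Q₂ = Q' ++ [q] →
      ∃ r, r ≠ [] ∧ q = r ++ vd ∧ za ++ R = Q'.flatten ++ r := by
    rintro q Q' rfl
    exact List.exists_overlap_right (by simpa using h5) (h6 Q' q rfl)
  refine ⟨Z', R', V', za' ++ w, z ++ vd', ?_, rfl, ?_, ?_, ?_, ?_, ?_, ?_, hZ.mem_left,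
    hV.mem_left⟩
  · rw [← hlen]
    rcases Q₂ with _ | ⟨q, Q'⟩
    · simp
    rcases List.eq_nil_or_concat Q' with rfl | ⟨Qm, q', rfl⟩
    · simp
    obtain ⟨r, hr0, hr1, hr2⟩ := hleft q _ rfl
    obtain ⟨r', hr0', hr1', hr2'⟩ := hright q' (q :: Qm) (by simp)
    have hfl : R = r ++ (Qm.flatten ++ r') := by
      rw [hr1'] at hr2
      simp only [List.concat_eq_append, List.flatten_append, List.flatten_cons, List.flatten_nil,
        List.append_nil, ← List.append_assoc, List.append_cancel_right_eq] at hr2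
      rw [hr2, List.append_assoc]
    have := hN Qm ⟨Q₁ ++ [q], q' :: Q₃, by simp⟩ ⟨r, r', by rw [hfl]; simp⟩
    simp
    omega
  · rw [h5] at hR
    have := hR.trans ((hza.append h.refines).append hvd)
    simp only [List.append_assoc] at this ⊢
    exact this.mono (by omega)
  · rw [wt_append, hZ.wt_eq, ← hza.wt_eq, ← h.wt_left, ← h1, wt_append]; omega
  · rw [wt_append, hV.wt_eq, ← hvd.wt_eq, ← h.wt_right, ← h4, wt_append]; omega
  · rintro x R'' rfl
    cases hr₂ with
    | @cons q _ Q' _ hx hr₂ =>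
      obtain ⟨r, hr0, hr1, hr2⟩ := hleft q Q' rfl
      have hq := hx.wt_eq
      obtain ⟨y, R, rfl⟩ := List.exists_cons_of_ne_nil hR0
      obtain ⟨y', r, rfl⟩ := List.exists_cons_of_ne_nil hr0
      simp only [List.cons_append, List.cons.injEq] at hr2
      have := h.tight_left y R rfl
      rw [wt_cons, wt_nil, hr1, wt_append, hza.wt_eq, wt_cons, ← hr2.1] at hq
      rw [wt_append]
      omega
  · rintro x R'' rfl
    obtain ⟨Q', Qx, rfl, hrx, hrx'⟩ := hr₂.flip.append_left
    cases hrx' with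
    | @cons _ q _ _ hx hnil =>
      cases hnil
      obtain ⟨r, hr0, hr1, hr2⟩ := hright q Q' rfl
      have hq := RefinesLE.wt_eq hx
      obtain ⟨R, y, rfl⟩ := (List.eq_nil_or_concat R).resolve_left hR0
      obtain ⟨r, y', rfl⟩ := (List.eq_nil_or_concat r).resolve_left hr0
      simp only [List.concat_eq_append] at *
      have hyy : y = y' := by
        have := congrArg List.getLast? hr2
        simpa using this
      have := h.tight_right y R rfl
      rw [wt_cons, wt_nil, hr1, wt_append, hvd.wt_eq, wt_append, wt_cons, ← hyy] at hq
      rw [wt_append]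
      omega
  · intro x hx
    simp only [List.mem_append] at hx
    rcases hx with (hx | hx) | hx | hx | hx
    · exact hza' x hx
    · exact h.notRun x (by simp [hx])
    · exact h.notRun x (by simp [hx])
    · exact h.notRun x (by simp [hx])
    · exact hvd' x hx

/-- By tightness a variable of `R` which is neither the first nor the last one lies within the
window, but it is longer. -/
theorem IsCover.length_le_two {L : List ℕ} {P E n : ℕ} {cs Z R V w z : List ℕ}
    (h : G.IsCover L P E cs n Z R V w z) (hR : ∀ x ∈ R, G.wt cs < (G.val x).length) :
    R.length ≤ 2 := by
  rcases R with _ | ⟨x, R⟩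
  · simp
  rcases List.eq_nil_or_concat R with rfl | ⟨R, y, rfl⟩
  · simp
  rcases R with _ | ⟨u, R⟩
  · simp
  exfalso
  have h1 := h.tight_left x _ rfl
  have h2 := h.tight_right y (x :: u :: R) (by simp)
  have h3 := hR u (by simp)
  have h4 := h.refines.wt_eq
  simp only [List.concat_eq_append, List.cons_append, wt_cons, wt_append, wt_nil] at h4
  omega

/-- Two one-sided covers with `c` in between make a cover. -/
theorem IsLeftCover.cover {X Y c c' lam rho Z A w V D z : List ℕ} {P E n m : ℕ}
    (h : G.IsLeftCover X P lam n Z A w)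
    (h' : G.mirror.IsLeftCover Y.reverse E rho.reverse m V.reverse D.reverse z.reverse)
    (hc : G.RefinesLE 0 c c') (hc' : ∀ x ∈ c', G.NotRun x) (hc0 : c ≠ []) :
    G.IsCover (X ++ (c ++ Y)) P E (lam ++ (c' ++ rho)) (n + m) Z (A ++ (c ++ D)) V w z := by
  have hD : G.RefinesLE m D (rho ++ z) := by
    have := h'.refines.mirror
    rw [mirror_mirror] at this
    simpa using this
  have hY : Y = D ++ V := by
    have := congrArg List.reverse h'.eq
    simpa using this
  have hz : G.mirror.wt z.reverse = G.wt z :=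
    G.mirror_wt fun x hx => hD.mem_right x (by simp [hx])
  have hV : ∀ x ∈ V, x ∈ G.vars := fun x hx => h'.mem x (by simpa using hx)
  have hmem := hc.mem_left
  refine ⟨by rw [h.eq, hY]; simp, ?_, h.wt_eq, ?_, ?_, ?_, ?_, h.mem, hV⟩
  · have := (h.refines.append (hc.append hD))
    simpa using this
  · rw [← h'.wt_eq, hz, G.mirror_wt hV]
  · intro x R' hx
    rcases A with _ | ⟨y, A⟩
    · rw [(List.append_eq_nil_iff.1 h.refines.eq_nil).1]
      obtain ⟨y, c, rfl⟩ := List.exists_cons_of_ne_nil hc0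
      simp at hx
      rw [← hx.1]
      exact G.length_val_pos (hmem y (by simp))
    · simp at hx
      rw [← hx.1]
      exact h.tight y A rfl
  · intro x R' hx
    rcases List.eq_nil_or_concat D with rfl | ⟨D, y, rfl⟩
    · rw [(List.append_eq_nil_iff.1 hD.eq_nil).2]
      obtain ⟨c, y, rfl⟩ := (List.eq_nil_or_concat c).resolve_left hc0
      have := congrArg List.getLast? hx
      simp at this
      rw [← this]
      exact G.length_val_pos (hmem y (by simp))
    · have := congrArg List.getLast? hx
      simp at this
      rw [← this, ← hz, ← G.mirror_length_val (hD.mem_left y (by simp))]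
      exact h'.tight y D.reverse (by simp)
  · intro x hx
    simp only [List.mem_append] at hx
    rcases hx with hx | (hx | hx | hx) | hx
    · exact h.notRun x (by simp [hx])
    · exact h.notRun x (by simp [hx])
    · exact hc' x hx
    · exact G.mirror_notRun.1 (h'.notRun x (by simp [hx]))
    · exact G.mirror_notRun.1 (h'.notRun x (by simp [hx]))

end RunLengthACFG

/-! ### The levels of a signature encoding. -/

namespace RunLengthACFG

variable {α : Type*} {G : RunLengthACFG α}

theorem IsSig.unique {x : Rhs α} {e e' : ℕ} (h : G.IsSig x e) (h' : G.IsSig x e') : e = e' :=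
  G.rhs_injOn h.1 h'.1 (h.2.trans h'.2.symm)

theorem IsSig.char_notRun {a : α} {e : ℕ} (h : G.IsSig (.char a) e) : G.NotRun e := by
  intro y d h'; simp [h.2] at h'

theorem IsSig.pair_notRun {l r e : ℕ} (h : G.IsSig (.pair l r) e) : G.NotRun e := by
  intro y d h'; simp [h.2] at h'

theorem IsSig.refines_pair {l r e : ℕ} (h : G.IsSig (.pair l r) e) :
    G.RefinesLE 1 [e] [l, r] := ⟨1, le_rfl, .single_pair h.1 h.2⟩

/-- Undoing the last application of `Sig` shows that the intermediate variables of a block are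
signatures of its prefixes. -/
theorem IsSigBlock.cases {q : List ℕ} {e : ℕ} (h : G.IsSigBlock q e) :
    (∃ a b, q = [a, b] ∧ G.IsSig (.pair a b) e) ∨
    ∃ q' x c, q = q' ++ [c] ∧ 2 ≤ q'.length ∧ q'.length ≤ 3 ∧ G.IsSigBlock q' x ∧
      G.IsSig (.pair x c) e := by
  match q, h with
  | [a, b], h => exact .inl ⟨a, b, rfl, h⟩
  | [a, b, c], ⟨x, h1, h2⟩ => exact .inr ⟨[a, b], x, c, rfl, by simp, by simp, h1, h2⟩
  | [a, b, c, d], ⟨x, y, h1, h2, h3⟩ =>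
    exact .inr ⟨[a, b, c], y, d, rfl, by simp, by simp, ⟨x, h1, h2⟩, h3⟩

theorem IsSigBlock.notRun {q : List ℕ} {e : ℕ} (h : G.IsSigBlock q e) : G.NotRun e := by
  rcases h.cases with ⟨a, b, -, h'⟩ | ⟨q', x, c, -, -, -, -, h'⟩ <;> exact IsSig.pair_notRun h'

theorem IsSigBlock.length {q : List ℕ} {e : ℕ} (h : G.IsSigBlock q e) :
    2 ≤ q.length ∧ q.length ≤ 4 := by
  rcases h.cases with ⟨a, b, rfl, h⟩ | ⟨q', x, c, rfl, h1, h2, -⟩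
  · simp
  · simp; omega

theorem IsSigBlock.refines {q : List ℕ} {e : ℕ} (h : G.IsSigBlock q e) :
    G.RefinesLE 3 [e] q := by
  match q, h with
  | [a, b], h => exact (IsSig.refines_pair h).mono (by omega)
  | [a, b, c], ⟨x, h1, h2⟩ =>
    have h3 := h2.refines_pair
    exact (h3.trans (h1.refines_pair.append (.refl fun y hy => h3.mem_right y (by simp_all)))).mono
      (by omega)
  | [a, b, c, d], ⟨x, y, h1, h2, h3⟩ =>
    have h4 := h2.refines_pair
    have h5 := h4.trans (h1.refines_pair.append (F' := [c]) (u' := [c])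
      (.refl fun y hy => h4.mem_right y (by simp_all)))
    have h6 := h3.refines_pair
    exact (h6.trans (h5.append (F' := [d]) (u' := [d])
      (.refl fun y hy => h6.mem_right y (by simp_all)))).mono (by omega)

theorem flatten_eblock {W : ℕ} (f : WindowFun W) (p : List ℕ) : (eblock f p).flatten = p := by
  rw [eblock_eq_cuts, flatten_cuts]

/-- The sequences of the signature encoding. -/
structure IsLevels {W : ℕ} (G : RunLengthACFG α) (f : WindowFun W) (T : List α) (h : ℕ)
    (shrink pow : ℕ → List ℕ) : Prop where
  base : List.Forall₂ (fun a e => G.IsSig (.char a) e) T (shrink 0)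
  pow_sig : ∀ t ≤ h, List.Forall₂ (fun q e => G.IsSig (.run q.1 q.2) e) (epow (shrink t)) (pow t)
  shrink_sig : ∀ t < h, List.Forall₂ G.IsSigBlock (eblock f (pow t)) (shrink (t + 1))
  top : pow h = [G.start]

theorem exists_mem_of_forall₂ {β γ : Type*} {r : β → γ → Prop} {l : List β} {m : List γ}
    (h : List.Forall₂ r l m) {y : γ} (hy : y ∈ m) : ∃ x ∈ l, r x y := by
  induction h with
  | nil => simp at hy
  | cons h1 _ ih =>
    rcases List.mem_cons.1 hy with rfl | hy
    · exact ⟨_, by simp, h1⟩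
    · obtain ⟨x, hx, h⟩ := ih hy
      exact ⟨x, by simp [hx], h⟩

theorem eq_replicate_of_mem_splitBy {s q : List ℕ} (h : q ∈ s.splitBy fun x y => x == y) :
    q = List.replicate q.length (q.headD 0) := by
  have h1 := List.isChain_of_mem_splitBy h
  obtain ⟨a, q, rfl⟩ := List.exists_cons_of_ne_nil (List.ne_nil_of_mem_splitBy h)
  rw [List.eq_replicate_iff]
  refine ⟨rfl, ?_⟩
  simp only [List.headD_cons]
  clear h
  induction q generalizing a with
  | nil => simp
  | cons b q ih =>
    rw [List.isChain_cons_cons] at h1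
    have := beq_iff_eq.1 h1.1
    subst this
    intro x hx
    rcases List.mem_cons.1 hx with rfl | hx
    · rfl
    · exact ih a h1.2 x hx

variable (G) in
/-- Every character of the string derived by `F` is reached by expanding at most `n` pairs. -/
def Reachable (n : ℕ) (F : List ℕ) : Prop :=
  ∀ p < G.wt F, ∃ w a z, G.RefinesLE n F (w ++ a :: z) ∧ (G.val a).length = 1 ∧ G.wt w = p ∧
    ∀ x ∈ w ++ a :: z, G.NotRun x

theorem Reachable.of_refines {k n : ℕ} {F u : List ℕ} (h : G.RefinesLE k F u)
    (h' : G.Reachable n u) : G.Reachable (k + n) F := by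
  intro p hp
  obtain ⟨w, a, z, h1, h2⟩ := h' p (by rwa [← h.wt_eq])
  exact ⟨w, a, z, h.trans h1, h2⟩

/-- Only the variable containing the position has to be opened; the others are merely freed of runs,
at no cost. -/
theorem reachable_of_forall {n : ℕ} {F : List ℕ} (h : ∀ x ∈ F, G.Reachable n [x])
    (h' : ∀ x ∈ F, G.Flattens x) : G.Reachable n F := by
  induction F with
  | nil => intro p hp; simp at hp
  | cons x F ih =>
    intro p hp
    obtain ⟨uF, huF, huF'⟩ := exists_flatten (L := F) fun y hy => h' y (by simp [hy])
    obtain ⟨ux, hux, hux'⟩ := h' x (by simp)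
    by_cases hpx : p < G.wt [x]
    · obtain ⟨w, a, z, h1, h2, h3, h4⟩ := h x (by simp) p hpx
      refine ⟨w, a, z ++ uF, by simpa using h1.append huF, h2, h3, fun y hy => ?_⟩
      rw [← List.cons_append, ← List.append_assoc, List.mem_append] at hy
      rcases hy with hy | hy
      exacts [h4 y hy, huF' y hy]
    · obtain ⟨w, a, z, h1, h2, h3, h4⟩ := ih (fun y hy => h y (by simp [hy]))
        (fun y hy => h' y (by simp [hy])) (p - G.wt [x]) (by simp at hp hpx ⊢; omega)
      refine ⟨ux ++ w, a, z, (by simpa using hux.append h1), h2, ?_, fun y hy => ?_⟩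
      · rw [wt_append, ← hux.wt_eq]; omega
      · rw [List.append_assoc, List.mem_append] at hy
        rcases hy with hy | hy
        exacts [hux' y hy, h4 y hy]

theorem reachable_char {a : α} {e : ℕ} (h : G.IsSig (.char a) e) : G.Reachable 0 [e] := by
  intro p hp
  have hv := G.val_char h.2
  simp [hv] at hp
  exact ⟨[], e, [], .refl (by simpa using h.1), by simp [hv], by simp [hp],
    by simpa using h.char_notRun⟩

theorem word_of_forall₂ {s : List α} {X : List ℕ}
    (h : List.Forall₂ (fun a e => G.IsSig (.char a) e) s X) : G.word X = s := by
  induction h with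
  | nil => rfl
  | cons h1 _ ih => rw [word_cons, ih, G.val_char h1.2]; rfl

namespace IsLevels

variable {W : ℕ} {f : WindowFun W} {T : List α} {h t : ℕ} {shrink pow : ℕ → List ℕ}
  (H : IsLevels G f T h shrink pow)
include H

theorem pow_blocks (ht : t ≤ h) : List.Forall₂ (fun q e => ∃ x d, q = List.replicate d x ∧
    G.IsSig (.run x d) e) ((shrink t).splitBy fun x y => x == y) (pow t) := by
  have h1 := H.pow_sig t ht
  rw [epow, List.forall₂_map_left_iff] at h1
  have h2 := (List.forall₂_and_left _ _).2 ⟨fun q hq => eq_replicate_of_mem_splitBy hq, h1⟩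
  exact h2.imp fun q e h => ⟨_, _, h.1, h.2⟩

theorem pow_refines (ht : t ≤ h) : List.Forall₂ (fun q e => G.RefinesLE 0 [e] q)
    ((shrink t).splitBy fun x y => x == y) (pow t) := by
  refine (H.pow_blocks ht).imp ?_
  rintro q e ⟨x, d, rfl, h1⟩
  exact ⟨0, le_rfl, .single_run h1.1 h1.2⟩

theorem shrink_refines (ht : t < h) : List.Forall₂ (fun q e => G.RefinesLE 3 [e] q)
    (eblock f (pow t)) (shrink (t + 1)) :=
  (H.shrink_sig t ht).imp fun _ _ h => h.refines

theorem pow_refines_shrink (ht : t ≤ h) : G.RefinesLE 0 (pow t) (shrink t) := by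
  have := RefinesLE.of_forall₂ (H.pow_refines ht)
  rwa [List.flatten_splitBy, Nat.zero_mul] at this

theorem shrink_refines_pow (ht : t < h) :
    G.RefinesLE (3 * (shrink (t + 1)).length) (shrink (t + 1)) (pow t) := by
  have := RefinesLE.of_forall₂ (H.shrink_refines ht)
  rwa [flatten_eblock] at this

theorem shrink_notRun (ht : t ≤ h) : ∀ x ∈ shrink t, G.NotRun x := by
  intro x hx
  cases t with
  | zero =>
    obtain ⟨a, -, h1⟩ := exists_mem_of_forall₂ H.base hx
    exact h1.char_notRun
  | succ t =>
    obtain ⟨q, -, h1⟩ := exists_mem_of_forall₂ (H.shrink_sig t ht) hx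
    exact h1.notRun

theorem shrink_mem (ht : t ≤ h) : ∀ x ∈ shrink t, x ∈ G.vars :=
  (H.pow_refines_shrink ht).mem_right

theorem pow_mem (ht : t ≤ h) : ∀ x ∈ pow t, x ∈ G.vars :=
  (H.pow_refines_shrink ht).mem_left

theorem pow_isRun (ht : t ≤ h) {e : ℕ} (he : e ∈ pow t) :
    ∃ x d, x ∈ shrink t ∧ G.IsSig (.run x d) e := by
  obtain ⟨q, hq, x, d, rfl, h1⟩ := exists_mem_of_forall₂ (H.pow_blocks ht) he
  refine ⟨x, d, ?_, h1⟩
  have hd := G.run_pos e h1.1 x d h1.2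
  rw [← List.flatten_splitBy (fun x y => x == y) (shrink t), List.mem_flatten]
  exact ⟨_, hq, by simp; omega⟩

theorem shrink_flattens (ht : t ≤ h) : ∀ x ∈ shrink t, G.Flattens x := fun x hx =>
  ⟨[x], .refl (by simpa using H.shrink_mem ht x hx), by simpa using H.shrink_notRun ht x hx⟩

theorem pow_flattens (ht : t ≤ h) : ∀ x ∈ pow t, G.Flattens x := by
  intro e he
  obtain ⟨x, d, hx, h1⟩ := H.pow_isRun ht he
  refine ⟨List.replicate d x, ⟨0, le_rfl, .single_run h1.1 h1.2⟩, fun y hy => ?_⟩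
  rw [List.eq_of_mem_replicate hy]
  exact H.shrink_notRun ht x hx

theorem word_shrink_pow (ht : t ≤ h) : G.word (shrink t) = T ∧ G.word (pow t) = T := by
  induction t with
  | zero =>
    have h1 := word_of_forall₂ H.base
    exact ⟨h1, by rw [(H.pow_refines_shrink ht).word_eq, h1]⟩
  | succ t ih =>
    have h1 : G.word (shrink (t + 1)) = T := by
      rw [(H.shrink_refines_pow ht).word_eq, (ih (by omega)).2]
    exact ⟨h1, by rw [(H.pow_refines_shrink ht).word_eq, h1]⟩

theorem wt_pow (ht : t ≤ h) : G.wt (pow t) = T.length := by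
  rw [wt, (H.word_shrink_pow ht).2]

/-- A block has at least two entries, so forming blocks doubles the minimal length; forming runs
does not decrease it. -/
theorem two_pow_le (ht : t ≤ h) : (∀ x ∈ shrink t, 2 ^ t ≤ (G.val x).length) ∧
    ∀ x ∈ pow t, 2 ^ t ≤ (G.val x).length := by
  have key : ∀ t ≤ h, (∀ x ∈ shrink t, 2 ^ t ≤ (G.val x).length) →
      ∀ x ∈ pow t, 2 ^ t ≤ (G.val x).length := by
    intro t ht h1 e he
    obtain ⟨x, d, hx, h2⟩ := H.pow_isRun ht he
    have hd := G.run_pos e h2.1 x d h2.2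
    rw [G.val_run h2.1 h2.2, ← word_replicate]
    change _ ≤ G.wt _
    rw [wt_replicate]
    exact (h1 x hx).trans (Nat.le_mul_of_pos_left _ hd)
  induction t with
  | zero =>
    have h1 : ∀ x ∈ shrink 0, 2 ^ 0 ≤ (G.val x).length := fun x hx =>
      G.length_val_pos (H.shrink_mem ht x hx)
    exact ⟨h1, key 0 ht h1⟩
  | succ t ih =>
    have h1 : ∀ x ∈ shrink (t + 1), 2 ^ (t + 1) ≤ (G.val x).length := by
      intro e he
      obtain ⟨q, hq, h2⟩ := exists_mem_of_forall₂ (H.shrink_sig t ht) he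
      have h3 := h2.refines.wt_eq
      have h4 : ∀ x ∈ q, 2 ^ t ≤ (G.val x).length := fun x hx =>
        (ih (by omega)).2 x (by
          rw [← flatten_eblock f (pow t), List.mem_flatten]; exact ⟨q, hq, hx⟩)
      obtain ⟨a, b, q', rfl⟩ : ∃ a b q', q = a :: b :: q' := by
        have := h2.length
        match q with
        | a :: b :: q' => exact ⟨a, b, q', rfl⟩
        | [a] => simp at this
        | [] => simp at this
      have h5 := h4 a (by simp)
      have h6 := h4 b (by simp)
      simp only [wt_cons, wt_nil] at h3
      rw [pow_succ]
      omega
    exact ⟨h1, key _ ht h1⟩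

/-- Equal neighbours in `Pow_t` would be signatures of neighbouring runs of the same variable,
contrary to the maximality of runs. -/
theorem colored (ht : t ≤ h) (hW : ∀ e ∈ G.vars, e ≤ W) : IsColored W (pow t) := by
  refine ⟨fun x hx => hW x (H.pow_mem ht x hx), ?_⟩
  have h1 := H.pow_blocks ht
  have h2 := List.isChain_getLast_head_splitBy (fun x y => x == y) (shrink t)
  generalize (shrink t).splitBy (fun x y => x == y) = Q at h1 h2
  generalize pow t = p at h1
  induction h1 with
  | nil => exact .nil
  | cons h3 h4 ih =>
    cases h4 with
    | nil => exact .singleton _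
    | cons h5 h6 =>
      rw [List.isChain_cons_cons] at h2 ⊢
      refine ⟨?_, ih h2.2⟩
      obtain ⟨x, d, rfl, h7⟩ := h3
      obtain ⟨x', d', rfl, h8⟩ := h5
      obtain ⟨⟨ha, hb, h9⟩, -⟩ := h2
      rintro rfl
      have := h7.2.symm.trans h8.2
      cases this
      simp at h9

/-- Descending one level means opening one block, at the cost of three pairs, and one run, which is
free. -/
theorem reachable_levels (ht : t ≤ h) : (∀ x ∈ shrink t, G.Reachable (3 * t) [x]) ∧
    ∀ x ∈ pow t, G.Reachable (3 * t) [x] := by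
  have key : ∀ t ≤ h, (∀ x ∈ shrink t, G.Reachable (3 * t) [x]) →
      ∀ x ∈ pow t, G.Reachable (3 * t) [x] := by
    intro t ht h1 e he
    obtain ⟨x, d, hx, h2⟩ := H.pow_isRun ht he
    have := Reachable.of_refines (k := 0) (F := [e]) ⟨0, le_rfl, .single_run h2.1 h2.2⟩
      (reachable_of_forall (n := 3 * t)
        (fun y hy => by rw [List.eq_of_mem_replicate hy]; exact h1 x hx)
        (fun y hy => by rw [List.eq_of_mem_replicate hy]; exact H.shrink_flattens ht x hx))
    rwa [Nat.zero_add] at this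
  induction t with
  | zero =>
    have h1 : ∀ x ∈ shrink 0, G.Reachable (3 * 0) [x] := by
      intro x hx
      obtain ⟨a, -, h1⟩ := exists_mem_of_forall₂ H.base hx
      exact reachable_char h1
    exact ⟨h1, key 0 ht h1⟩
  | succ t ih =>
    have h1 : ∀ x ∈ shrink (t + 1), G.Reachable (3 * (t + 1)) [x] := by
      intro e he
      obtain ⟨q, hq, h2⟩ := exists_mem_of_forall₂ (H.shrink_sig t ht) he
      have h3 : ∀ x ∈ q, x ∈ pow t := fun x hx => by
        rw [← flatten_eblock f (pow t), List.mem_flatten]; exact ⟨q, hq, hx⟩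
      have := Reachable.of_refines h2.refines (reachable_of_forall (n := 3 * t)
        (fun y hy => (ih (by omega)).2 y (h3 y hy)) (fun y hy => H.pow_flattens (by omega) y (h3 y hy)))
      rwa [show 3 + 3 * t = 3 * (t + 1) by ring] at this
    exact ⟨h1, key _ ht h1⟩

/-- Every variable is a character, or a variable of some `Pow_t`, or it derives a prefix of a
block of some `Pow_t`. -/
theorem occurs : ∀ e ∈ G.vars, (∃ a, G.IsSig (.char a) e) ∨ (∃ t ≤ h, e ∈ pow t) ∨
    ∃ t < h, ∃ q q', q ++ q' ∈ eblock f (pow t) ∧ G.IsSigBlock q e := by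
  -- Induction downwards from the start symbol: any other variable is used by a larger one, whose
  -- distance from the maximum is smaller.
  suffices hs : ∀ n, ∀ e ∈ G.vars, G.vars.sup id - e = n → (∃ a, G.IsSig (.char a) e) ∨
      (∃ t ≤ h, e ∈ pow t) ∨
      ∃ t < h, ∃ q q', q ++ q' ∈ eblock f (pow t) ∧ G.IsSigBlock q e from
    fun e he => hs _ e he rfl
  intro n
  induction n using Nat.strong_induction_on with
  | _ n ih =>
    rintro e he rfl
    by_cases hes : e = G.start
    · exact .inr (.inl ⟨h, le_rfl, by rw [H.top, hes]; simp⟩)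
    obtain ⟨e', he', hlt, hmem⟩ := G.used e he hes
    have hle : e' ≤ G.vars.sup id := Finset.le_sup (f := id) he'
    have hpow : ∀ {t q}, q ∈ eblock f (pow t) → ∀ x ∈ q, x ∈ pow t := fun {t q} hq x hx => by
      rw [← flatten_eblock f (pow t), List.mem_flatten]; exact ⟨q, hq, hx⟩
    rcases ih _ (by omega) e' he' rfl with ⟨a, h1⟩ | ⟨t, ht, h1⟩ | ⟨t, ht, q, q', hq, h1⟩
    · rw [h1.2] at hmem
      exact hmem.elim
    · obtain ⟨x, d, hx, h2⟩ := H.pow_isRun ht h1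
      rw [h2.2] at hmem
      obtain rfl : e = x := hmem
      cases t with
      | zero =>
        obtain ⟨a, -, h3⟩ := exists_mem_of_forall₂ H.base hx
        exact .inl ⟨a, h3⟩
      | succ t =>
        obtain ⟨q, hq, h3⟩ := exists_mem_of_forall₂ (H.shrink_sig t ht) hx
        exact .inr (.inr ⟨t, ht, q, [], by simpa using hq, h3⟩)
    · rcases h1.cases with ⟨a, b, rfl, h2⟩ | ⟨q₀, x, c, rfl, h2, h3, h4, h5⟩
      · rw [h2.2] at hmem
        refine .inr (.inl ⟨t, ht.le, hpow hq e ?_⟩)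
        rcases hmem with rfl | rfl <;> simp
      · rw [h5.2] at hmem
        rcases hmem with rfl | rfl
        · exact .inr (.inr ⟨t, ht, q₀, c :: q', by simpa using hq, h4⟩)
        · exact .inr (.inl ⟨t, ht.le, hpow hq _ (by simp)⟩)

/-- Every variable which is no character derives at most four consecutive variables of some
`Pow_t`. -/
theorem exists_pow_segment {e : ℕ} (he : e ∈ G.vars) (hc : ¬ ∃ a, G.IsSig (.char a) e) :
    ∃ t ≤ h, ∃ U q V, pow t = U ++ (q ++ V) ∧ q.length ≤ 4 ∧ G.RefinesLE 3 [e] q ∧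
      2 ^ t ≤ (G.val e).length := by
  rcases H.occurs e he with h1 | ⟨t, ht, h1⟩ | ⟨t, ht, q, q', hq, h1⟩
  · exact absurd h1 hc
  · obtain ⟨U, V, hUV⟩ := List.append_of_mem h1
    exact ⟨t, ht, U, [e], V, by simpa using hUV, by simp,
      (RefinesLE.refl (by simpa using he)).mono (by omega), (H.two_pow_le ht).2 e h1⟩
  · obtain ⟨Q₁, Q₂, hQ⟩ := List.append_of_mem hq
    have hfl := flatten_eblock f (pow t)
    rw [hQ] at hfl
    refine ⟨t, ht.le, Q₁.flatten, q, q' ++ Q₂.flatten, by simp [← hfl], h1.length.2, h1.refines, ?_⟩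
    have h3 := h1.refines.wt_eq
    obtain ⟨x, q, rfl⟩ := List.exists_cons_of_ne_nil (l := q) (by
      rintro rfl; simpa using h1.length)
    have h4 := (H.two_pow_le ht.le).2 x (by rw [← hfl]; simp)
    simp only [wt_cons, wt_nil] at h3
    omega

/-- Runs occur only in the sequences `Pow_t`, and their bases lie in `Shrink_t`, where there are no
runs. So replacing a run on a stack lowers the potential from `2` to `1`. -/
theorem notRun_of_run {e y d : ℕ} (he : e ∈ G.vars) (hr : G.rhs e = .run y d) : G.NotRun y := by
  rcases H.occurs e he with ⟨a, h1⟩ | ⟨t, ht, h1⟩ | ⟨t, ht, q, q', hq, h1⟩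
  · simp [h1.2] at hr
  · obtain ⟨x, d', hx, h2⟩ := H.pow_isRun ht h1
    rw [h2.2] at hr
    cases hr
    exact H.shrink_notRun ht _ hx
  · exact absurd hr (h1.notRun y d)

theorem flattens {e : ℕ} (he : e ∈ G.vars) : G.Flattens e := by
  by_cases hr : G.NotRun e
  · exact ⟨[e], .refl (by simpa using he), by simpa using hr⟩
  · obtain ⟨y, d, hr⟩ : ∃ y d, G.rhs e = .run y d := by simpa [NotRun] using hr
    refine ⟨List.replicate d y, ⟨0, le_rfl, .single_run he hr⟩, fun z hz => ?_⟩
    rw [List.eq_of_mem_replicate hz]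
    exact H.notRun_of_run he hr

theorem reachable {e : ℕ} (he : e ∈ G.vars) :
    G.Reachable (3 * Nat.log 2 (G.val e).length + 3) [e] := by
  by_cases hc : ∃ a, G.IsSig (.char a) e
  · obtain ⟨a, ha⟩ := hc
    intro p hp
    obtain ⟨w, b, z, h1, h2⟩ := reachable_char ha p hp
    exact ⟨w, b, z, h1.mono (by omega), h2⟩
  · obtain ⟨t, ht, U, q, V, h1, -, h2, h3⟩ := H.exists_pow_segment he hc
    have hlog := Nat.le_log_of_pow_le (by omega) h3
    have hq : ∀ x ∈ q, x ∈ pow t := fun x hx => by rw [h1]; simp [hx]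
    have h4 := Reachable.of_refines h2 (reachable_of_forall
      (fun x hx => (H.reachable_levels ht).2 x (hq x hx))
      (fun x hx => H.pow_flattens ht x (hq x hx)))
    intro p hp
    obtain ⟨w, b, z, h1, h2⟩ := h4 p hp
    exact ⟨w, b, z, h1.mono (by omega), h2⟩

theorem length_val_le {e : ℕ} (he : e ∈ G.vars) : (G.val e).length ≤ T.length := by
  by_cases hc : ∃ a, G.IsSig (.char a) e
  · obtain ⟨a, ha⟩ := hc
    rw [G.val_char ha.2, ← (H.word_shrink_pow (le_refl h)).2, H.top]
    exact G.length_le_wt (u := [G.start]) (by simpa using G.start_mem)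
  · obtain ⟨t, ht, U, q, V, h1, -, h2, h3⟩ := H.exists_pow_segment he hc
    have h4 := h2.wt_eq
    have h5 := H.wt_pow ht
    rw [h1, wt_append, wt_append] at h5
    rw [wt_cons, wt_nil] at h4
    omega

end IsLevels

end RunLengthACFG

/-! ### Windows with a core common to several occurrences. -/

namespace RunLengthACFG

variable {α : Type*} {G : RunLengthACFG α}

variable (G) in
/-- The mirror image of `IsLeftCover`: `Y = D ++ V` covers `rho` on the left. -/
def IsRightCover (Y : List ℕ) (E : ℕ) (rho : List ℕ) (n : ℕ) (V D z : List ℕ) : Prop :=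
  G.mirror.IsLeftCover Y.reverse E rho.reverse n V.reverse D.reverse z.reverse

theorem IsRightCover.coarsen {Y Y' : List ℕ} {E n k N : ℕ} {rho lp lp' V D z : List ℕ}
    {Q : List (List ℕ)} (h : G.IsRightCover Y E rho n V D z) (hQ : Q.flatten = lp ++ Y)
    (hr : List.Forall₂ (fun q e => G.RefinesLE k [e] q) Q Y')
    (hN : ∀ Q', Q' <:+: Q → Q'.flatten <+: lp ++ D → Q'.length ≤ N)
    (hY : ∀ x ∈ Y, G.Flattens x) (hlp : G.RefinesLE 0 lp lp') (hlp' : ∀ x ∈ lp', G.NotRun x) :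
    ∃ V' D' z', D'.length ≤ N + 1 ∧
      G.IsRightCover Y' E (lp' ++ rho) (n + k * D'.length) V' D' z' := by
  have hrev : (Q.map List.reverse).reverse.flatten = Y.reverse ++ lp.reverse := by
    rw [List.flatten_reverse_map_reverse, hQ, List.reverse_append]
  have hr' : List.Forall₂ (fun q e => G.mirror.RefinesLE k [e] q) (Q.map List.reverse).reverse
      Y'.reverse := by
    refine List.Forall₂.reverse' ?_
    rw [List.forall₂_map_left_iff]
    exact hr.imp fun q e h => h.mirror
  have hN' : ∀ Q', Q' <:+: (Q.map List.reverse).reverse →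
      Q'.flatten <:+ D.reverse ++ lp.reverse → Q'.length ≤ N := by
    intro Q' h1 h2
    have h3 : (Q'.map List.reverse).reverse <:+: Q := by
      have := (List.reverse_infix.2 h1).map List.reverse
      simpa [Function.comp_def] using this
    have := hN _ h3 (by
      rw [List.flatten_reverse_map_reverse, ← List.reverse_suffix]
      simpa using h2)
    simpa using this
  obtain ⟨V', D', z', h1, h2⟩ := IsLeftCover.coarsen (N := N) h hrev hr' hN'
    (fun x hx => (hY x (by simpa using hx)).mirror) hlp.mirror
    (fun x hx => G.mirror_notRun.2 (hlp' x (by simpa using hx)))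
  refine ⟨V'.reverse, D'.reverse, z'.reverse, by simpa using h1, ?_⟩
  simpa [IsRightCover] using h2

variable (G) in
/-- `L = X ++ gam ++ Y` where the window `lam ++ gam ++ rho` is covered by `X` and `Y` outside `gam`,
with `N` variables and at the cost of `n`. -/
def IsCore (L : List ℕ) (P E : ℕ) (lam gam rho : List ℕ) (N n : ℕ) : Prop :=
  ∃ X Y Z A w V D z n₁ n₂, L = X ++ (gam ++ Y) ∧ G.IsLeftCover X P lam n₁ Z A w ∧
    G.IsRightCover Y E rho n₂ V D z ∧ A.length + D.length = N ∧ n₁ + n₂ ≤ n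

variable (G) in
/-- The window `cs` of `L` is covered by `N` variables at the cost of `n`. -/
def IsCovered (L : List ℕ) (P E : ℕ) (cs : List ℕ) (N n : ℕ) : Prop :=
  ∃ Z R V w z, G.IsCover L P E cs n Z R V w z ∧ R.length = N

theorem IsCovered.mono {L cs : List ℕ} {P E N n m : ℕ} (h : G.IsCovered L P E cs N n)
    (hm : n ≤ m) : G.IsCovered L P E cs N m := by
  obtain ⟨Z, R, V, w, z, h, hR⟩ := h
  exact ⟨Z, R, V, w, z, { h with refines := h.refines.mono hm }, hR⟩

theorem IsCore.mono {L lam gam rho : List ℕ} {P E N n m : ℕ} (h : G.IsCore L P E lam gam rho N n)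
    (hm : n ≤ m) : G.IsCore L P E lam gam rho N m := by
  obtain ⟨X, Y, Z, A, w, V, D, z, n₁, n₂, h1, h2, h3, h4, h5⟩ := h
  exact ⟨X, Y, Z, A, w, V, D, z, n₁, n₂, h1, h2, h3, h4, h5.trans hm⟩

/-- The core is given up: its variables are counted among the covering ones, and from now on the
sequence to be covered is fixed. -/
theorem IsCore.covered {L lam gam gam' rho : List ℕ} {P E N n : ℕ}
    (h : G.IsCore L P E lam gam rho N n) (hg : G.RefinesLE 0 gam gam')
    (hg' : ∀ x ∈ gam', G.NotRun x) (h0 : gam ≠ []) :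
    G.IsCovered L P E (lam ++ (gam' ++ rho)) (N + gam.length) n := by
  obtain ⟨X, Y, Z, A, w, V, D, z, n₁, n₂, rfl, h2, h3, rfl, h5⟩ := h
  refine IsCovered.mono ⟨_, _, _, _, _, h2.cover h3 hg hg' h0, ?_⟩ h5
  simp; omega

theorem IsCore.le_two {L lam gam rho : List ℕ} {P E N n : ℕ}
    (h : G.IsCore L P E lam gam rho N n)
    (hL : ∀ x ∈ L, G.wt lam < (G.val x).length ∧ G.wt rho < (G.val x).length)
    (hm : ∀ x ∈ L, x ∈ G.vars) : N ≤ 2 := by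
  obtain ⟨X, Y, Z, A, w, V, D, z, n₁, n₂, rfl, h2, h3, rfl, h5⟩ := h
  have hr : ∀ x ∈ rho, x ∈ G.vars := fun x hx => h3.refines.mem_right x (by simp [hx])
  have hX := h2.eq
  have hY := h3.eq
  have h6 := h2.length_le_one fun x hx => (hL x (by simp [hX, hx])).1
  have h7 := h3.length_le_one fun x hx => by
    have : x ∈ Y := by rw [← List.mem_reverse, hY]; simp only [List.mem_append]; exact .inr hx
    rw [G.mirror_wt hr, G.mirror_length_val (hm x (by simp [this]))]
    exact (hL x (by simp [this])).2
  rw [List.length_reverse] at h7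
  omega

theorem IsCovered.le_two {L cs : List ℕ} {P E N n : ℕ} (h : G.IsCovered L P E cs N n)
    (hL : ∀ x ∈ L, G.wt cs < (G.val x).length) : N ≤ 2 := by
  obtain ⟨Z, R, V, w, z, h, rfl⟩ := h
  exact h.length_le_two fun x hx => hL x (by simp [h.eq, hx])

/-- The factor `μ` is the guaranteed contraction, `2` for blocks and `1` for runs; the summand `2 *
μ` stands for the two blocks that may stick out of the old cover. -/
theorem IsCovered.coarsen {L L' cs : List ℕ} {P E N n k μ x : ℕ} {Q : List (List ℕ)}
    (h : G.IsCovered L P E cs N n) (hcs : cs ≠ []) (hμ : 0 < μ) (hQ : Q.flatten = L)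
    (hr : List.Forall₂ (fun q e => G.RefinesLE k [e] q) Q L')
    (hN : ∀ Q' R, Q' <:+: Q → Q'.flatten <:+: R → Q'.length * μ ≤ R.length + x)
    (hL : ∀ x ∈ L, G.Flattens x) :
    ∃ N', N' * μ ≤ N + x + 2 * μ ∧ G.IsCovered L' P E cs N' (n + k * N') := by
  obtain ⟨Z, R, V, w, z, h, rfl⟩ := h
  obtain ⟨Z', R', V', w', z', h1, h2⟩ := h.coarsen (N := (R.length + x) / μ) hcs hQ hr
    (fun Q' h1 h2 => (Nat.le_div_iff_mul_le hμ).2 (hN Q' R h1 h2)) hL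
  refine ⟨_, ?_, Z', R', V', w', z', h2, rfl⟩
  have := Nat.div_mul_le_self (R.length + x) μ
  have := Nat.mul_le_mul_right μ h1
  rw [Nat.add_mul] at this
  omega

/-- The core is given up and coarsened in one step. The hypothesis `hN` counts blocks meeting the
core through `x` instead of its variables, so a long core made of few runs is cheap. -/
theorem IsCore.coarsen_covered {L L' lam gam gam' rho : List ℕ} {P E N n k μ x : ℕ}
    {Q : List (List ℕ)} (h : G.IsCore L P E lam gam rho N n) (hg : G.RefinesLE 0 gam gam')
    (hg' : ∀ x ∈ gam', G.NotRun x) (h0 : gam ≠ []) (hμ : 0 < μ) (hQ : Q.flatten = L)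
    (hr : List.Forall₂ (fun q e => G.RefinesLE k [e] q) Q L')
    (hN : ∀ Q' A D, Q' <:+: Q → Q'.flatten <:+: A ++ (gam ++ D) →
      Q'.length * μ ≤ A.length + D.length + x)
    (hL : ∀ x ∈ L, G.Flattens x) :
    ∃ N', N' * μ ≤ N + x + 2 * μ ∧
      G.IsCovered L' P E (lam ++ (gam' ++ rho)) N' (n + k * N') := by
  obtain ⟨X, Y, Z, A, w, V, D, z, n₁, n₂, rfl, h2, h3, rfl, h5⟩ := h
  obtain ⟨Z', R', V', w', z', h6, h7⟩ := (h2.cover h3 hg hg' h0).coarsen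
    (N := (A.length + D.length + x) / μ)
    (by
      have : gam' ≠ [] := by
        rintro rfl
        exact h0 (G.eq_nil_of_wt hg.mem_left (by rw [hg.wt_eq]; rfl))
      simp [this]) hQ hr
    (fun Q' h1 h2 => (Nat.le_div_iff_mul_le hμ).2 (hN Q' A D h1 h2)) hL
  refine ⟨_, ?_, IsCovered.mono ⟨Z', R', V', w', z', h7, rfl⟩ (by omega)⟩
  have := Nat.div_mul_le_self (A.length + D.length + x) μ
  have := Nat.mul_le_mul_right μ h6
  rw [Nat.add_mul] at this
  omega

theorem forall₂_unique {β γ : Type*} {r : β → γ → Prop}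
    (hr : ∀ a b b', r a b → r a b' → b = b') {l : List β} {m m' : List γ}
    (h : List.Forall₂ r l m) (h' : List.Forall₂ r l m') : m = m' := by
  induction h generalizing m' with
  | nil => cases h'; rfl
  | cons h1 _ ih =>
    cases h' with
    | cons h2 h3 => rw [hr _ _ _ h1 h2, ih h3]

/-- Coarsening when the blocks of `gam₂` are blocks of `L`. -/
theorem IsCore.coarsen {L L' lam gam gam₁ gam₁' gam₃ gam₃' rho c : List ℕ}
    {P E N n k μ x y : ℕ} {Q Qm : List (List ℕ)} {r : List ℕ → ℕ → Prop}
    (h : G.IsCore L P E lam gam rho N n) (hμ : 0 < μ)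
    (hQ : ∀ X Y, L = X ++ (gam ++ Y) → ∃ Q₁ Q₃, Q = Q₁ ++ (Qm ++ Q₃) ∧
      Q₁.flatten = X ++ gam₁ ∧ Q₃.flatten = gam₃ ++ Y)
    (hr : List.Forall₂ r Q L') (hrk : ∀ q e, r q e → G.RefinesLE k [e] q)
    (hru : ∀ q e e', r q e → r q e' → e = e') (hc : List.Forall₂ r Qm c)
    (hN₁ : ∀ Q' A, Q' <:+: Q → Q'.flatten <:+ A ++ gam₁ → Q'.length * μ ≤ A.length + x)
    (hN₃ : ∀ Q' D, Q' <:+: Q → Q'.flatten <+: gam₃ ++ D → Q'.length * μ ≤ D.length + y)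
    (hL : ∀ x ∈ L, G.Flattens x)
    (hg₁ : G.RefinesLE 0 gam₁ gam₁') (hg₁' : ∀ x ∈ gam₁', G.NotRun x)
    (hg₃ : G.RefinesLE 0 gam₃ gam₃') (hg₃' : ∀ x ∈ gam₃', G.NotRun x) :
    ∃ N', N' * μ ≤ N + x + y + 2 * μ ∧
      G.IsCore L' P E (lam ++ gam₁') c (gam₃' ++ rho) N' (n + k * N') := by
  obtain ⟨X, Y, Z, A, w, V, D, z, n₁, n₂, hXY, h2, h3, rfl, h5⟩ := h
  obtain ⟨Q₁, Q₃, rfl, h6, h7⟩ := hQ X Y hXY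
  obtain ⟨X', L'', rfl, hr₁, hr₂⟩ := hr.append_left
  obtain ⟨c', Y', rfl, hr₂, hr₃⟩ := hr₂.append_left
  obtain rfl := forall₂_unique hru hc hr₂
  obtain ⟨Z', A', w', h8, h9⟩ := h2.coarsen (N := (A.length + x) / μ) h6 (hr₁.imp hrk)
    (fun Q' h1 h2 => (Nat.le_div_iff_mul_le hμ).2
      (hN₁ Q' A (h1.trans ⟨[], _, rfl⟩) h2))
    (fun x hx => hL x (by simp [hXY, hx])) hg₁ hg₁'
  obtain ⟨V', D', z', h10, h11⟩ := h3.coarsen (N := (D.length + y) / μ) h7 (hr₃.imp hrk)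
    (fun Q' h1 h2 => (Nat.le_div_iff_mul_le hμ).2
      (hN₃ Q' D (h1.trans ⟨Q₁ ++ Qm, [], by simp⟩) h2))
    (fun x hx => hL x (by simp [hXY, hx])) hg₃ hg₃'
  refine ⟨_, ?_, X', Y', Z', A', w', V', D', z', _, _, rfl, h9, h11, rfl, ?_⟩
  · have h12 := Nat.div_mul_le_self (A.length + x) μ
    have h13 := Nat.div_mul_le_self (D.length + y) μ
    have h14 := Nat.mul_le_mul_right μ h8
    have h15 := Nat.mul_le_mul_right μ h10
    rw [Nat.add_mul] at h14 h15 ⊢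
    omega
  · rw [Nat.mul_add]; omega

end RunLengthACFG

/-! ### From one level to the next, for several windows at once. -/

namespace RunLengthACFG

variable {α : Type*} {G : RunLengthACFG α}

variable (G) in
/-- All windows in `S`, of length `ℓ`, are covered by at most `B` variables of `L` outside a common
part of `L`, or with the same sequence to be covered. -/
def IsState (S : Set (ℕ × ℕ)) (ℓ : ℕ) (L : List ℕ) (B n : ℕ) : Prop :=
  (∃ lam gam rho, gam ≠ [] ∧ G.wt lam + G.wt gam + G.wt rho = ℓ ∧
    ∀ p ∈ S, ∃ N ≤ B, G.IsCore L p.1 p.2 lam gam rho N n) ∨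
  ∃ cs, cs ≠ [] ∧ G.wt cs = ℓ ∧ ∀ p ∈ S, ∃ N ≤ B, G.IsCovered L p.1 p.2 cs N n

theorem IsCore.infix {L lam gam rho : List ℕ} {P E N n : ℕ}
    (h : G.IsCore L P E lam gam rho N n) : gam <:+: L := by
  obtain ⟨X, Y, Z, A, w, V, D, z, n₁, n₂, rfl, -⟩ := h
  exact ⟨X, Y, by simp⟩

theorem IsSigBlock.unique {q : List ℕ} {e e' : ℕ} (h : G.IsSigBlock q e)
    (h' : G.IsSigBlock q e') : e = e' := by
  match q, h, h' with
  | [a, b], h, h' => exact IsSig.unique h h'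
  | [a, b, c], ⟨x, h1, h2⟩, ⟨x', h1', h2'⟩ =>
    obtain rfl := h1.unique h1'
    exact h2.unique h2'
  | [a, b, c, d], ⟨x, y, h1, h2, h3⟩, ⟨x', y', h1', h2', h3'⟩ =>
    obtain rfl := h1.unique h1'
    obtain rfl := h2.unique h2'
    exact h3.unique h3'

/-- `e` is the signature of the run `q`. -/
def IsSigRun (G : RunLengthACFG α) (q : List ℕ) (e : ℕ) : Prop :=
  ∃ x d, q = List.replicate d x ∧ G.IsSig (.run x d) e

theorem IsSigRun.unique {q : List ℕ} {e e' : ℕ} (h : G.IsSigRun q e)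
    (h' : G.IsSigRun q e') : e = e' := by
  obtain ⟨x, d, rfl, h1⟩ := h
  obtain ⟨x', d', h2, h3⟩ := h'
  have hd := G.run_pos e h1.1 x d h1.2
  have hd' : d = d' := by simpa using congrArg List.length h2
  subst hd'
  rw [List.replicate_right_inj (by omega)] at h2
  subst h2
  exact h1.unique h3

theorem IsSigRun.refines {q : List ℕ} {e : ℕ} (h : G.IsSigRun q e) : G.RefinesLE 0 [e] q := by
  obtain ⟨x, d, rfl, h1⟩ := h
  exact ⟨0, le_rfl, .single_run h1.1 h1.2⟩

theorem length_le_of_flatten_infix {s R : List ℕ} {Q : List (List ℕ)}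
    (hQ : Q <:+: s.splitBy fun x y => x == y) (hR : Q.flatten <:+: R) :
    Q.length ≤ changes R + 1 := by
  have := length_le_changes hQ
  have := changes_le_of_infix hR
  omega

namespace IsLevels

variable {W : ℕ} {f : WindowFun W} {T : List α} {h t : ℕ} {shrink pow : ℕ → List ℕ}
  (H : IsLevels G f T h shrink pow)
include H

theorem eblock_flatten_length (ht : t < h) {Q : List (List ℕ)} (hQ : Q <:+: eblock f (pow t)) :
    Q.length * 2 ≤ Q.flatten.length := by
  have h1 : ∀ q ∈ Q, 2 ≤ q.length := by
    intro q hq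
    have h2 := hQ.subset hq
    obtain ⟨e, -, h3⟩ := exists_mem_of_forall₂ (H.shrink_sig t ht).flip h2
    exact (IsSigBlock.length h3).1
  have := List.length_flatten_ge h1
  omega

theorem covered_block (ht : t < h) {P E N n : ℕ} {cs : List ℕ} (hcs : cs ≠ [])
    (hc : G.IsCovered (pow t) P E cs N n) :
    ∃ N', N' * 2 ≤ N + 4 ∧ G.IsCovered (shrink (t + 1)) P E cs N' (n + 3 * N') :=
  hc.coarsen (x := 0) hcs (by omega) (flatten_eblock f _) (H.shrink_refines ht)
    (fun Q' R h1 h2 => by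
      have := H.eblock_flatten_length ht h1
      have := h2.length_le
      omega) (H.pow_flattens ht.le)

theorem covered_run (ht : t ≤ h) {P E N n : ℕ} {cs : List ℕ} (hcs : cs ≠ [])
    (hc : G.IsCovered (shrink t) P E cs N n) :
    ∃ N' ≤ N + 3, G.IsCovered (pow t) P E cs N' n := by
  obtain ⟨N', h1, h2⟩ := hc.coarsen (x := 1) (μ := 1) hcs (by omega) (List.flatten_splitBy _ _)
    (H.pow_refines ht)
    (fun Q' R h1 h2 => by
      have := length_le_of_flatten_infix h1 h2
      have := changes_le_length R
      omega) (H.shrink_flattens ht)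
  rw [Nat.zero_mul, Nat.add_zero] at h2
  exact ⟨N', by omega, h2⟩

theorem shrink_long (ht : t ≤ h) {ℓ : ℕ} (hl : ¬ 2 ^ t ≤ ℓ) : ∀ x ∈ shrink t,
    ℓ < (G.val x).length := fun x hx => by
  have := (H.two_pow_le ht).1 x hx
  omega

/-- The coarsening of a state from `Pow_t` to `Shrink_{t + 1}`. -/
theorem state_block (hf : IsLocallyConsistent f) (hW : ∀ e ∈ G.vars, e ≤ W) (ht : t < h)
    {S : Set (ℕ × ℕ)} {ℓ n : ℕ} (hS : S.Nonempty)
    (hs : G.IsState S ℓ (pow t) (deltaL W + 28) n) :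
    G.IsState S ℓ (shrink (t + 1)) (deltaL W + 22)
      (n + 3 * if 2 ^ (t + 1) ≤ ℓ then deltaL W + 22 else 2) := by
  -- The cost of a level: once its variables are longer than the window, at most two of them cover
  -- it, whatever bound the grouping yields.
  have hcov : ∀ {P E N n : ℕ} {cs : List ℕ}, G.wt cs = ℓ → N ≤ deltaL W + 22 →
      G.IsCovered (shrink (t + 1)) P E cs N (n + 3 * N) → ∃ N ≤ deltaL W + 22,
      G.IsCovered (shrink (t + 1)) P E cs N
        (n + 3 * if 2 ^ (t + 1) ≤ ℓ then deltaL W + 22 else 2) := by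
    intro P E N n cs hcs hN hc
    refine ⟨N, hN, hc.mono ?_⟩
    split_ifs with hl
    · omega
    · have := hc.le_two (by rw [hcs]; exact H.shrink_long ht hl)
      omega
  obtain ⟨p₀, hp₀⟩ := hS
  rcases hs with ⟨lam, gam, rho, h0, hwt, hs⟩ | ⟨cs, h0, hwt, hs⟩
  swap
  · refine .inr ⟨cs, h0, hwt, fun p hp => ?_⟩
    obtain ⟨N, hN, h1⟩ := hs p hp
    obtain ⟨N', hN', h2⟩ := H.covered_block ht h0 h1
    exact hcov hwt (by omega) h2
  obtain ⟨N₀, -, hc₀⟩ := hs p₀ hp₀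
  have hsub : ∀ x ∈ gam, G.Flattens x := fun x hx => H.pow_flattens ht.le x (hc₀.infix.subset hx)
  -- From the length `Δ_L + 12` on, the two cuts chosen below satisfy `k₁ ≤ Δ_L + 3 < gam.length - 8
  -- ≤ k₂`, so a nonempty core remains. A shorter core is dissolved: `2 * N' ≤ (Δ_L + 28) + (Δ_L +
  -- 11) + 4`.
  by_cases hlen : gam.length < deltaL W + 12
  · obtain ⟨gam', hg, hg'⟩ := exists_flatten hsub
    have h0' : gam' ≠ [] := by
      rintro rfl
      exact h0 (G.eq_nil_of_wt hg.mem_left (by rw [hg.wt_eq]; rfl))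
    have hwt' : G.wt (lam ++ (gam' ++ rho)) = ℓ := by simp [← hg.wt_eq]; omega
    refine .inr ⟨lam ++ (gam' ++ rho), by simp [h0'], hwt', fun p hp => ?_⟩
    obtain ⟨N, hN, h1⟩ := hs p hp
    obtain ⟨N', hN', h2⟩ := h1.coarsen_covered (x := gam.length) (μ := 2) hg hg' h0 (by omega)
      (flatten_eblock f _) (H.shrink_refines ht)
      (fun Q' A D h1 h2 => by
        have := H.eblock_flatten_length ht h1
        have := h2.length_le
        simp only [List.length_append] at this
        omega) (H.pow_flattens ht.le)
    exact hcov hwt' (by omega) h2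
  · have hcol : IsColored W gam := by
      have := H.colored ht.le hW
      exact ⟨fun x hx => this.1 x (hc₀.infix.subset hx), this.2.infix hc₀.infix⟩
    -- Density supplies a cut near each end of the core whose context lies inside the core. Between
    -- them all occurrences have the same blocks; at most `Δ_L + 3` variables are lost on the left
    -- and `8` on the right, so `2 * N' ≤ (Δ_L + 28) + (Δ_L + 3) + 8 + 4`.
    obtain ⟨k₁, hk₁, hk₁', hb₁⟩ : ∃ k₁, deltaL W ≤ k₁ ∧ k₁ ≤ deltaL W + 3 ∧
        parseBit f gam k₁ = true := by
      rcases hf.dense gam hcol (deltaL W) (by omega) with hb | hb | hb | hb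
      exacts [⟨_, by omega, by omega, hb⟩, ⟨_, by omega, by omega, hb⟩,
        ⟨_, by omega, by omega, hb⟩, ⟨_, by omega, by omega, hb⟩]
    obtain ⟨k₂, hk₂, hk₂', hb₂⟩ : ∃ k₂, gam.length - 8 ≤ k₂ ∧ k₂ ≤ gam.length - 5 ∧
        parseBit f gam k₂ = true := by
      rcases hf.dense gam hcol (gam.length - 8) (by omega) with hb | hb | hb | hb
      exacts [⟨_, by omega, by omega, hb⟩, ⟨_, by omega, by omega, hb⟩,
        ⟨_, by omega, by omega, hb⟩, ⟨_, by omega, by omega, hb⟩]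
    obtain ⟨gam₁, gam₂, gam₃, hgam, hl₁, hl₂⟩ : ∃ gam₁ gam₂ gam₃, gam = gam₁ ++ (gam₂ ++ gam₃) ∧
        gam₁.length = k₁ ∧ (gam₁ ++ gam₂).length = k₂ := by
      refine ⟨gam.take k₁, (gam.drop k₁).take (k₂ - k₁), (gam.drop k₁).drop (k₂ - k₁), ?_, ?_, ?_⟩
      · rw [List.take_append_drop, List.take_append_drop]
      · simp; omega
      · simp; omega
    have hlen₃ := congrArg List.length hgam
    simp only [List.length_append] at hlen₃ hl₂
    obtain ⟨gam₁', hg₁, hg₁'⟩ := exists_flatten (L := gam₁) fun x hx => hsub x (by simp [hgam, hx])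
    obtain ⟨gam₃', hg₃, hg₃'⟩ := exists_flatten (L := gam₃) fun x hx => hsub x (by simp [hgam, hx])
    have hQ := eblock_append f hgam (by omega) (by simp; omega) (by rw [hl₁]; exact hb₁)
      (by rw [List.length_append, hl₂]; exact hb₂)
    -- The signatures of the common blocks are taken from one occurrence; as signatures are unique,
    -- they serve for all.
    obtain ⟨c, hc⟩ : ∃ c, List.Forall₂ G.IsSigBlock (cuts (parseBit f gam) gam₁.length gam₂) c := by
      obtain ⟨X, Y, -, -, -, -, -, -, -, -, hXY, -⟩ := hc₀
      obtain ⟨Q₁, Q₃, h1, -⟩ := hQ X Y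
      have h2 := H.shrink_sig t ht
      rw [hXY, h1] at h2
      obtain ⟨-, L', -, -, h3⟩ := h2.append_left
      obtain ⟨c, -, -, h4, -⟩ := h3.append_left
      exact ⟨c, h4⟩
    have hcr := RefinesLE.of_forall₂ (hc.imp fun _ _ h => h.refines)
    rw [flatten_cuts] at hcr
    have hc0 : c ≠ [] := by
      rintro rfl
      have := hcr.eq_nil
      subst this
      simp at hl₂
      omega
    refine .inl ⟨lam ++ gam₁', c, gam₃' ++ rho, hc0, ?_, fun p hp => ?_⟩
    · rw [hgam] at hwt
      simp only [wt_append] at hwt ⊢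
      rw [hcr.wt_eq, ← hg₁.wt_eq, ← hg₃.wt_eq]
      omega
    · obtain ⟨N, hN, h1⟩ := hs p hp
      obtain ⟨N', hN', h2⟩ := h1.coarsen (μ := 2) (x := gam₁.length) (y := gam₃.length)
        (by omega) (fun X Y hXY => by rw [hXY]; exact hQ X Y) (H.shrink_sig t ht)
        (fun _ _ h => h.refines) (fun _ _ _ h h' => h.unique h') hc
        (fun Q' A h1 h2 => by
          have := H.eblock_flatten_length ht h1
          have := h2.length_le
          simp only [List.length_append] at this
          omega)
        (fun Q' A h1 h2 => by
          have := H.eblock_flatten_length ht h1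
          have := h2.length_le
          simp only [List.length_append] at this
          omega) (H.pow_flattens ht.le) hg₁ hg₁' hg₃ hg₃'
      refine ⟨N', by omega, h2.mono ?_⟩
      split_ifs with hl
      · omega
      · have h3 := h2.le_two (fun x hx => by
          have := H.shrink_long ht hl x hx
          rw [hgam] at hwt
          simp only [wt_append] at hwt ⊢
          rw [← hg₁.wt_eq, ← hg₃.wt_eq]
          omega) (H.shrink_mem ht)
        omega

/-- The coarsening of a state from `Shrink_t` to `Pow_t`. -/
theorem state_run (ht : t ≤ h) {S : Set (ℕ × ℕ)} {ℓ n : ℕ} (hS : S.Nonempty)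
    (hs : G.IsState S ℓ (shrink t) (deltaL W + 22) n) :
    G.IsState S ℓ (pow t) (deltaL W + 28) n := by
  obtain ⟨p₀, hp₀⟩ := hS
  rcases hs with ⟨lam, gam, rho, h0, hwt, hs⟩ | ⟨cs, h0, hwt, hs⟩
  swap
  · refine .inr ⟨cs, h0, hwt, fun p hp => ?_⟩
    obtain ⟨N, hN, h1⟩ := hs p hp
    obtain ⟨N', hN', h2⟩ := H.covered_run ht h0 h1
    exact ⟨N', by omega, h2⟩
  obtain ⟨N₀, -, hc₀⟩ := hs p₀ hp₀
  have hsub : ∀ x ∈ gam, x ∈ shrink t := fun x hx => hc₀.infix.subset hx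
  have hmem : ∀ x ∈ gam, x ∈ G.vars := fun x hx => H.shrink_mem ht x (hsub x hx)
  have hnr : ∀ x ∈ gam, G.NotRun x := fun x hx => H.shrink_notRun ht x (hsub x hx)
  have hfl := List.flatten_splitBy (fun x y => x == y) gam
  have hzero : ∀ {q}, q ∈ gam.splitBy (fun x y => x == y) → changes q = 0 := fun hq =>
    changes_eq_zero (List.isChain_of_mem_splitBy hq)
  -- The first and the last run of the core may extend beyond it, differently in different
  -- occurrences, so only the runs in between are common. With at most two runs nothing would
  -- remain, and the core is dissolved.
  by_cases hlen : changes gam ≤ 1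
  · refine .inr ⟨lam ++ (gam ++ rho), by simp [h0], by simp; omega, fun p hp => ?_⟩
    obtain ⟨N, hN, h1⟩ := hs p hp
    -- The `4` is made up of one change inside `gam`, one at either end of it, and the excess of the
    -- number of runs over the number of changes.
    obtain ⟨N', hN', h2⟩ := h1.coarsen_covered (x := 4) (μ := 1) (.refl hmem) hnr h0 (by omega)
      (List.flatten_splitBy _ _) (H.pow_refines ht)
      (fun Q' A D h1 h2 => by
        have h3 := length_le_of_flatten_infix h1 h2
        rw [changes_append, changes_append] at h3
        have := changeAt_le A (gam ++ D)
        have := changeAt_le gam D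
        have := changes_le_length A
        have := changes_le_length D
        omega) (H.shrink_flattens ht)
    rw [Nat.zero_mul, Nat.add_zero] at h2
    exact ⟨N', by omega, h2⟩
  · obtain ⟨q₁, Qm, q₂, hQ, hQm⟩ : ∃ q₁ Qm q₂,
        gam.splitBy (fun x y => x == y) = [q₁] ++ (Qm ++ [q₂]) ∧ Qm ≠ [] := by
      generalize hE : gam.splitBy (fun x y => x == y) = Q at hfl hzero
      rcases Q with _ | ⟨q₁, Q⟩
      · simp at hfl; simp [hfl] at h0
      rcases List.eq_nil_or_concat Q with rfl | ⟨Qm, q₂, rfl⟩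
      · simp at hfl
        subst hfl
        have := hzero (q := q₁) (by simp)
        omega
      refine ⟨q₁, Qm, q₂, by simp, ?_⟩
      rintro rfl
      simp at hfl
      rw [← hfl, changes_append, hzero (q := q₁) (by simp), hzero (q := q₂) (by simp)] at hlen
      have := changeAt_le q₁ q₂
      omega
    have hb₁ := List.splitBy_boundary hQ
    have hb₂ := List.splitBy_boundary (Q₁ := [q₁] ++ Qm) (Q₂ := [q₂]) (by rw [hQ]; simp)
    have hz₁ := hzero (q := q₁) (by simp [hQ])
    have hz₂ := hzero (q := q₂) (by simp [hQ])
    have hq₁0 : q₁ ≠ [] :=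
      List.ne_nil_of_mem_splitBy (r := fun x y => x == y) (l := gam) (by simp [hQ])
    have hq₂0 : q₂ ≠ [] :=
      List.ne_nil_of_mem_splitBy (r := fun x y => x == y) (l := gam) (by simp [hQ])
    have hsplit : (Qm.flatten).splitBy (fun x y => x == y) = Qm := by
      have h1 := List.nil_notMem_splitBy (fun x y => x == y) gam
      have h2 := List.isChain_getLast_head_splitBy (fun x y => x == y) gam
      have h3 : ∀ m ∈ Qm, m.IsChain fun x y => (x == y) = true := fun m hm =>
        List.isChain_of_mem_splitBy (l := gam) (by simp [hQ, hm])
      rw [hQ] at h1 h2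
      refine List.splitBy_flatten (by simp at h1; tauto) h3 ?_
      exact (List.isChain_append.1 (List.isChain_append.1 h2).2.1).1
    have hgam : gam = q₁ ++ (Qm.flatten ++ q₂) := by rw [← hfl, hQ]; simp
    have hblocks : ∀ X Y, shrink t = X ++ (gam ++ Y) → ∃ Q₁ Q₃,
        (shrink t).splitBy (fun x y => x == y) = Q₁ ++ (Qm ++ Q₃) ∧
        Q₁.flatten = X ++ q₁ ∧ Q₃.flatten = q₂ ++ Y := by
      intro X Y hXY
      have hm0 : Qm.flatten ≠ [] := by
        intro h0
        rw [h0] at hsplit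
        exact hQm hsplit.symm
      refine ⟨(X ++ q₁).splitBy fun x y => x == y, (q₂ ++ Y).splitBy fun x y => x == y, ?_, List.flatten_splitBy _ _,
        List.flatten_splitBy _ _⟩
      rw [hXY, hgam, show X ++ (q₁ ++ (Qm.flatten ++ q₂) ++ Y) =
        (X ++ q₁) ++ (Qm.flatten ++ (q₂ ++ Y)) by simp, List.splitBy_append (l := X ++ q₁),
        List.splitBy_append (l := Qm.flatten),
        hsplit]
      · intro x hx y hy
        refine hb₂ x ?_ y ?_
        · rwa [List.flatten_append, List.getLast?_append_of_ne_nil _ hm0]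
        · rw [List.head?_append_of_ne_nil _ hq₂0] at hy
          simpa using hy
      · intro x hx y hy
        refine hb₁ x ?_ y ?_
        · rw [List.getLast?_append_of_ne_nil _ hq₁0] at hx
          simpa using hx
        · rw [List.head?_append_of_ne_nil _ hm0] at hy
          rwa [List.flatten_append, List.head?_append_of_ne_nil _ hm0]
    obtain ⟨c, hc⟩ : ∃ c, List.Forall₂ (IsSigRun G) Qm c := by
      obtain ⟨X, Y, -, -, -, -, -, -, -, -, hXY, -⟩ := hc₀
      obtain ⟨Q₁, Q₃, h1, -⟩ := hblocks X Y hXY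
      have h2 := H.pow_blocks ht
      rw [h1] at h2
      obtain ⟨-, L', -, -, h3⟩ := h2.append_left
      obtain ⟨c, -, -, h4, -⟩ := h3.append_left
      exact ⟨c, h4⟩
    have hcr := RefinesLE.of_forall₂ (hc.imp fun _ _ h => h.refines)
    have hc0 : c ≠ [] := by
      rintro rfl
      cases hc
      exact hQm rfl
    have hq₁ : ∀ x ∈ q₁, x ∈ gam := fun x hx => by simp [hgam, hx]
    have hq₂ : ∀ x ∈ q₂, x ∈ gam := fun x hx => by simp [hgam, hx]
    refine .inl ⟨lam ++ q₁, c, q₂ ++ rho, hc0, ?_, fun p hp => ?_⟩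
    · rw [hgam] at hwt
      simp only [wt_append] at hwt ⊢
      rw [hcr.wt_eq]
      omega
    · obtain ⟨N, hN, h1⟩ := hs p hp
      -- The runs `q₁` and `q₂` contain no change, however long they are; only the boundary and the
      -- excess of runs over changes count, on either side.
      obtain ⟨N', hN', h2⟩ := h1.coarsen (μ := 1) (x := 2) (y := 2) (k := 0)
        (by omega) hblocks (H.pow_blocks ht)
        (fun _ _ h => IsSigRun.refines h) (fun _ _ _ h h' => IsSigRun.unique h h') hc
        (fun Q' A h1 h2 => by
          have h3 := length_le_of_flatten_infix h1 h2.isInfix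
          rw [changes_append] at h3
          have := changeAt_le A q₁
          have := changes_le_length A
          omega)
        (fun Q' A h1 h2 => by
          have h3 := length_le_of_flatten_infix h1 h2.isInfix
          rw [changes_append] at h3
          have := changeAt_le q₂ A
          have := changes_le_length A
          omega) (H.shrink_flattens ht) (.refl fun x hx => hmem x (hq₁ x hx))
        (fun x hx => hnr x (hq₁ x hx)) (.refl fun x hx => hmem x (hq₂ x hx))
        (fun x hx => hnr x (hq₂ x hx))
      rw [Nat.zero_mul, Nat.add_zero] at h2
      exact ⟨N', by omega, h2⟩

end IsLevels

end RunLengthACFG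

/-- The cost of the levels up to `t` for a window of length `ℓ`, where `b` bounds the number of
variables covering it. -/
def levelCost (b ℓ t : ℕ) : ℕ := 3 * b * min t (Nat.log 2 ℓ) + 6 * t

theorem levelCost_succ {b ℓ t : ℕ} (hl : ℓ ≠ 0) :
    levelCost b ℓ t + 3 * (if 2 ^ (t + 1) ≤ ℓ then b else 2) ≤ levelCost b ℓ (t + 1) := by
  unfold levelCost
  split_ifs with h
  · rw [← Nat.le_log_iff_pow_le (by omega) hl] at h
    rw [min_eq_left h, min_eq_left (by omega), Nat.mul_succ]
    omega
  · have : 3 * b * min t (Nat.log 2 ℓ) ≤ 3 * b * min (t + 1) (Nat.log 2 ℓ) :=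
      Nat.mul_le_mul_left _ (min_le_min_right _ (by omega))
    omega

theorem levelCost_le (b ℓ t : ℕ) : levelCost b ℓ t ≤ 3 * b * Nat.log 2 ℓ + 6 * t := by
  have := Nat.mul_le_mul_left (3 * b) (min_le_right t (Nat.log 2 ℓ))
  unfold levelCost
  omega

/-! ### Common sequences of equal substrings. -/

namespace RunLengthACFG

variable {α : Type*} {G : RunLengthACFG α}

theorem isLeftCover_self {X : List ℕ} (hX : ∀ x ∈ X, x ∈ G.vars) :
    G.IsLeftCover X (G.wt X) [] 0 X [] [] where
  eq := by simp
  refines := .refl (by simp)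
  wt_eq := by simp
  tight := by simp
  notRun := by simp
  mem := hX

theorem IsState.mono {S : Set (ℕ × ℕ)} {ℓ B n m : ℕ} {L : List ℕ} (h : G.IsState S ℓ L B n)
    (hm : n ≤ m) : G.IsState S ℓ L B m := by
  rcases h with ⟨lam, gam, rho, h0, h1, h2⟩ | ⟨cs, h0, h1, h2⟩
  · refine .inl ⟨lam, gam, rho, h0, h1, fun p hp => ?_⟩
    obtain ⟨N, hN, h3⟩ := h2 p hp
    exact ⟨N, hN, h3.mono hm⟩
  · refine .inr ⟨cs, h0, h1, fun p hp => ?_⟩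
    obtain ⟨N, hN, h3⟩ := h2 p hp
    exact ⟨N, hN, h3.mono hm⟩

variable (G) in
/-- By expanding at most `n` pairs, `e` becomes a sequence without runs in which `cs` occurs after
`k` characters. -/
def IsPart (n e k : ℕ) (cs : List ℕ) : Prop :=
  ∃ w z, G.RefinesLE n [e] (w ++ (cs ++ z)) ∧ G.wt w = k ∧ ∀ x ∈ w ++ (cs ++ z), G.NotRun x

theorem IsPart.mono {n m e k : ℕ} {cs : List ℕ} (h : G.IsPart n e k cs) (hm : n ≤ m) :
    G.IsPart m e k cs := by
  obtain ⟨w, z, h1, h2⟩ := h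
  exact ⟨w, z, h1.mono hm, h2⟩

/-- If the window lies in the part derived by `q`, a tight cover uses variables of `q` only, so the
cover can be reached from `e` by first opening `e` to `q`. -/
theorem IsCovered.isPart {L U q V cs : List ℕ} {P E N n m e : ℕ}
    (h : G.IsCovered L P E cs N n) (hcs : cs ≠ []) (hL : L = U ++ (q ++ V)) (hU : G.wt U ≤ P)
    (hV : G.wt V ≤ E) (hf : ∀ x ∈ L, G.Flattens x) (he : G.RefinesLE m [e] q) :
    G.IsPart (n + m) e (P - G.wt U) cs := by
  obtain ⟨Z, R, V', w, z, h, -⟩ := h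
  have hR0 : R ≠ [] := by
    rintro rfl
    have := h.refines.eq_nil
    simp [hcs] at this
  have heq := h.eq.symm.trans hL
  -- Were the first variable of `R` in `U`, the window would begin before the end of `U`, by
  -- tightness; but `U` derives at most `P` characters.
  obtain ⟨z₁, rfl, h1⟩ : ∃ z₁, Z = U ++ z₁ ∧ q ++ V = z₁ ++ (R ++ V') := by
    rcases List.append_eq_append_iff.1 heq with ⟨r, h1, h2⟩ | ⟨r, h1, h2⟩
    · rcases r with _ | ⟨x, r⟩
      · exact ⟨[], by simpa using h1.symm, by simpa using h2.symm⟩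
      · obtain ⟨x', R, rfl⟩ := List.exists_cons_of_ne_nil hR0
        simp only [List.cons_append, List.cons.injEq] at h2
        obtain ⟨rfl, -⟩ := h2
        have h3 := h.tight_left _ _ rfl
        have h4 := h.wt_left
        rw [h1, wt_append, wt_cons] at hU
        omega
    · exact ⟨r, h1, h2⟩
  rw [← List.append_assoc] at h1
  obtain ⟨v₁, rfl, rfl⟩ : ∃ v₁, V' = v₁ ++ V ∧ q = z₁ ++ R ++ v₁ := by
    rcases List.append_eq_append_iff.1 h1 with ⟨r, h1, h2⟩ | ⟨r, h1, h2⟩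
    · rcases List.eq_nil_or_concat r with rfl | ⟨r, x, rfl⟩
      · exact ⟨[], by simpa using h2.symm, by simpa using h1.symm⟩
      · obtain ⟨R, x', rfl⟩ := (List.eq_nil_or_concat R).resolve_left hR0
        have h5 := congrArg List.getLast? h1
        simp at h5
        subst h5
        have h3 := h.tight_right x' R (by simp)
        have h4 := h.wt_right
        rw [h2] at hV
        simp at hV
        omega
    · exact ⟨r, h2, h1⟩
  obtain ⟨zf, hz, hz'⟩ := exists_flatten (L := z₁) fun x hx => hf x (by simp [hL, hx])
  obtain ⟨vf, hv, hv'⟩ := exists_flatten (L := v₁) fun x hx => hf x (by simp [hL, hx])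
  refine ⟨zf ++ w, z ++ vf, ?_, ?_, ?_⟩
  · have := he.trans ((hz.append h.refines).append hv)
    simp only [List.append_assoc] at this ⊢
    exact this.mono (by omega)
  · have := h.wt_left
    rw [wt_append] at this ⊢
    rw [← hz.wt_eq]
    omega
  · intro x hx
    have := h.notRun x
    have := hz' x
    have := hv' x
    simp only [List.mem_append] at *
    tauto

/-- The covers lie outside the core, so `X` derives at least `P` and `Y` at least `E` characters.
Hence the core lies inside `q`. -/
theorem IsCore.length_le {L U q V lam gam rho : List ℕ} {P E N n : ℕ}
    (h : G.IsCore L P E lam gam rho N n) (hL : L = U ++ (q ++ V)) (hU : G.wt U ≤ P)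
    (hV : G.wt V ≤ E) (hm : ∀ x ∈ L, x ∈ G.vars) : gam.length ≤ q.length := by
  obtain ⟨X, Y, Z, A, w, V', D, z, n₁, n₂, hXY, h2, h3, -⟩ := h
  have hX : P ≤ G.wt X := by
    have h4 := h2.wt_eq
    have h5 := h2.refines.wt_eq
    rw [h2.eq]
    simp only [wt_append] at h5 ⊢
    omega
  have hY : E ≤ G.wt Y := by
    have h4 := h3.wt_eq
    have h5 := h3.refines.wt_eq
    rw [← G.mirror_wt fun x hx => hm x (by simp [hXY, hx]), h3.eq]
    simp only [wt_append] at h5 ⊢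
    omega
  have heq := hXY.symm.trans hL
  obtain ⟨x', rfl, h6⟩ := prefix_of_wt_le heq (fun x hx => hm x (by simp [hL, hx])) (by omega)
  have hwt := congrArg G.wt h6
  rw [← List.append_assoc] at h6
  simp only [wt_append] at hwt
  obtain ⟨q', rfl, -⟩ := prefix_of_wt_le h6 (fun x hx => hm x (by
    simp only [List.mem_append] at hx
    rcases hx with hx | hx <;> simp [hXY, hx])) (by rw [wt_append]; omega)
  simp; omega

/-- A variable which derives one character and is no run is the signature of this character. -/
theorem isSig_char_of_length {e : ℕ} {a : α} (he : e ∈ G.vars) (hn : G.NotRun e)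
    (hv : G.val e = [a]) : G.IsSig (.char a) e := by
  rcases hr : G.rhs e with b | ⟨l, r⟩ | ⟨x, d⟩
  · rw [G.val_char hr] at hv
    cases hv
    exact ⟨he, hr⟩
  · have := length_val_pair he hr
    simp [hv] at this
  · exact absurd hr (hn x d)

namespace IsLevels

variable {W : ℕ} {f : WindowFun W} {T : List α} {h t : ℕ} {shrink pow : ℕ → List ℕ}
  (H : IsLevels G f T h shrink pow)
include H

/-- At the bottom the whole window is the core, as equal characters have equal signatures, and
nothing has to be covered outside it. -/
theorem state_base {S : Set (ℕ × ℕ)} {s : List α} (hs : s ≠ []) (hS : S.Nonempty)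
    (hw : ∀ p ∈ S, ∃ T₁ T₂, T = T₁ ++ (s ++ T₂) ∧ T₁.length = p.1 ∧ T₂.length = p.2) (B : ℕ) :
    G.IsState S s.length (shrink 0) B 0 := by
  obtain ⟨p₀, hp₀⟩ := hS
  have key : ∀ p ∈ S, ∃ X c Y, shrink 0 = X ++ (c ++ Y) ∧ G.wt X = p.1 ∧ G.wt Y = p.2 ∧
      List.Forall₂ (fun a e => G.IsSig (.char a) e) s c := by
    intro p hp
    obtain ⟨T₁, T₂, hT, h1, h2⟩ := hw p hp
    have hb := H.base
    rw [hT] at hb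
    obtain ⟨X, L, h3, h4, h5⟩ := hb.append_left
    obtain ⟨c, Y, rfl, h6, h7⟩ := h5.append_left
    exact ⟨X, c, Y, h3, by rw [wt, word_of_forall₂ h4, h1], by rw [wt, word_of_forall₂ h7, h2], h6⟩
  obtain ⟨-, c, -, -, -, -, hc⟩ := key p₀ hp₀
  refine .inl ⟨[], c, [], ?_, ?_, fun p hp => ?_⟩
  · rintro rfl
    cases hc
    exact hs rfl
  · simp [wt, word_of_forall₂ hc]
  · obtain ⟨X, c', Y, h1, h2, h3, hc'⟩ := key p hp
    obtain rfl := forall₂_unique (r := fun a e => G.IsSig (.char a) e)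
      (fun _ _ _ h h' => IsSig.unique h h') hc hc'
    have hm : ∀ x ∈ shrink 0, x ∈ G.vars := H.shrink_mem (Nat.zero_le _)
    rw [h1] at hm
    have hY : ∀ x ∈ Y, x ∈ G.vars := fun x hx => hm x (by simp [hx])
    refine ⟨0, Nat.zero_le _, X, Y, X, [], [], Y, [], [], 0, 0, h1, ?_, ?_, rfl, le_rfl⟩
    · rw [← h2]
      exact isLeftCover_self fun x hx => hm x (by simp [hx])
    · rw [← h3, ← G.mirror_wt hY]
      exact isLeftCover_self fun x hx => hY x (by simpa using hx)

theorem state_pow (hf : IsLocallyConsistent f) (hW : ∀ e ∈ G.vars, e ≤ W)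
    {S : Set (ℕ × ℕ)} {s : List α} (hs : s ≠ []) (hS : S.Nonempty)
    (hw : ∀ p ∈ S, ∃ T₁ T₂, T = T₁ ++ (s ++ T₂) ∧ T₁.length = p.1 ∧ T₂.length = p.2)
    (ht : t ≤ h) :
    G.IsState S s.length (pow t) (deltaL W + 28) (levelCost (deltaL W + 22) s.length t) := by
  induction t with
  | zero => exact (H.state_run ht hS (H.state_base hs hS hw _)).mono (Nat.zero_le _)
  | succ t ih =>
    exact (H.state_run ht hS (H.state_block hf hW ht hS (ih (by omega)))).mono
      (levelCost_succ (by simpa using hs))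

/-- A frozen window is carried upwards. The bound `Δ_L + 32` reproduces itself: blocks give at most
`(Δ_L + 36) / 2` variables, runs add three. -/
theorem covered_levels {t' P E N ℓ : ℕ} {cs : List ℕ} (htt' : t ≤ t') (ht : t' ≤ h)
    (hcs : cs ≠ []) (hl : G.wt cs = ℓ) (hN : N ≤ deltaL W + 32)
    (hc : G.IsCovered (pow t) P E cs N (levelCost (deltaL W + 22) ℓ t)) :
    ∃ N' ≤ deltaL W + 32,
      G.IsCovered (pow t') P E cs N' (levelCost (deltaL W + 22) ℓ t') := by
  induction t', htt' using Nat.le_induction with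
  | base => exact ⟨N, hN, hc⟩
  | succ t' _ ih =>
    obtain ⟨N₁, hN₁, h1⟩ := ih (by omega)
    obtain ⟨N₂, hN₂, h2⟩ := H.covered_block ht hcs h1
    have h3 : N₂ ≤ if 2 ^ (t' + 1) ≤ ℓ then deltaL W + 22 else 2 := by
      split_ifs with h3
      · omega
      · exact h2.le_two (by rw [hl]; exact H.shrink_long ht h3)
    obtain ⟨N₃, hN₃, h4⟩ := H.covered_run ht hcs h2
    have hl0 : ℓ ≠ 0 := by
      rintro rfl
      obtain ⟨Z, R, V, w, z, h5, -⟩ := h1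
      exact hcs (G.eq_nil_of_wt (fun x hx => h5.refines.mem_right x (by simp [hx])) hl)
    have := levelCost_succ (b := deltaL W + 22) (t := t') hl0
    exact ⟨N₃, by omega, h4.mono (by omega)⟩

/-- Equal substrings of two variables whose occurrences are given have a common sequence. -/
theorem exists_isPart_of_segment (hf : IsLocallyConsistent f) (hW : ∀ e ∈ G.vars, e ≤ W)
    {s a₁ b₁ a₂ b₂ : List α} (hs : s ≠ []) {e₁ e₂ t₁ t₂ : ℕ} {U₁ q₁ V₁ U₂ q₂ V₂ : List ℕ}
    (h₁ : G.val e₁ = a₁ ++ (s ++ b₁)) (h₂ : G.val e₂ = a₂ ++ (s ++ b₂))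
    (htt : t₁ ≤ t₂) (ht : t₂ ≤ h) (hp₁ : pow t₁ = U₁ ++ (q₁ ++ V₁))
    (hp₂ : pow t₂ = U₂ ++ (q₂ ++ V₂)) (hq₁ : q₁.length ≤ 4)
    (hr₁ : G.RefinesLE 3 [e₁] q₁) (hr₂ : G.RefinesLE 3 [e₂] q₂) :
    ∃ cs, G.wt cs = s.length ∧
      G.IsPart (levelCost (deltaL W + 22) s.length t₁ + 3) e₁ a₁.length cs ∧
      G.IsPart (levelCost (deltaL W + 22) s.length t₂ + 3) e₂ a₂.length cs := by
  have hw₁ := (H.word_shrink_pow (htt.trans ht)).2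
  have hw₂ := (H.word_shrink_pow ht).2
  have hv₁ := hr₁.word_eq
  have hv₂ := hr₂.word_eq
  rw [word_cons, word_nil, List.append_nil] at hv₁ hv₂
  rw [hp₁, word_append, word_append, ← hv₁, h₁] at hw₁
  rw [hp₂, word_append, word_append, ← hv₂, h₂] at hw₂
  have hfl₁ := H.pow_flattens (htt.trans ht)
  -- Both occurrences of `s` are located in `T`: one inside the segment for `e₁`, the other inside
  -- the segment for `e₂`.
  have hst := H.state_pow hf hW (t := t₁) hs
    (S := {(G.wt U₁ + a₁.length, b₁.length + G.wt V₁), (G.wt U₂ + a₂.length, b₂.length + G.wt V₂)})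
    (by simp) (by
      rintro p (rfl | rfl)
      · exact ⟨G.word U₁ ++ a₁, b₁ ++ G.word V₁, by simp [← hw₁], by simp [wt], by simp [wt]⟩
      · exact ⟨G.word U₂ ++ a₂, b₂ ++ G.word V₂, by simp [← hw₂], by simp [wt], by simp [wt]⟩)
    (htt.trans ht)
  obtain ⟨cs, h0, hwt, N₁, N₂, hN₂, hc₁, hc₂⟩ : ∃ cs, cs ≠ [] ∧ G.wt cs = s.length ∧ ∃ N₁ N₂,
      N₂ ≤ deltaL W + 32 ∧
      G.IsCovered (pow t₁) (G.wt U₁ + a₁.length) (b₁.length + G.wt V₁) cs N₁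
        (levelCost (deltaL W + 22) s.length t₁) ∧
      G.IsCovered (pow t₁) (G.wt U₂ + a₂.length) (b₂.length + G.wt V₂) cs N₂
        (levelCost (deltaL W + 22) s.length t₁) := by
    rcases hst with ⟨lam, gam, rho, h0, hwt, hst⟩ | ⟨cs, h0, hwt, hst⟩
    · obtain ⟨N₁, hN₁, hc₁⟩ := hst _ (.inl rfl)
      obtain ⟨N₂, hN₂, hc₂⟩ := hst _ (.inr rfl)
      obtain ⟨gam', hg, hg'⟩ := exists_flatten fun x hx => hfl₁ x (hc₁.infix.subset hx)
      -- On the level of `e₁` the core lies inside `q₁`, so it has at most four variables. It can be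
      -- frozen for both occurrences, raising the bound from `Δ_L + 28` to `Δ_L + 32`.
      have hlen := hc₁.length_le hp₁ (by simp) (by simp) (H.pow_mem (htt.trans ht))
      refine ⟨lam ++ (gam' ++ rho), ?_, ?_, _, _, ?_, hc₁.covered hg hg' h0,
        hc₂.covered hg hg' h0⟩
      · have : gam' ≠ [] := by
          rintro rfl
          exact h0 (G.eq_nil_of_wt hg.mem_left (by rw [hg.wt_eq]; rfl))
        simp [this]
      · simp only [wt_append, ← hg.wt_eq]; omega
      · omega
    · obtain ⟨N₁, hN₁, hc₁⟩ := hst _ (.inl rfl)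
      obtain ⟨N₂, hN₂, hc₂⟩ := hst _ (.inr rfl)
      exact ⟨cs, h0, hwt, N₁, N₂, by omega, hc₁, hc₂⟩
  obtain ⟨N₂', -, hc₂⟩ := H.covered_levels htt ht h0 hwt hN₂ hc₂
  refine ⟨cs, hwt, ?_, ?_⟩
  · simpa using hc₁.isPart h0 hp₁ (by simp) (by simp) hfl₁ hr₁
  · simpa using hc₂.isPart h0 hp₂ (by simp) (by simp) (H.pow_flattens ht) hr₂

theorem isPart_nil {e k : ℕ} (he : e ∈ G.vars) (hk : k ≤ (G.val e).length) :
    G.IsPart (3 * Nat.log 2 (G.val e).length + 3) e k [] := by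
  rcases hk.lt_or_eq with hk | rfl
  · obtain ⟨w, a, z, h1, -, h2, h3⟩ := H.reachable he k (by simpa using hk)
    exact ⟨w, a :: z, h1, h2, h3⟩
  · obtain ⟨u, h1, h2⟩ := H.flattens he
    exact ⟨u, [], by simpa using h1.mono (by omega), by simpa using h1.wt_eq.symm, by simpa using h2⟩

theorem isPart_singleton {e : ℕ} {a b : List α} {x : α} (he : e ∈ G.vars)
    (hv : G.val e = a ++ x :: b) : ∃ c, G.IsSig (.char x) c ∧
      G.IsPart (3 * Nat.log 2 (G.val e).length + 3) e a.length [c] := by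
  obtain ⟨w, c, z, h1, h2, h3, h4⟩ := H.reachable he a.length (by simp [hv])
  refine ⟨c, isSig_char_of_length (h1.mem_right c (by simp)) (h4 c (by simp)) ?_, w, z,
    h1, h3, h4⟩
  have h5 := h1.word_eq
  rw [word_cons, word_nil, List.append_nil, hv, word_append, word_cons] at h5
  obtain ⟨-, h5⟩ := List.append_inj h5 h3.symm
  obtain ⟨y, hy⟩ := List.length_eq_one_iff.1 h2
  rw [hy] at h5 ⊢
  simp at h5
  rw [h5.1]

/-- Equal substrings of two variables have a common sequence. -/
theorem exists_isPart (hf : IsLocallyConsistent f) (hW : ∀ e ∈ G.vars, e ≤ W)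
    {s a₁ b₁ a₂ b₂ : List α} {e₁ e₂ : ℕ} (he₁ : e₁ ∈ G.vars) (he₂ : e₂ ∈ G.vars)
    (h₁ : G.val e₁ = a₁ ++ (s ++ b₁)) (h₂ : G.val e₂ = a₂ ++ (s ++ b₂)) :
    ∃ cs, G.wt cs = s.length ∧
      G.IsPart (3 * (deltaL W + 22) * Nat.log 2 s.length + 6 * Nat.log 2 (G.val e₁).length + 3)
        e₁ a₁.length cs ∧
      G.IsPart (3 * (deltaL W + 22) * Nat.log 2 s.length + 6 * Nat.log 2 (G.val e₂).length + 3)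
        e₂ a₂.length cs := by
  -- Substrings of length at most one may lie in variables assigned a character, which
  -- `exists_pow_segment` does not cover; they are reached directly.
  rcases s with _ | ⟨x, s⟩
  · exact ⟨[], rfl, (H.isPart_nil he₁ (by simp [h₁])).mono (by omega),
      (H.isPart_nil he₂ (by simp [h₂])).mono (by omega)⟩
  rcases s with _ | ⟨y, s⟩
  · obtain ⟨c, h3, h4⟩ := H.isPart_singleton he₁ h₁
    obtain ⟨c', h5, h6⟩ := H.isPart_singleton he₂ h₂
    obtain rfl := h3.unique h5
    exact ⟨[c], by simp [G.val_char h3.2], h4.mono (by omega), h6.mono (by omega)⟩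
  have key : ∀ {e : ℕ} {a b : List α}, G.val e = a ++ (x :: y :: s ++ b) →
      ¬ ∃ a, G.IsSig (.char a) e := by
    rintro e a b hv ⟨c, hc⟩
    rw [G.val_char hc.2] at hv
    have := congrArg List.length hv
    simp at this
    omega
  obtain ⟨t₁, ht₁, U₁, q₁, V₁, hp₁, hq₁, hr₁, hl₁⟩ := H.exists_pow_segment he₁ (key h₁)
  obtain ⟨t₂, ht₂, U₂, q₂, V₂, hp₂, hq₂, hr₂, hl₂⟩ := H.exists_pow_segment he₂ (key h₂)
  have hlog₁ := Nat.le_log_of_pow_le (by omega) hl₁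
  have hlog₂ := Nat.le_log_of_pow_le (by omega) hl₂
  generalize hs : x :: y :: s = s' at *
  have hs' : s' ≠ [] := by rintro rfl; simp at hs
  have hc₁ := levelCost_le (deltaL W + 22) s'.length t₁
  have hc₂ := levelCost_le (deltaL W + 22) s'.length t₂
  -- The core is followed up to the lower of the two levels, whichever variable lives there.
  rcases le_total t₁ t₂ with htt | htt
  · obtain ⟨cs, h3, h4, h5⟩ := H.exists_isPart_of_segment hf hW hs' h₁ h₂ htt ht₂ hp₁ hp₂ hq₁
      hr₁ hr₂
    exact ⟨cs, h3, h4.mono (by omega), h5.mono (by omega)⟩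
  · obtain ⟨cs, h3, h4, h5⟩ := H.exists_isPart_of_segment hf hW hs' h₂ h₁ htt ht₁ hp₂ hp₁ hq₂
      hr₂ hr₁
    exact ⟨cs, h3, h5.mono (by omega), h4.mono (by omega)⟩

end IsLevels

end RunLengthACFG

/-! ### The iterated logarithm -/

theorem logStar_of_le_one {n : ℕ} (h : n ≤ 1) : logStar n = 0 := by
  rw [logStar, dif_pos h]

theorem logStar_of_one_lt {n : ℕ} (h : 1 < n) : logStar n = logStar (Nat.clog 2 n) + 1 := by
  rw [logStar, dif_neg (by omega)]

theorem Nat.clog_two_lt {n : ℕ} (h : 1 < n) : Nat.clog 2 n < n := by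
  obtain ⟨m, rfl⟩ : ∃ m, n = m + 1 := ⟨n - 1, by omega⟩
  have h2 : m < 2 ^ m := Nat.lt_two_pow_self
  have : Nat.clog 2 (m + 1) ≤ m := Nat.clog_le_of_le_pow (by omega)
  omega

theorem logStar_mono {m n : ℕ} (h : m ≤ n) : logStar m ≤ logStar n := by
  induction n using Nat.strong_induction_on generalizing m with
  | _ n ih =>
    rcases Nat.lt_or_ge 1 m with hm | hm
    · rw [logStar_of_one_lt hm, logStar_of_one_lt (n := n) (by omega)]
      have := ih _ (Nat.clog_two_lt (by omega)) (Nat.clog_mono_right 2 h)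
      omega
    · rw [logStar_of_le_one hm]; omega

/-- A factor of two passes through the recursion unchanged, because `Nat.clog 2 (2 * n) ≤ 2 *
Nat.clog 2 n` for `1 < n`. -/
theorem logStar_two_mul (n : ℕ) : logStar (2 * n) ≤ logStar n + 1 := by
  induction n using Nat.strong_induction_on with
  | _ n ih =>
    rcases Nat.lt_or_ge 1 n with hn | hn
    · have h1 : Nat.clog 2 (2 * n) ≤ 2 * Nat.clog 2 n := by
        have h2 : 0 < Nat.clog 2 n := Nat.clog_pos (by omega) (by omega)
        refine Nat.clog_le_of_le_pow ?_
        calc 2 * n ≤ 2 ^ 1 * 2 ^ Nat.clog 2 n :=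
              Nat.mul_le_mul_left 2 (Nat.le_pow_clog (by omega) n)
          _ = 2 ^ (1 + Nat.clog 2 n) := (pow_add _ _ _).symm
          _ ≤ 2 ^ (2 * Nat.clog 2 n) := Nat.pow_le_pow_right (by omega) (by omega)
      rw [logStar_of_one_lt hn, logStar_of_one_lt (by omega)]
      have := ih _ (Nat.clog_two_lt hn)
      have := logStar_mono h1
      omega
    · have h1 : logStar (2 * n) ≤ logStar 2 := logStar_mono (by omega)
      have h2 : logStar 2 = 1 := by
        rw [logStar_of_one_lt (by omega), logStar_of_le_one (by simp [Nat.clog_of_one_lt])]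
      omega

theorem logStar_two_pow_mul (k n : ℕ) : logStar (2 ^ k * n) ≤ logStar n + k := by
  induction k with
  | zero => simp
  | succ k ih =>
    have := logStar_two_mul (2 ^ k * n)
    rw [← Nat.mul_assoc, ← pow_succ'] at this
    omega

theorem logStar_le_add_clog {K M W : ℕ} (h : W ≤ K * M) :
    logStar W ≤ logStar M + Nat.clog 2 K :=
  (logStar_mono (h.trans (Nat.mul_le_mul_right M (Nat.le_pow_clog (by omega) K)))).trans
    (logStar_two_pow_mul _ _)

/-! ### Longest common prefixes -/

theorem exists_of_lcp {α : Type*} [DecidableEq α] (u v : List α) : ∃ s u' v',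
    u = s ++ u' ∧ v = s ++ v' ∧ s.length = lcp u v ∧
    ∀ a x y, u' = a :: x → v' = a :: y → False := by
  induction u generalizing v with
  | nil => exact ⟨[], [], v, by simp [lcp]⟩
  | cons a u ih =>
    rcases v with _ | ⟨b, v⟩
    · exact ⟨[], a :: u, [], by simp [lcp]⟩
    · by_cases hab : a = b
      · obtain ⟨s, u', v', rfl, rfl, h1, h2⟩ := ih v
        exact ⟨a :: s, u', v', rfl, by simp [hab], by simp [lcp, hab, h1], h2⟩
      · refine ⟨[], a :: u, b :: v, rfl, rfl, by simp [lcp, hab], ?_⟩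
        rintro c x y h1 h2
        simp only [List.cons.injEq] at h1 h2
        exact hab (h1.1.trans h2.1.symm)

/-! ### From common sequences to certificates. -/

namespace RunLengthACFG

variable {α : Type*} {G : RunLengthACFG α}

theorem Reachable.mirror {n e : ℕ} (h : G.Reachable n [e]) (he : e ∈ G.vars) :
    G.mirror.Reachable n [e] := by
  intro p hp
  simp only [wt_cons, wt_nil, Nat.add_zero, G.mirror_length_val he] at hp
  obtain ⟨w, a, z, h1, h2, h3, h4⟩ := h ((G.val e).length - 1 - p) (by simp; omega)
  have h5 := h1.wt_eq
  simp only [wt_cons, wt_nil, wt_append] at h5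
  refine ⟨z.reverse, a, w.reverse, by simpa using h1.mirror, ?_, ?_, fun x hx => ?_⟩
  · rw [G.mirror_length_val (h1.mem_right a (by simp)), h2]
  · rw [G.mirror_wt fun x hx => h1.mem_right x (by simp [hx])]
    omega
  · refine G.mirror_notRun.2 (h4 x ?_)
    simp only [List.mem_append, List.mem_reverse, List.mem_cons] at hx ⊢
    tauto

theorem IsPart.mirror {n e : ℕ} {cs : List ℕ} {a s b : List α} (h : G.IsPart n e a.length cs)
    (hv : G.val e = a ++ (s ++ b)) (hs : G.wt cs = s.length) :
    G.mirror.IsPart n e b.length cs.reverse := by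
  obtain ⟨w, z, h1, h2, h3⟩ := h
  have h4 := h1.wt_eq
  simp only [wt_cons, wt_nil, wt_append, hv, List.length_append] at h4
  refine ⟨z.reverse, w.reverse, by simpa using h1.mirror, ?_, fun x hx => ?_⟩
  · rw [G.mirror_wt fun x hx => h1.mem_right x (by simp [hx])]
    omega
  · refine G.mirror_notRun.2 (h3 x ?_)
    simp only [List.mem_append, List.mem_reverse] at hx ⊢
    tauto

/-- Only the first variable after the common sequence has to be opened further, down to its first
character, so that a mismatch is visible there. -/
theorem IsPart.halfCert {n e : ℕ} {cs : List ℕ} {a s b : List α} (h : G.IsPart n e a.length cs)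
    (hv : G.val e = a ++ (s ++ b)) (hs : G.wt cs = s.length)
    (hr : ∀ e ∈ G.vars, G.Reachable (3 * Nat.log 2 (G.val e).length + 3) [e]) :
    ∃ m ≤ n + (3 * Nat.log 2 (G.val e).length + 3), ∃ z, G.HalfCert m a.length [e] cs z ∧
      G.word z = b := by
  obtain ⟨w, z, h1, h2, h3⟩ := h
  have hw := h1.word_eq
  rw [word_cons, word_nil, List.append_nil, hv, word_append, word_append] at hw
  have hz : G.word z = b :=
    (List.append_inj (List.append_inj hw h2.symm).2 hs.symm).2.symm
  rcases z with _ | ⟨x, z⟩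
  · obtain ⟨m, hm, h1⟩ := h1
    exact ⟨m, by omega, [], ⟨w, h1, h2, h3, by simp⟩, hz⟩
  · have hx := h1.mem_right x (by simp)
    obtain ⟨w', c, z', h4, h5, h6, h7⟩ := hr x hx 0 (by simpa using G.length_val_pos hx)
    obtain rfl : w' = [] := G.eq_nil_of_wt (fun y hy => h4.mem_right y (by simp [hy])) h6
    have hxe : (G.val x).length ≤ (G.val e).length := by
      have := h1.wt_eq
      simp only [wt_cons, wt_nil, wt_append] at this
      omega
    have hlog := Nat.log_mono_right (b := 2) hxe
    have h8 : G.RefinesLE (3 * Nat.log 2 (G.val x).length + 3) (w ++ (cs ++ (x :: z)))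
        (w ++ (cs ++ (c :: z' ++ z))) := by
      have h9 : G.RefinesLE 0 (w ++ cs) (w ++ cs) :=
        .refl fun y hy => h1.mem_right y (by
          rw [← List.append_assoc]; exact List.mem_append_left _ hy)
      have h10 : G.RefinesLE 0 z z := .refl fun y hy => h1.mem_right y (by simp [hy])
      have := h9.append (h4.append h10)
      simpa using this
    obtain ⟨m, hm, h9⟩ := h1.trans h8
    refine ⟨m, by omega, c :: z' ++ z, ⟨w, h9, h2, fun y hy => ?_, ?_⟩, ?_⟩
    · have := h3 y
      have := h7 y
      simp only [List.mem_append, List.mem_cons, List.nil_append] at *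
      tauto
    · rintro y z'' hy
      simp only [List.cons_append, List.cons.injEq] at hy
      rw [← hy.1]
      exact h5
    · have h11 := h4.word_eq
      simp only [word_cons, word_nil, List.append_nil, List.nil_append] at h11
      simp [← hz, h11]

theorem Cert.mono {n m k₁ k₂ r : ℕ} {F₁ F₂ : List ℕ} (h : G.Cert n k₁ F₁ k₂ F₂ r)
    (hm : n ≤ m) : G.Cert m k₁ F₁ k₂ F₂ r := by
  obtain ⟨n₁, n₂, c, z₁, z₂, h1, h2⟩ := h
  exact ⟨n₁, n₂, c, z₁, z₂, h1.trans hm, h2⟩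

theorem exists_cert {n₁ n₂ e₁ e₂ : ℕ} {cs : List ℕ} {a₁ a₂ s b₁ b₂ : List α}
    (h₁ : G.IsPart n₁ e₁ a₁.length cs) (h₂ : G.IsPart n₂ e₂ a₂.length cs)
    (hv₁ : G.val e₁ = a₁ ++ (s ++ b₁)) (hv₂ : G.val e₂ = a₂ ++ (s ++ b₂))
    (hs : G.wt cs = s.length)
    (hr : ∀ e ∈ G.vars, G.Reachable (3 * Nat.log 2 (G.val e).length + 3) [e])
    (hb : ∀ a x y, b₁ = a :: x → b₂ = a :: y → False) :
    G.Cert (n₁ + n₂ + 3 * Nat.log 2 (G.val e₁).length + 3 * Nat.log 2 (G.val e₂).length + 6)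
      a₁.length [e₁] a₂.length [e₂] s.length := by
  obtain ⟨m₁, hm₁, z₁, hc₁, hz₁⟩ := h₁.halfCert hv₁ hs hr
  obtain ⟨m₂, hm₂, z₂, hc₂, hz₂⟩ := h₂.halfCert hv₂ hs hr
  refine ⟨m₁, m₂, cs, z₁, z₂, by omega, hc₁, hc₂, hs, ?_⟩
  rw [hz₁, hz₂]
  exact hb

end RunLengthACFG

/-! ### Certificates for forward and backward queries. -/

namespace RunLengthACFG

variable {α : Type*} {G : RunLengthACFG α}

theorem IsSignatureEncoding.exists_isLevels {W : ℕ} {f : WindowFun W} {T : List α}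
    (h : G.IsSignatureEncoding f T) : ∃ h shrink pow, G.IsLevels f T h shrink pow := by
  obtain ⟨h, shrink, pow, h1, h2, h3, -, h4⟩ := h
  exact ⟨h, shrink, pow, h1, h2, h3, h4⟩

namespace IsLevels

variable {W : ℕ} {f : WindowFun W} {T : List α} {h : ℕ} {shrink pow : ℕ → List ℕ}
  (H : IsLevels G f T h shrink pow)
include H

/-- A forward query has a certificate. -/
theorem exists_cert_lce [DecidableEq α] (hf : IsLocallyConsistent f) (hW : ∀ e ∈ G.vars, e ≤ W)
    {e₁ e₂ i j : ℕ} (he₁ : e₁ ∈ G.vars) (he₂ : e₂ ∈ G.vars) (hi : i ≤ (G.val e₁).length)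
    (hj : j ≤ (G.val e₂).length) :
    G.Cert (6 * (deltaL W + 22) * Nat.log 2 (LCE (G.val e₁) (G.val e₂) i j) +
      9 * Nat.log 2 (G.val e₁).length + 9 * Nat.log 2 (G.val e₂).length + 12)
      (i - 1) [e₁] (j - 1) [e₂] (LCE (G.val e₁) (G.val e₂) i j) := by
  obtain ⟨s, b₁, b₂, h1, h2, h3, h4⟩ :=
    exists_of_lcp ((G.val e₁).drop (i - 1)) ((G.val e₂).drop (j - 1))
  have hv₁ := List.take_append_drop (i - 1) (G.val e₁)
  have hv₂ := List.take_append_drop (j - 1) (G.val e₂)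
  rw [h1] at hv₁
  rw [h2] at hv₂
  obtain ⟨cs, h5, h6, h7⟩ := H.exists_isPart hf hW he₁ he₂ hv₁.symm hv₂.symm
  have := exists_cert h6 h7 hv₁.symm hv₂.symm h5 (fun e he => H.reachable he) h4
  rw [List.length_take_of_le (by omega), List.length_take_of_le (by omega), h3] at this
  change G.Cert _ _ _ _ _ (LCE (G.val e₁) (G.val e₂) i j) at this
  refine this.mono ?_
  rw [show 6 * (deltaL W + 22) = 3 * (deltaL W + 22) + 3 * (deltaL W + 22) by ring, Nat.add_mul]
  unfold LCE
  omega

/-- A backward query has a certificate in the mirror image of the grammar. -/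
theorem exists_cert_lce_reverse [DecidableEq α] (hf : IsLocallyConsistent f)
    (hW : ∀ e ∈ G.vars, e ≤ W)
    {e₁ e₂ i j : ℕ} (he₁ : e₁ ∈ G.vars) (he₂ : e₂ ∈ G.vars) (hi : i ≤ (G.val e₁).length)
    (hj : j ≤ (G.val e₂).length) :
    G.mirror.Cert (6 * (deltaL W + 22) *
        Nat.log 2 (LCE (G.val e₁).reverse (G.val e₂).reverse i j) +
      9 * Nat.log 2 (G.val e₁).length + 9 * Nat.log 2 (G.val e₂).length + 12)
      (i - 1) [e₁] (j - 1) [e₂] (LCE (G.val e₁).reverse (G.val e₂).reverse i j) := by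
  obtain ⟨s, b₁, b₂, h1, h2, h3, h4⟩ :=
    exists_of_lcp ((G.val e₁).reverse.drop (i - 1)) ((G.val e₂).reverse.drop (j - 1))
  have hv₁ := List.take_append_drop (i - 1) (G.val e₁).reverse
  have hv₂ := List.take_append_drop (j - 1) (G.val e₂).reverse
  rw [h1] at hv₁
  rw [h2] at hv₂
  have hr : ∀ {v a s b : List α}, a ++ (s ++ b) = v.reverse →
      v = b.reverse ++ (s.reverse ++ a.reverse) := by
    intro v a s b h
    rw [← List.reverse_reverse v, ← h]
    simp
  -- The common sequence is found in `G` and mirrored afterwards: the parsing is not symmetric, so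
  -- the mirror grammar cannot be treated as a signature encoding.
  obtain ⟨cs, h5, h6, h7⟩ := H.exists_isPart hf hW he₁ he₂ (hr hv₁) (hr hv₂)
  have h8 := h6.mirror (hr hv₁) h5
  have h9 := h7.mirror (hr hv₂) h5
  have hm : ∀ x ∈ cs, x ∈ G.vars := by
    obtain ⟨w, z, h10, -⟩ := h6
    exact fun x hx => h10.mem_right x (by simp [hx])
  simp only [List.length_reverse] at h5 h8 h9
  have := exists_cert h8 h9 ((G.mirror_val he₁).trans hv₁.symm) ((G.mirror_val he₂).trans hv₂.symm)
    (by rw [G.mirror_wt hm, h5]) (fun e he => by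
      rw [G.mirror_length_val he]
      exact (H.reachable he).mirror he) h4
  rw [List.length_take_of_le (by rw [List.length_reverse]; omega),
    List.length_take_of_le (by rw [List.length_reverse]; omega), h3] at this
  change G.mirror.Cert _ _ _ _ _ (LCE (G.val e₁).reverse (G.val e₂).reverse i j) at this
  refine this.mono ?_
  rw [G.mirror_length_val he₁, G.mirror_length_val he₂,
    show 6 * (deltaL W + 22) = 3 * (deltaL W + 22) + 3 * (deltaL W + 22) by ring, Nat.add_mul]
  unfold LCE
  omega

end IsLevels

end RunLengthACFG

/-! ### The final time bound. -/

/-- The time bound of the algorithm in terms of `M`. -/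
theorem certTime_le {K M W a b l : ℕ} (hW : W ≤ K * M) (hl : l ≤ M) :
    1000 * (6 * (deltaL W + 22) * Nat.log 2 l + 9 * a + 9 * b + 12 + 1) ≤
      1000 * (6 * Nat.clog 2 K + 200) * (a + b + Nat.log 2 l * logStar M + 1) := by
  have h1 : (deltaL W + 22) * Nat.log 2 l ≤
      (Nat.clog 2 K + 29) * (Nat.log 2 l * logStar M) := by
    -- For `l < 2` the logarithm vanishes. Otherwise `2 ≤ l ≤ M`, so `logStar M` is at least `1` and
    -- absorbs the additive constants: `28` from `deltaL W + 22` and `Nat.clog 2 K`.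
    rcases Nat.lt_or_ge l 2 with h | h
    · simp [Nat.log_of_lt h]
    · have h2 := logStar_le_add_clog hW
      have h3 : 1 ≤ logStar M := by rw [logStar_of_one_lt (by omega)]; omega
      have h4 : deltaL W + 22 ≤ (Nat.clog 2 K + 29) * logStar M := by
        unfold deltaL
        nlinarith
      calc _ ≤ (Nat.clog 2 K + 29) * logStar M * Nat.log 2 l := Nat.mul_le_mul_right _ h4
        _ = _ := by ring
  generalize Nat.log 2 l * logStar M = x at *
  rw [Nat.mul_assoc 6]
  generalize (deltaL W + 22) * Nat.log 2 l = y at *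
  generalize Nat.clog 2 K = k at *
  have h2 : (6 * k + 200) * (a + b + x + 1) =
      6 * ((k + 29) * x) + 26 * x + 6 * k * (a + b + 1) + 200 * (a + b + 1) := by ring
  rw [Nat.mul_assoc, h2]
  omega

theorem lcp_le_length {α : Type*} [DecidableEq α] (u v : List α) : lcp u v ≤ u.length := by
  obtain ⟨s, u', v', h1, -, h2, -⟩ := exists_of_lcp u v
  have := congrArg List.length h1
  rw [List.length_append] at this
  omega

theorem mainTheorem9 :
    ∃ (fwd bwd : Program) (k : ℕ), ∀ K : ℕ, ∃ C : ℕ,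
      ∀ (α : Type*) [DecidableEq α] (M W : ℕ) (f : WindowFun W)
        (G : RunLengthACFG α) (T : List α),
        IsLocallyConsistent f →
        W ≤ K * M → (∀ e ∈ G.vars, e ≤ W) →
        T.length ≤ M → G.IsSignatureEncoding f T →
      ∀ (b : ℕ) (input : BitVec b → BitVec b) (addr : ℕ → BitVec b),
        Nat.log 2 M + k ≤ b → HoldsDAG G input addr →
      ∀ e₁ ∈ G.vars, ∀ e₂ ∈ G.vars, ∀ i j : ℕ,
        1 ≤ i → i ≤ (G.val e₁).length → 1 ≤ j → j ≤ (G.val e₂).length →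
      ∀ c : Config b, IsQuery addr e₁ e₂ i j c →
        (∀ l : ℕ, l = LCE (G.val e₁) (G.val e₂) i j →
          ComputesWithin fwd input c l
            (C * (Nat.log 2 (G.val e₁).length + Nat.log 2 (G.val e₂).length
              + Nat.log 2 l * logStar M + 1))) ∧
        (∀ l : ℕ, l = LCE (G.val e₁).reverse (G.val e₂).reverse i j →
          ComputesWithin bwd input c l
            (C * (Nat.log 2 (G.val e₁).length + Nat.log 2 (G.val e₂).length
              + Nat.log 2 l * logStar M + 1))) := by
  refine ⟨lceProgram 1 2, lceProgram 2 1, 6, fun K => ⟨1000 * (6 * Nat.clog 2 K + 200), ?_⟩⟩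
  intro α _ M W f G T hf hWK hW hT hG b input addr hb hD e₁ he₁ e₂ he₂ i j hi hi' hj hj' c hc
  obtain ⟨h, shrink, pow, H⟩ := hG.exists_isLevels
  have hM₁ := (H.length_val_le he₁).trans hT
  have hM₂ := (H.length_val_le he₂).trans hT
  -- Six additional bits suffice: `M < 2 * 2 ^ log M`, so `4 * M + 32` is less than `40 * 2 ^ log
  -- M`. The factor `4` is the stride of the stacks.
  have hM : 4 * M + 32 ≤ 2 ^ b := by
    have h1 := Nat.lt_pow_succ_log_self (b := 2) (by omega) M
    have h2 : 2 ^ (Nat.log 2 M + 6) ≤ 2 ^ b := Nat.pow_le_pow_right (by omega) hb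
    rw [pow_add] at h2
    rw [pow_succ] at h1
    omega
  have hlce : LCE (G.val e₁) (G.val e₂) i j ≤ M := by
    refine (lcp_le_length _ _).trans ?_
    rw [List.length_drop]
    omega
  have hlce' : LCE (G.val e₁).reverse (G.val e₂).reverse i j ≤ M := by
    refine (lcp_le_length _ _).trans ?_
    rw [List.length_drop, List.length_reverse]
    omega
  constructor
  · rintro l rfl
    obtain ⟨t, ht, h1⟩ := lceProgram_correct hD.stored hM
      (fun e he y d hr => H.notRun_of_run he hr) he₁ he₂ hM₁ hM₂ hi hj
      (H.exists_cert_lce hf hW he₁ he₂ hi' hj') (by omega) hc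
    exact ⟨t, ht.trans (certTime_le hWK hlce), h1⟩
  · rintro l rfl
    obtain ⟨t, ht, h1⟩ := lceProgram_correct hD.stored_mirror hM
      (fun e he y d hr => G.mirror_notRun.2 (H.notRun_of_run he (G.rhs_of_mirror hr))) he₁ he₂
      (by rwa [G.mirror_length_val he₁]) (by rwa [G.mirror_length_val he₂])
      hi hj
      (H.exists_cert_lce_reverse hf hW he₁ he₂ hi' hj') (by omega) hc
    exact ⟨t, ht.trans (certTime_le hWK hlce'), h1⟩
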